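/- **Proposition 8 (confluence of the call-by-value $\lambda\Box$-calculus).** Types are $\sigma ::= p \mid \sigma\supset\sigma \mid \Box\sigma$, where $p$ ranges over type constants. Terms $M$ and values $V$ of the call-by-value $\lambda\Box$-calculus are given, up to $\alpha$-equivalence, by $$M ::= c^{\sigma} \mid x \mid \lambda x^{\sigma}.M \mid MM \mid \mathrm{box}\ x_1^{\sigma_1},\dots,x_n^{\sigma_n} = M_1,\dots,M_n\ \mathrm{in}\ V,$$ $$V ::= c^{\sigma} \mid x \mid \lambda x^{\sigma}.M \mid \mathrm{box}\ x_1^{\sigma_1},\dots,x_n^{\sigma_n} = V_1,\dots,V_n\ \mathrm{in}\ V \qquad (n\ge 0),$$ where $c$ ranges over constants and the $x_i$ are bound in the body of the box; the free variables of a box are those of $M_1,\dots,M_n$. The typing rules are those of the simply typed $\lambda$-calculus, with $\Gamma\vdash c^{\tau}:\tau$ for every constant, together with the rule: if $x_1:\sigma_1,\dots,x_n:\sigma_n\vdash M:\tau$ and $\Gamma\vdash N_i:\Box\sigma_i$ for $1\le i\le n$, then $\Gamma\vdash \mathrm{box}\ \vec x^{\vec\sigma}=\vec N\ \mathrm{in}\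 M:\Box\tau$. Simple evaluation contexts $C$ and evaluation contexts $E$ are $$C ::= -\,M \mid V\,- \mid \mathrm{box}\ \vec x = V,\dots,V,-,M,\dots,M\ \mathrm{in}\ V,\qquad E ::= - \mid C[E].$$ Let $\to_{\mathsf v}$ be the closure under all term constructors (reduction inside the body of an abstraction or of a box included) of the following rules on typed terms, where $V, W$ are values and $y$ is a variable or a constant: - $(\lambda x.x)M \to M$; - $(\lambda x.M)V \to M[x:=V]$; - $\lambda x.Vx \to V$ if $x\notin FV(V)$; - $C[(\lambda x.M)N] \to (\lambda x.C[M])N$, where $x$ is not free in $C$; - $C[yM] \to (\lambda x.C[x])(yM)$ if $C$ is not of the form $V\,-$, where $x$ is not free in $C$ and is annotated with the type of $yM$; - $(\lambda x.E[yx])M \to E[yM]$ if $x\notin FV(E[y])$; - $\mathrm{box}\ x = M\ \mathrm{in}\ x \to M$; - $\mathrm{box}\ \vec w,x,\vec z = \vec W,(\mathrm{box}\ \vec y=\vec N\ \mathrm{in}\ V),\vec P\ \mathrm{in}\ M \to \mathrm{box}\ \vec w,\vec y,\vec z=\vec W,\vec N,\vec P\ \mathrm{in}\ M[x:=V]$ if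 $|\vec w|=|\vec W|$. Then $\to_{\mathsf v}$ is confluent on typable terms: if $\Gamma\vdash M:\tau$, $M\to_{\mathsf v}^{*}N_1$ and $M\to_{\mathsf v}^{*}N_2$, then there is a term $L$ with $N_1\to_{\mathsf v}^{*}L$ and $N_2\to_{\mathsf v}^{*}L$. -/

import Mathlib

namespace LambdaBox

universe u v

/-- Types `σ ::= p | σ ⊃ σ | □σ` over a set `P` of type constants. -/
inductive Ty (P : Type u) : Type u
  | base (p : P) : Ty P
  | imp (σ τ : Ty P) : Ty P
  | box (σ : Ty P) : Ty P

/-- Terms `M ::= c | x | λx^σ. M | M M | box x₁^σ₁, …, xₙ^σₙ = N₁, …, Nₙ in M`, up to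
`α`-equivalence (de Bruijn indices).  A constant `c` carries its type.  In `lam σ M`, index `0`
of `M` is the bound variable.  In `box σs Ns M`, index `i` of `M` is the variable `xᵢ` that is
bound to the `i`-th entry of `Ns`; the free variables of `box σs Ns M` are those of `Ns`, so the
body has a scope of its own. -/
inductive Tm (P : Type u) (K : Type v) : Type (max u v)
  | con (c : K) (σ : Ty P) : Tm P K
  | var (i : ℕ) : Tm P K
  | lam (σ : Ty P) (M : Tm P K) : Tm P K
  | app (M N : Tm P K) : Tm P K
  | box (σs : List (Ty P)) (Ns : List (Tm P K)) (M : Tm P K) : Tm P K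

variable {P : Type u} {K : Type v}

/-- The typing rules; the `i`-th entry of `Γ` is the type of the variable with index `i`. -/
inductive HasType : List (Ty P) → Tm P K → Ty P → Prop
  | con (Γ : List (Ty P)) (c : K) (τ : Ty P) : HasType Γ (Tm.con c τ) τ
  | var (Γ : List (Ty P)) (i : ℕ) (τ : Ty P) (h : Γ[i]? = some τ) : HasType Γ (Tm.var i) τ
  | lam (Γ : List (Ty P)) (σ τ : Ty P) (M : Tm P K) (hM : HasType (σ :: Γ) M τ) :
      HasType Γ (Tm.lam σ M) (Ty.imp σ τ)
  | app (Γ : List (Ty P)) (σ τ : Ty P) (M N : Tm P K) (hM : HasType Γ M (Ty.imp σ τ))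
      (hN : HasType Γ N σ) : HasType Γ (Tm.app M N) τ
  | box (Γ σs : List (Ty P)) (τ : Ty P) (Ns : List (Tm P K)) (M : Tm P K)
      (hM : HasType σs M τ) (hlen : Ns.length = σs.length)
      (hN : ∀ p ∈ Ns.zip σs, HasType Γ p.1 (Ty.box p.2)) :
      HasType Γ (Tm.box σs Ns M) (Ty.box τ)

/-- Values `V ::= c | x | λx^σ. M | box x⃗ = V, …, V in M`. -/
inductive IsValue : Tm P K → Prop
  | con (c : K) (σ : Ty P) : IsValue (Tm.con c σ)
  | var (i : ℕ) : IsValue (Tm.var i)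
  | lam (σ : Ty P) (M : Tm P K) : IsValue (Tm.lam σ M)
  | box (σs : List (Ty P)) (Vs : List (Tm P K)) (M : Tm P K) (h : ∀ V ∈ Vs, IsValue V) :
      IsValue (Tm.box σs Vs M)

/-- The terms of the call-by-value calculus, in which the body of each box is a value:
`M ::= c | x | λx^σ. M | M M | box x⃗ = M, …, M in V`. -/
inductive IsCbvTerm : Tm P K → Prop
  | con (c : K) (σ : Ty P) : IsCbvTerm (Tm.con c σ)
  | var (i : ℕ) : IsCbvTerm (Tm.var i)
  | lam (σ : Ty P) (M : Tm P K) (hM : IsCbvTerm M) : IsCbvTerm (Tm.lam σ M)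
  | app (M N : Tm P K) (hM : IsCbvTerm M) (hN : IsCbvTerm N) : IsCbvTerm (Tm.app M N)
  | box (σs : List (Ty P)) (Ns : List (Tm P K)) (V : Tm P K) (hN : ∀ N ∈ Ns, IsCbvTerm N)
      (hV : IsCbvTerm V) (hval : IsValue V) : IsCbvTerm (Tm.box σs Ns V)

/-- A renaming lifted under one binder. -/
def upRen (f : ℕ → ℕ) : ℕ → ℕ
  | 0 => 0
  | i + 1 => f i + 1

mutual
  /-- Renaming of free variables. -/
  def Tm.rename (f : ℕ → ℕ) : Tm P K → Tm P K
    | Tm.con c σ => Tm.con c σ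
    | Tm.var i => Tm.var (f i)
    | Tm.lam σ M => Tm.lam σ (Tm.rename (upRen f) M)
    | Tm.app M N => Tm.app (Tm.rename f M) (Tm.rename f N)
    | Tm.box σs Ns M => Tm.box σs (Tm.renameList f Ns) M
  /-- Renaming of free variables in a list of terms. -/
  def Tm.renameList (f : ℕ → ℕ) : List (Tm P K) → List (Tm P K)
    | [] => []
    | N :: Ns => Tm.rename f N :: Tm.renameList f Ns
end

/-- A term regarded under one more binder, whose variable does not occur in it. -/
def Tm.weaken (M : Tm P K) : Tm P K := M.rename Nat.succ

/-- A substitution lifted under one binder. -/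
def upSubst (s : ℕ → Tm P K) : ℕ → Tm P K
  | 0 => Tm.var 0
  | i + 1 => (s i).weaken

mutual
  /-- Simultaneous capture-avoiding substitution for the free variables. -/
  def Tm.subst (s : ℕ → Tm P K) : Tm P K → Tm P K
    | Tm.con c σ => Tm.con c σ
    | Tm.var i => s i
    | Tm.lam σ M => Tm.lam σ (Tm.subst (upSubst s) M)
    | Tm.app M N => Tm.app (Tm.subst s M) (Tm.subst s N)
    | Tm.box σs Ns M => Tm.box σs (Tm.substList s Ns) M
  /-- Simultaneous capture-avoiding substitution in a list of terms. -/
  def Tm.substList (s : ℕ → Tm P K) : List (Tm P K) → List (Tm P K)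
    | [] => []
    | N :: Ns => Tm.subst s N :: Tm.substList s Ns
end

/-- `M[x := N]` for the body `M` of an abstraction `λx. M`. -/
def Tm.inst (M N : Tm P K) : Tm P K :=
  M.subst fun
    | 0 => N
    | i + 1 => Tm.var i

/-- `M[x := V]` for the body `M` of `box w⃗, x, z⃗ = … in M` and the body `V` of
`box y⃗ = … in V`, as the body of a box that binds `w⃗, y⃗, z⃗`.  Here `a` is the length of `w⃗`
and `b` is the length of `y⃗`. -/
def Tm.instBox (a b : ℕ) (M V : Tm P K) : Tm P K :=
  M.subst fun i =>
    if i < a then Tm.var i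
    else if i = a then V.rename fun j => a + j
    else Tm.var (i - 1 + b)

/-- The shapes of simple evaluation contexts: `- M`, `V -`, and
`box x⃗ = V, …, V, -, M, …, M in L`. -/
inductive Frame (P : Type u) (K : Type v) : Type (max u v)
  | appL (M : Tm P K) : Frame P K
  | appR (V : Tm P K) : Frame P K
  | box (σs : List (Ty P)) (Vs Ms : List (Tm P K)) (L : Tm P K) : Frame P K

/-- `C` is a simple evaluation context: the terms before the hole are values. -/
def Frame.IsSimple : Frame P K → Prop
  | Frame.appL _ => True
  | Frame.appR V => IsValue V
  | Frame.box _ Vs _ _ => ∀ V ∈ Vs, IsValue V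

/-- `C[N]`. -/
def Frame.fill : Frame P K → Tm P K → Tm P K
  | Frame.appL M, N => Tm.app N M
  | Frame.appR V, N => Tm.app V N
  | Frame.box σs Vs Ms L, N => Tm.box σs (Vs ++ N :: Ms) L

/-- A context regarded under one more binder, whose variable does not occur in it. -/
def Frame.weaken : Frame P K → Frame P K
  | Frame.appL M => Frame.appL M.weaken
  | Frame.appR V => Frame.appR V.weaken
  | Frame.box σs Vs Ms L =>
      Frame.box σs (Tm.renameList Nat.succ Vs) (Tm.renameList Nat.succ Ms) L

/-- The shapes of evaluation contexts `E ::= - | C[E]`. -/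
inductive ECtx (P : Type u) (K : Type v) : Type (max u v)
  | hole : ECtx P K
  | comp (C : Frame P K) (E : ECtx P K) : ECtx P K

/-- `E` is an evaluation context: each of its layers is a simple evaluation context. -/
def ECtx.IsEval : ECtx P K → Prop
  | ECtx.hole => True
  | ECtx.comp C E => C.IsSimple ∧ E.IsEval

/-- `E[N]`. -/
def ECtx.fill : ECtx P K → Tm P K → Tm P K
  | ECtx.hole, N => N
  | ECtx.comp C E, N => C.fill (E.fill N)

/-- An evaluation context regarded under one more binder, whose variable does not occur in it. -/
def ECtx.weaken : ECtx P K → ECtx P K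
  | ECtx.hole => ECtx.hole
  | ECtx.comp C E => ECtx.comp C.weaken E.weaken

/-- Atoms: variables and constants. -/
inductive IsAtom : Tm P K → Prop
  | con (c : K) (σ : Ty P) : IsAtom (Tm.con c σ)
  | var (i : ℕ) : IsAtom (Tm.var i)

/-- The call-by-value reduction rules, for terms in the typing context `Γ`.  The context is used
only for the type of the variable that `flat` introduces. -/
inductive Rule (Γ : List (Ty P)) : Tm P K → Tm P K → Prop
  /-- `(λx. x) M → M` -/
  | idImp (σ : Ty P) (M : Tm P K) : Rule Γ (Tm.app (Tm.lam σ (Tm.var 0)) M) M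
  /-- `(λx. M) V → M[x := V]` -/
  | betaImp (σ : Ty P) (M V : Tm P K) (hV : IsValue V) :
      Rule Γ (Tm.app (Tm.lam σ M) V) (M.inst V)
  /-- `λx. V x → V` if `x` is not free in `V` -/
  | etaImp (σ : Ty P) (V : Tm P K) (hV : IsValue V) :
      Rule Γ (Tm.lam σ (Tm.app V.weaken (Tm.var 0))) V
  /-- `C[(λx. M) N] → (λx. C[M]) N` -/
  | lift (C : Frame P K) (σ : Ty P) (M N : Tm P K) (hC : C.IsSimple) :
      Rule Γ (C.fill (Tm.app (Tm.lam σ M) N)) (Tm.app (Tm.lam σ (C.weaken.fill M)) N)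
  /-- `C[y M] → (λx. C[x]) (y M)` if `C` is not of the form `V -` -/
  | flat (C : Frame P K) (σ : Ty P) (y M : Tm P K) (hy : IsAtom y) (hC : C.IsSimple)
      (hne : ∀ V : Tm P K, C ≠ Frame.appR V) (hσ : HasType Γ (Tm.app y M) σ) :
      Rule Γ (C.fill (Tm.app y M))
        (Tm.app (Tm.lam σ (C.weaken.fill (Tm.var 0))) (Tm.app y M))
  /-- `(λx. E[y x]) M → E[y M]` if `x` is not free in `E[y]` -/
  | betaOmega (E : ECtx P K) (σ : Ty P) (y M : Tm P K) (hy : IsAtom y) (hE : E.IsEval) :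
      Rule Γ (Tm.app (Tm.lam σ (E.weaken.fill (Tm.app y.weaken (Tm.var 0)))) M)
        (E.fill (Tm.app y M))
  /-- `box x = M in x → M` -/
  | idBox (σ : Ty P) (M : Tm P K) : Rule Γ (Tm.box [σ] [M] (Tm.var 0)) M
  /-- `box w⃗, x, z⃗ = W⃗, (box y⃗ = N⃗ in V), P⃗ in M → box w⃗, y⃗, z⃗ = W⃗, N⃗, P⃗ in M[x := V]`
  if `w⃗` and `W⃗` have the same length -/
  | betaBox (ws ys zs : List (Ty P)) (σ : Ty P) (Ws Ns Ps : List (Tm P K)) (V M : Tm P K)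
      (hWs : ∀ W ∈ Ws, IsValue W) (hV : IsValue V) (hlen : ws.length = Ws.length) :
      Rule Γ (Tm.box (ws ++ σ :: zs) (Ws ++ Tm.box ys Ns V :: Ps) M)
        (Tm.box (ws ++ ys ++ zs) (Ws ++ Ns ++ Ps) (M.instBox ws.length ys.length V))

/-- One-step call-by-value reduction of terms in the typing context `Γ`: a rule is applied to
some subterm. -/
inductive Step : List (Ty P) → Tm P K → Tm P K → Prop
  | rule (Γ : List (Ty P)) (M N : Tm P K) (h : Rule Γ M N) : Step Γ M N
  | lam (Γ : List (Ty P)) (σ : Ty P) (M M' : Tm P K) (h : Step (σ :: Γ) M M') :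
      Step Γ (Tm.lam σ M) (Tm.lam σ M')
  | appL (Γ : List (Ty P)) (M M' N : Tm P K) (h : Step Γ M M') :
      Step Γ (Tm.app M N) (Tm.app M' N)
  | appR (Γ : List (Ty P)) (M N N' : Tm P K) (h : Step Γ N N') :
      Step Γ (Tm.app M N) (Tm.app M N')
  | boxArg (Γ σs : List (Ty P)) (Ls Rs : List (Tm P K)) (N N' M : Tm P K) (h : Step Γ N N') :
      Step Γ (Tm.box σs (Ls ++ N :: Rs) M) (Tm.box σs (Ls ++ N' :: Rs) M)
  | boxBody (Γ σs : List (Ty P)) (Ns : List (Tm P K)) (M M' : Tm P K) (h : Step σs M M') :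
      Step Γ (Tm.box σs Ns M) (Tm.box σs Ns M')

/-- `M →* N`: the reflexive transitive closure of one-step call-by-value reduction. -/
def Steps (Γ : List (Ty P)) : Tm P K → Tm P K → Prop := Relation.ReflTransGen (Step Γ)

end LambdaBox

namespace LambdaBox

universe u v

variable {P : Type u} {K : Type v}

-- Confluence follows from a map `nf` on typed terms such that `M` reduces to `nf M`
-- (`HasType.steps_nf`) and reduction does not change `nf` (`Steps.nf_eq`): then `nf M` is a common
-- reduct of all reducts of `M`. Neither termination nor normality of `nf M` is needed. The map is
-- built by normalisation by evaluation.
--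
-- The model. A term denotes a computation (`Comp`): a finite sequence of calls of atoms on values,
-- each binding its result, followed by a returned denotation. Function types denote functions into
-- computations. Since a typed value of type `□σ` is an atom or a box, and nested boxes merge, `□σ`
-- denotes a flat list of atoms together with a body. In this model every rule becomes an equation
-- (`Rule.eval_eq`): `lift`, `flat` and `betaOmega` express that an evaluation context runs the term
-- in its hole first, and the remaining rules are unit laws, extensionality and substitution.
--
-- Reading back. `reify` turns a sequence of calls into nested redexes `(λx. L) (a W)`. The
-- `η`-rule, the identity rules and `betaOmega` only contract, so an atom does not reduce to its
-- `η`-expansion and `E[y (a W)]` need not reduce to `(λx. E[y x]) (a W)`. Hence read-back uses the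
-- constructors `etaLam`, `idBox` and `slet`, which contract wherever they can.
--
-- Reachability. A Kripke logical relation (`RV` for values, `RC` for computations) says that a term
-- reduces to something of the shape its denotation describes. `RC.bind` evaluates a term inside a
-- simple context, `HasType.rc_eval` is the fundamental theorem, and `RV.reflect_reify` and
-- `RC.steps` extract the reduction to the read-back. The delicate case is a call that is the
-- argument of an atom, `E[y (a W)]`: what remains to be computed is described by `E[y x]`, and
-- `Step.replace` replays its reductions with `a W` in place of `x`.

-- Renaming and substitution of terms

theorem Tm.ind {p : Tm P K → Prop} (hcon : ∀ c σ, p (.con c σ)) (hvar : ∀ i, p (.var i))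
    (hlam : ∀ σ M, p M → p (.lam σ M)) (happ : ∀ M N, p M → p N → p (.app M N))
    (hbox : ∀ σs Ns M, (∀ N ∈ Ns, p N) → p M → p (.box σs Ns M)) (M : Tm P K) : p M :=
  Tm.rec (motive_1 := p) (motive_2 := fun Ns => ∀ N ∈ Ns, p N) hcon hvar hlam happ hbox
    (by simp) (fun N Ns h₁ h₂ => by simpa using ⟨h₁, h₂⟩) M

@[simp] theorem renameList_eq_map (f : ℕ → ℕ) (Ns : List (Tm P K)) :
    Tm.renameList f Ns = Ns.map (Tm.rename f) := by
  induction Ns with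
  | nil => simp [Tm.renameList]
  | cons N Ns ih => simp [Tm.renameList, ih]

@[simp] theorem substList_eq_map (s : ℕ → Tm P K) (Ns : List (Tm P K)) :
    Tm.substList s Ns = Ns.map (Tm.subst s) := by
  induction Ns with
  | nil => simp [Tm.substList]
  | cons N Ns ih => simp [Tm.substList, ih]

section equations
variable (f : ℕ → ℕ) (s : ℕ → Tm P K)

@[simp] theorem rename_con (c : K) (σ : Ty P) : (Tm.con c σ).rename f = .con c σ := by
  simp [Tm.rename]
@[simp] theorem rename_var (i : ℕ) : (Tm.var i : Tm P K).rename f = .var (f i) := by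
  simp [Tm.rename]
@[simp] theorem rename_lam (σ : Ty P) (M : Tm P K) :
    (Tm.lam σ M).rename f = .lam σ (M.rename (upRen f)) := by
  simp [Tm.rename]
@[simp] theorem rename_app (M N : Tm P K) :
    (Tm.app M N).rename f = .app (M.rename f) (N.rename f) := by
  simp [Tm.rename]
@[simp] theorem rename_box (σs : List (Ty P)) (Ns : List (Tm P K)) (M : Tm P K) :
    (Tm.box σs Ns M).rename f = .box σs (Ns.map (Tm.rename f)) M := by
  simp [Tm.rename]
@[simp] theorem subst_con (c : K) (σ : Ty P) : (Tm.con c σ).subst s = .con c σ := by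
  simp [Tm.subst]
@[simp] theorem subst_var (i : ℕ) : (Tm.var i : Tm P K).subst s = s i := by
  simp [Tm.subst]
@[simp] theorem subst_lam (σ : Ty P) (M : Tm P K) :
    (Tm.lam σ M).subst s = .lam σ (M.subst (upSubst s)) := by
  simp [Tm.subst]
@[simp] theorem subst_app (M N : Tm P K) :
    (Tm.app M N).subst s = .app (M.subst s) (N.subst s) := by
  simp [Tm.subst]
@[simp] theorem subst_box (σs : List (Ty P)) (Ns : List (Tm P K)) (M : Tm P K) :
    (Tm.box σs Ns M).subst s = .box σs (Ns.map (Tm.subst s)) M := by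
  simp [Tm.subst]
@[simp] theorem upRen_zero : upRen f 0 = 0 := rfl
@[simp] theorem upRen_succ (i : ℕ) : upRen f (i + 1) = f i + 1 := rfl
@[simp] theorem upSubst_zero : upSubst s 0 = .var 0 := rfl
@[simp] theorem upSubst_succ (i : ℕ) : upSubst s (i + 1) = (s i).weaken := rfl

end equations

theorem map_eq_self {α : Type*} {f : α → α} {l : List α} (h : ∀ x ∈ l, f x = x) :
    l.map f = l := by
  conv_rhs => rw [← List.map_id l]
  exact List.map_congr_left h

theorem upRen_id : upRen id = id := by
  funext i; cases i <;> simp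

theorem upRen_comp (f g : ℕ → ℕ) : upRen (g ∘ f) = upRen g ∘ upRen f := by
  funext i; cases i <;> simp

@[simp] theorem rename_id (M : Tm P K) : M.rename id = M := by
  induction M using Tm.ind with
  | hcon => simp
  | hvar => simp
  | hlam σ M ih => simp [upRen_id, ih]
  | happ M N ihM ihN => simp [ihM, ihN]
  | hbox σs Ns M ihN ihM => simpa using map_eq_self ihN

theorem rename_rename (f g : ℕ → ℕ) (M : Tm P K) :
    (M.rename f).rename g = M.rename (g ∘ f) := by
  induction M using Tm.ind generalizing f g with
  | hcon => simp
  | hvar => simp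
  | hlam σ M ih => simp [upRen_comp, ih]
  | happ M N ihM ihN => simp [ihM, ihN]
  | hbox σs Ns M ihN ihM => simpa using fun N hN => ihN N hN f g

theorem weaken_rename (f : ℕ → ℕ) (M : Tm P K) :
    M.weaken.rename (upRen f) = (M.rename f).weaken := by
  simp only [Tm.weaken, rename_rename]; rfl

theorem subst_rename (f : ℕ → ℕ) (s : ℕ → Tm P K) (M : Tm P K) :
    (M.rename f).subst s = M.subst (s ∘ f) := by
  induction M using Tm.ind generalizing f s with
  | hcon => simp
  | hvar => simp
  | hlam σ M ih =>
    simp only [rename_lam, subst_lam, ih]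
    congr 2
    funext i; cases i <;> simp
  | happ M N ihM ihN => simp [ihM, ihN]
  | hbox σs Ns M ihN ihM => simpa using fun N hN => ihN N hN f s

theorem rename_subst (f : ℕ → ℕ) (s : ℕ → Tm P K) (M : Tm P K) :
    (M.subst s).rename f = M.subst fun i => (s i).rename f := by
  induction M using Tm.ind generalizing f s with
  | hcon => simp
  | hvar => simp
  | hlam σ M ih =>
    simp only [rename_lam, subst_lam, ih]
    congr 2
    funext i; cases i <;> simp [weaken_rename]
  | happ M N ihM ihN => simp [ihM, ihN]
  | hbox σs Ns M ihN ihM => simpa using fun N hN => ihN N hN f s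

theorem weaken_subst (s : ℕ → Tm P K) (M : Tm P K) :
    M.weaken.subst (upSubst s) = (M.subst s).weaken := by
  simp only [Tm.weaken, subst_rename, rename_subst]; rfl

theorem subst_subst (s t : ℕ → Tm P K) (M : Tm P K) :
    (M.subst s).subst t = M.subst fun i => (s i).subst t := by
  induction M using Tm.ind generalizing s t with
  | hcon => simp
  | hvar => simp
  | hlam σ M ih =>
    simp only [subst_lam, ih]
    congr 2
    funext i; cases i <;> simp [weaken_subst]
  | happ M N ihM ihN => simp [ihM, ihN]
  | hbox σs Ns M ihN ihM => simpa using fun N hN => ihN N hN s t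

theorem upSubst_var : upSubst (Tm.var : ℕ → Tm P K) = Tm.var := by
  funext i; cases i <;> simp [Tm.weaken]

@[simp] theorem subst_var_eq (M : Tm P K) : M.subst Tm.var = M := by
  induction M using Tm.ind with
  | hcon => simp
  | hvar => simp
  | hlam σ M ih => simp [upSubst_var, ih]
  | happ M N ihM ihN => simp [ihM, ihN]
  | hbox σs Ns M ihN ihM => simpa using map_eq_self ihN

theorem rename_eq_subst (f : ℕ → ℕ) (M : Tm P K) : M.rename f = M.subst fun i => .var (f i) := by
  have := subst_rename f Tm.var M
  rwa [subst_var_eq] at this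

/-- The substitution that instantiates the variable of an abstraction. -/
def scons (N : Tm P K) (s : ℕ → Tm P K) : ℕ → Tm P K
  | 0 => N
  | i + 1 => s i

@[simp] theorem scons_zero (N : Tm P K) (s : ℕ → Tm P K) : scons N s 0 = N := rfl
@[simp] theorem scons_succ (N : Tm P K) (s : ℕ → Tm P K) (i : ℕ) : scons N s (i + 1) = s i := rfl

theorem inst_eq (M N : Tm P K) : M.inst N = M.subst (scons N Tm.var) := by
  unfold Tm.inst
  congr 1

@[simp] theorem weaken_inst (M N : Tm P K) : M.weaken.inst N = M := by
  rw [inst_eq, Tm.weaken, subst_rename]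
  exact subst_var_eq M

theorem weaken_injective : Function.Injective (Tm.weaken : Tm P K → Tm P K) := fun M N h => by
  rw [← weaken_inst M (.var 0), h, weaken_inst]

theorem inst_rename (f : ℕ → ℕ) (M N : Tm P K) :
    (M.inst N).rename f = (M.rename (upRen f)).inst (N.rename f) := by
  simp only [inst_eq, rename_subst, subst_rename]
  congr 1
  funext i; cases i <;> simp

theorem inst_subst (s : ℕ → Tm P K) (M N : Tm P K) :
    (M.subst (upSubst s)).inst N = M.subst (scons N s) := by
  simp only [inst_eq, subst_subst]
  congr 1
  funext i; cases i
  · simp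
  · simp only [upSubst_succ, scons_succ]
    rw [← inst_eq, weaken_inst]

theorem rename_upRen_succ_inst (M : Tm P K) : (M.rename (upRen Nat.succ)).inst (.var 0) = M := by
  rw [inst_eq, subst_rename]
  convert subst_var_eq M using 2
  funext i; cases i <;> simp

-- Renaming of contexts; values and atoms

/-- Renaming of free variables in a context. -/
def Frame.rename (f : ℕ → ℕ) : Frame P K → Frame P K
  | .appL M => .appL (M.rename f)
  | .appR V => .appR (V.rename f)
  | .box σs Vs Ms L => .box σs (Vs.map (Tm.rename f)) (Ms.map (Tm.rename f)) L

/-- Renaming of free variables in an evaluation context. -/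
def ECtx.rename (f : ℕ → ℕ) : ECtx P K → ECtx P K
  | .hole => .hole
  | .comp C E => .comp (C.rename f) (E.rename f)

theorem Frame.weaken_eq (C : Frame P K) : C.weaken = C.rename Nat.succ := by
  cases C <;> simp [Frame.weaken, Frame.rename, Tm.weaken]

theorem ECtx.weaken_eq (E : ECtx P K) : E.weaken = E.rename Nat.succ := by
  induction E with
  | hole => rfl
  | comp C E ih => simp [ECtx.weaken, ECtx.rename, ih, Frame.weaken_eq]

theorem Frame.rename_fill (f : ℕ → ℕ) (C : Frame P K) (M : Tm P K) :
    (C.fill M).rename f = (C.rename f).fill (M.rename f) := by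
  cases C <;> simp [Frame.fill, Frame.rename]

theorem ECtx.rename_fill (f : ℕ → ℕ) (E : ECtx P K) (M : Tm P K) :
    (E.fill M).rename f = (E.rename f).fill (M.rename f) := by
  induction E with
  | hole => rfl
  | comp C E ih => simp [ECtx.fill, ECtx.rename, ih, Frame.rename_fill]

theorem Frame.rename_rename (f g : ℕ → ℕ) (C : Frame P K) :
    (C.rename f).rename g = C.rename (g ∘ f) := by
  cases C <;> simp [Frame.rename, LambdaBox.rename_rename]

theorem ECtx.rename_rename (f g : ℕ → ℕ) (E : ECtx P K) :
    (E.rename f).rename g = E.rename (g ∘ f) := by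
  induction E with
  | hole => rfl
  | comp C E ih => simp [ECtx.rename, ih, Frame.rename_rename]

theorem Frame.weaken_rename (f : ℕ → ℕ) (C : Frame P K) :
    C.weaken.rename (upRen f) = (C.rename f).weaken := by
  simp only [Frame.weaken_eq, Frame.rename_rename]; rfl

theorem ECtx.weaken_rename (f : ℕ → ℕ) (E : ECtx P K) :
    E.weaken.rename (upRen f) = (E.rename f).weaken := by
  simp only [ECtx.weaken_eq, ECtx.rename_rename]; rfl

@[simp] theorem Frame.rename_id (C : Frame P K) : C.rename id = C := by
  cases C <;> simp [Frame.rename, map_eq_self]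

theorem Frame.weaken_fill_inst (C : Frame P K) (M N : Tm P K) :
    (C.weaken.fill M).inst N = C.fill (M.inst N) := by
  have h (Ms : List (Tm P K)) : Ms.map (fun x => (x.rename Nat.succ).subst (scons N Tm.var)) = Ms := by
    refine map_eq_self fun M _ => ?_
    rw [← inst_eq]; exact weaken_inst M N
  have h' (M : Tm P K) : M.weaken.subst (scons N Tm.var) = M := by rw [← inst_eq, weaken_inst]
  cases C <;> simp [inst_eq, Frame.weaken, Frame.fill, h, h', Function.comp_def]

theorem ECtx.weaken_fill_inst (E : ECtx P K) (M N : Tm P K) :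
    (E.weaken.fill M).inst N = E.fill (M.inst N) := by
  induction E with
  | hole => rfl
  | comp C E ih => simp [ECtx.fill, ECtx.weaken, Frame.weaken_fill_inst, ih]

theorem IsValue.rename {V : Tm P K} (h : IsValue V) (f : ℕ → ℕ) : IsValue (V.rename f) := by
  induction h with
  | con => simpa using IsValue.con _ _
  | var => simpa using IsValue.var _
  | lam => simpa using IsValue.lam _ _
  | box σs Vs M h ih =>
    rw [rename_box]
    refine .box _ _ _ fun V hV => ?_
    obtain ⟨W, hW, rfl⟩ := List.mem_map.1 hV
    exact ih W hW

theorem IsValue.subst {V : Tm P K} (h : IsValue V) {s : ℕ → Tm P K} (hs : ∀ i, IsValue (s i)) :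
    IsValue (V.subst s) := by
  induction h with
  | con => simpa using IsValue.con _ _
  | var => simpa using hs _
  | lam => simpa using IsValue.lam _ _
  | box σs Vs M h ih =>
    rw [subst_box]
    refine .box _ _ _ fun V hV => ?_
    obtain ⟨W, hW, rfl⟩ := List.mem_map.1 hV
    exact ih W hW

theorem IsAtom.isValue {y : Tm P K} (h : IsAtom y) : IsValue y := by
  cases h
  · exact .con _ _
  · exact .var _

theorem IsAtom.rename {y : Tm P K} (h : IsAtom y) (f : ℕ → ℕ) : IsAtom (y.rename f) := by
  cases h
  · simpa using IsAtom.con _ _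
  · simpa using IsAtom.var _

theorem not_isValue_app {M N : Tm P K} : ¬ IsValue (.app M N) := nofun

theorem isValue_box {σs : List (Ty P)} {Ns : List (Tm P K)} {M : Tm P K} :
    IsValue (.box σs Ns M) ↔ ∀ N ∈ Ns, IsValue N :=
  ⟨fun h => by cases h; assumption, .box _ _ _⟩

theorem Frame.IsSimple.rename {C : Frame P K} (h : C.IsSimple) (f : ℕ → ℕ) :
    (C.rename f).IsSimple := by
  cases C with
  | appL => trivial
  | appR => exact IsValue.rename h f
  | box σs Vs Ms L =>
    intro V hV
    obtain ⟨W, hW, rfl⟩ := List.mem_map.1 hV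
    exact IsValue.rename (h W hW) f

theorem ECtx.IsEval.rename {E : ECtx P K} (h : E.IsEval) (f : ℕ → ℕ) : (E.rename f).IsEval := by
  induction E with
  | hole => trivial
  | comp C E ih => exact ⟨h.1.rename f, ih h.2⟩

theorem Frame.IsSimple.weaken {C : Frame P K} (h : C.IsSimple) : C.weaken.IsSimple :=
  C.weaken_eq ▸ h.rename _

theorem ECtx.IsEval.weaken {E : ECtx P K} (h : E.IsEval) : E.weaken.IsEval :=
  E.weaken_eq ▸ h.rename _

-- Free variables

/-- The free variables of a term satisfy `S`. -/
inductive Scoped : (ℕ → Prop) → Tm P K → Prop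
  | con (S : ℕ → Prop) (c : K) (σ : Ty P) : Scoped S (.con c σ)
  | var (S : ℕ → Prop) (i : ℕ) (h : S i) : Scoped S (.var i)
  | lam (S : ℕ → Prop) (σ : Ty P) (M : Tm P K) (h : Scoped (fun i => ∀ j, i = j + 1 → S j) M) :
      Scoped S (.lam σ M)
  | app (S : ℕ → Prop) (M N : Tm P K) (hM : Scoped S M) (hN : Scoped S N) : Scoped S (.app M N)
  | box (S : ℕ → Prop) (σs : List (Ty P)) (Ns : List (Tm P K)) (M : Tm P K)
      (h : ∀ N ∈ Ns, Scoped S N) : Scoped S (.box σs Ns M)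

theorem scoped_con {S : ℕ → Prop} {c : K} {σ : Ty P} : Scoped S (Tm.con c σ) := .con _ _ _

theorem scoped_var {S : ℕ → Prop} {i : ℕ} : Scoped S (.var i : Tm P K) ↔ S i :=
  ⟨fun h => by cases h; assumption, .var _ _⟩

theorem scoped_lam {S : ℕ → Prop} {σ : Ty P} {M : Tm P K} :
    Scoped S (.lam σ M) ↔ Scoped (fun i => ∀ j, i = j + 1 → S j) M :=
  ⟨fun h => by cases h; assumption, .lam _ _ _⟩

theorem scoped_app {S : ℕ → Prop} {M N : Tm P K} : Scoped S (.app M N) ↔ Scoped S M ∧ Scoped S N :=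
  ⟨fun h => by cases h; constructor <;> assumption, fun h => .app _ _ _ h.1 h.2⟩

theorem scoped_box {S : ℕ → Prop} {σs : List (Ty P)} {Ns : List (Tm P K)} {M : Tm P K} :
    Scoped S (.box σs Ns M) ↔ ∀ N ∈ Ns, Scoped S N :=
  ⟨fun h => by cases h; assumption, .box _ _ _ _⟩

theorem Scoped.mono {S T : ℕ → Prop} {M : Tm P K} (h : Scoped S M) (hST : ∀ i, S i → T i) :
    Scoped T M := by
  induction h generalizing T with
  | con => exact .con _ _ _
  | var S i h => exact .var _ _ (hST i h)
  | lam S σ M h ih => exact .lam _ _ _ (ih fun i hi j hj => hST j (hi j hj))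
  | app S M N hM hN ihM ihN => exact .app _ _ _ (ihM hST) (ihN hST)
  | box S σs Ns M h ih => exact .box _ _ _ _ fun N hN => ih N hN hST

theorem scoped_true (M : Tm P K) : Scoped (fun _ => True) M := by
  induction M using Tm.ind with
  | hcon => exact .con _ _ _
  | hvar => exact .var _ _ trivial
  | hlam σ M ih => exact .lam _ _ _ (ih.mono fun _ _ _ _ => trivial)
  | happ M N ihM ihN => exact .app _ _ _ ihM ihN
  | hbox σs Ns M ihN ihM => exact .box _ _ _ _ ihN

theorem scoped_rename {S : ℕ → Prop} {f : ℕ → ℕ} {M : Tm P K} :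
    Scoped S (M.rename f) ↔ Scoped (fun i => S (f i)) M := by
  induction M using Tm.ind generalizing S f with
  | hcon => simp [scoped_con]
  | hvar => simp [scoped_var]
  | hlam σ M ih =>
    simp only [rename_lam, scoped_lam, ih]
    have : (fun i => ∀ j, upRen f i = j + 1 → S j) = fun i => ∀ j, i = j + 1 → S (f j) := by
      funext i; cases i <;> simp
    rw [this]
  | happ M N ihM ihN => simp [scoped_app, ihM, ihN]
  | hbox σs Ns M ihN ihM =>
    simp only [rename_box, scoped_box, List.mem_map]
    constructor
    · exact fun h N hN => (ihN N hN).1 (h _ ⟨N, hN, rfl⟩)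
    · rintro h _ ⟨N, hN, rfl⟩
      exact (ihN N hN).2 (h N hN)

theorem Scoped.subst {S T : ℕ → Prop} {s : ℕ → Tm P K} {M : Tm P K} (h : Scoped S M)
    (hs : ∀ i, S i → Scoped T (s i)) : Scoped T (M.subst s) := by
  induction h generalizing T s with
  | con => simp [scoped_con]
  | var S i h => simpa using hs i h
  | lam S σ M h ih =>
    rw [subst_lam]
    refine .lam _ _ _ (ih fun i hi => ?_)
    cases i with
    | zero => exact .var _ _ (by simp)
    | succ i => exact scoped_rename.2 ((hs i (hi i rfl)).mono (by simp))
  | app S M N hM hN ihM ihN => rw [subst_app]; exact .app _ _ _ (ihM hs) (ihN hs)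
  | box S σs Ns M h ih =>
    rw [subst_box]
    refine .box _ _ _ _ fun N hN => ?_
    obtain ⟨N, hN', rfl⟩ := List.mem_map.1 hN
    exact ih N hN' hs

theorem Scoped.subst_congr {S : ℕ → Prop} {s t : ℕ → Tm P K} {M : Tm P K} (h : Scoped S M)
    (hst : ∀ i, S i → s i = t i) : M.subst s = M.subst t := by
  induction h generalizing s t with
  | con => simp
  | var S i h => simpa using hst i h
  | lam S σ M h ih =>
    rw [subst_lam, subst_lam, ih]
    intro i hi
    cases i with
    | zero => simp
    | succ i => simp [hst i (hi i rfl)]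
  | app S M N hM hN ihM ihN => rw [subst_app, subst_app, ihM hst, ihN hst]
  | box S σs Ns M h ih =>
    simpa using fun N hN => ih N hN hst

theorem Scoped.rename_congr {S : ℕ → Prop} {f g : ℕ → ℕ} {M : Tm P K} (h : Scoped S M)
    (hfg : ∀ i, S i → f i = g i) : M.rename f = M.rename g := by
  rw [rename_eq_subst, rename_eq_subst]
  exact h.subst_congr fun i hi => by rw [hfg i hi]

theorem scoped_weaken (M : Tm P K) : Scoped (fun i => i ≠ 0) M.weaken :=
  scoped_rename.2 ((scoped_true M).mono (by simp))

theorem rename_pred_weaken (M : Tm P K) : M.weaken.rename Nat.pred = M := by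
  rw [Tm.weaken, rename_rename]
  exact rename_id M

theorem Scoped.weaken_rename_pred {M : Tm P K} (h : Scoped (fun i => i ≠ 0) M) :
    (M.rename Nat.pred).weaken = M := by
  rw [Tm.weaken, rename_rename]
  refine (h.rename_congr (g := id) fun i hi => ?_).trans (rename_id M)
  exact Nat.succ_pred hi

theorem Frame.scoped_fill {S : ℕ → Prop} {C : Frame P K} {M N : Tm P K} (h : Scoped S (C.fill M))
    (hN : Scoped S N) : Scoped S (C.fill N) := by
  cases C with
  | appL L => exact .app _ _ _ hN (scoped_app.1 h).2
  | appR L => exact .app _ _ _ (scoped_app.1 h).1 hN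
  | box σs Vs Ms L =>
    refine .box _ _ _ _ fun Q hQ => ?_
    have h := scoped_box.1 h
    simp only [List.mem_append, List.mem_cons] at hQ h
    rcases hQ with hQ | rfl | hQ
    · exact h _ (.inl hQ)
    · exact hN
    · exact h _ (.inr (.inr hQ))

theorem Frame.scoped_hole {S : ℕ → Prop} {C : Frame P K} {M : Tm P K} (h : Scoped S (C.fill M)) :
    Scoped S M := by
  cases C with
  | appL L => exact (scoped_app.1 h).1
  | appR L => exact (scoped_app.1 h).2
  | box σs Vs Ms L => exact scoped_box.1 h _ (by simp)

theorem Frame.weaken_rename_pred {C : Frame P K} {M : Tm P K}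
    (h : Scoped (fun i => i ≠ 0) (C.fill M)) : (C.rename Nat.pred).weaken = C := by
  have key (Ms : List (Tm P K)) (h : ∀ M ∈ Ms, Scoped (fun i => i ≠ 0) M) :
      Ms.map (Tm.rename Nat.succ ∘ Tm.rename Nat.pred) = Ms := by
    exact map_eq_self fun M hM => (h M hM).weaken_rename_pred
  cases C with
  | appL L => simpa [Frame.rename, Frame.weaken] using (scoped_app.1 h).2.weaken_rename_pred
  | appR L => simpa [Frame.rename, Frame.weaken] using (scoped_app.1 h).1.weaken_rename_pred
  | box σs Vs Ms L =>
    have h := scoped_box.1 h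
    simp only [Frame.rename, Frame.weaken, renameList_eq_map, List.map_map]
    rw [key, key]
    · exact fun M hM => h M (by simp [hM])
    · exact fun M hM => h M (by simp [hM])

theorem ECtx.weaken_rename_pred {E : ECtx P K} {M : Tm P K}
    (h : Scoped (fun i => i ≠ 0) (E.fill M)) : (E.rename Nat.pred).weaken = E := by
  induction E with
  | hole => rfl
  | comp C E ih =>
    simp only [ECtx.rename, ECtx.weaken]
    rw [Frame.weaken_rename_pred h, ih (C.scoped_hole h)]

-- Typing and subject reduction

theorem forall₂_append_left {α β : Type*} {R : α → β → Prop} {l₁ l₂ : List α} {s : List β} :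
    List.Forall₂ R (l₁ ++ l₂) s ↔
      ∃ s₁ s₂, s = s₁ ++ s₂ ∧ List.Forall₂ R l₁ s₁ ∧ List.Forall₂ R l₂ s₂ := by
  induction l₁ generalizing s with
  | nil => simp
  | cons a l₁ ih =>
    simp only [List.cons_append, List.forall₂_cons_left_iff, ih]
    constructor
    · rintro ⟨b, u, hab, ⟨s₁, s₂, rfl, h₁, h₂⟩, rfl⟩
      exact ⟨b :: s₁, s₂, rfl, ⟨b, s₁, hab, h₁, rfl⟩, h₂⟩
    · rintro ⟨_, s₂, rfl, ⟨b, s₁, hab, h₁, rfl⟩, h₂⟩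
      exact ⟨b, s₁ ++ s₂, hab, ⟨s₁, s₂, rfl, h₁, h₂⟩, rfl⟩

theorem Forall₂.append {α β : Type*} {R : α → β → Prop} {l₁ l₂ : List α} {s₁ s₂ : List β}
    (h₁ : List.Forall₂ R l₁ s₁) (h₂ : List.Forall₂ R l₂ s₂) :
    List.Forall₂ R (l₁ ++ l₂) (s₁ ++ s₂) :=
  forall₂_append_left.2 ⟨s₁, s₂, rfl, h₁, h₂⟩

theorem forall₂_append_eq {α β : Type*} {R : α → β → Prop} {l₁ l₂ : List α} {s₁ s₂ : List β}
    (h : List.Forall₂ R (l₁ ++ l₂) (s₁ ++ s₂)) (hl : s₁.length = l₁.length) :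
    List.Forall₂ R l₁ s₁ ∧ List.Forall₂ R l₂ s₂ := by
  obtain ⟨t₁, t₂, ht, h₁, h₂⟩ := forall₂_append_left.1 h
  obtain ⟨rfl, rfl⟩ := List.append_inj ht (hl.trans h₁.length_eq)
  exact ⟨h₁, h₂⟩

theorem hasType_con {Γ : List (Ty P)} {c : K} {σ τ : Ty P} :
    HasType Γ (.con c σ) τ ↔ σ = τ :=
  ⟨fun h => by cases h; rfl, fun h => h ▸ .con _ _ _⟩

theorem hasType_var {Γ : List (Ty P)} {i : ℕ} {τ : Ty P} :
    HasType Γ (.var i : Tm P K) τ ↔ Γ[i]? = some τ :=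
  ⟨fun h => by cases h; assumption, .var _ _ _⟩

theorem hasType_lam {Γ : List (Ty P)} {σ τ : Ty P} {M : Tm P K} :
    HasType Γ (.lam σ M) τ ↔ ∃ τ', τ = .imp σ τ' ∧ HasType (σ :: Γ) M τ' :=
  ⟨fun h => by cases h; exact ⟨_, rfl, by assumption⟩, fun ⟨_, h, h'⟩ => h ▸ .lam _ _ _ _ h'⟩

theorem hasType_app {Γ : List (Ty P)} {τ : Ty P} {M N : Tm P K} :
    HasType Γ (.app M N) τ ↔ ∃ σ, HasType Γ M (.imp σ τ) ∧ HasType Γ N σ :=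
  ⟨fun h => by cases h; exact ⟨_, by assumption, by assumption⟩,
    fun ⟨_, h, h'⟩ => .app _ _ _ _ _ h h'⟩

theorem hasType_box {Γ σs : List (Ty P)} {τ : Ty P} {Ns : List (Tm P K)} {M : Tm P K} :
    HasType Γ (.box σs Ns M) τ ↔ ∃ τ', τ = .box τ' ∧ HasType σs M τ' ∧
      List.Forall₂ (fun N σ => HasType Γ N (.box σ)) Ns σs := by
  constructor
  · intro h
    cases h with
    | box _ _ τ _ _ hM hlen hN =>
      exact ⟨τ, rfl, hM, List.forall₂_iff_zip.2 ⟨hlen, fun h => hN _ h⟩⟩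
  · rintro ⟨τ', rfl, hM, hN⟩
    exact .box _ _ _ _ _ hM hN.length_eq fun p hp => (List.forall₂_iff_zip.1 hN).2 hp

theorem HasType.induct {p : ∀ (Γ : List (Ty P)) (M : Tm P K) (τ : Ty P), HasType Γ M τ → Prop}
    (hcon : ∀ Γ c τ, p Γ (.con c τ) τ (.con Γ c τ))
    (hvar : ∀ Γ i τ h, p Γ (.var i) τ (.var Γ i τ h))
    (hlam : ∀ Γ σ τ M h, p (σ :: Γ) M τ h → p Γ (.lam σ M) (.imp σ τ) (.lam Γ σ τ M h))
    (happ : ∀ Γ σ τ M N hM hN, p Γ M (.imp σ τ) hM → p Γ N σ hN →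
      p Γ (.app M N) τ (.app Γ σ τ M N hM hN))
    (hbox : ∀ Γ σs τ Ns M (hM : HasType σs M τ) (h : HasType Γ (.box σs Ns M) (.box τ)),
      p σs M τ hM → List.Forall₂ (fun N σ => ∃ h : HasType Γ N (.box σ), p Γ N (.box σ) h) Ns σs →
      p Γ (.box σs Ns M) (.box τ) h)
    {Γ : List (Ty P)} {M : Tm P K} {τ : Ty P} (h : HasType Γ M τ) : p Γ M τ h := by
  induction h with
  | con Γ c τ => exact hcon Γ c τ
  | var Γ i τ h => exact hvar Γ i τ h
  | lam Γ σ τ M h ih => exact hlam Γ σ τ M h ih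
  | app Γ σ τ M N hM hN ihM ihN => exact happ Γ σ τ M N hM hN ihM ihN
  | box Γ σs τ Ns M hM hlen hN ihM ihN =>
    exact hbox Γ σs τ Ns M hM _ ihM
      (List.forall₂_iff_zip.2 ⟨hlen, fun h => ⟨hN _ h, ihN _ h⟩⟩)

theorem HasType.unique {Γ : List (Ty P)} {M : Tm P K} {σ τ : Ty P} (h : HasType Γ M σ)
    (h' : HasType Γ M τ) : σ = τ := by
  induction h using HasType.induct generalizing τ with
  | hcon Γ c σ => exact hasType_con.1 h'
  | hvar Γ i σ h => exact Option.some.inj (h.symm.trans (hasType_var.1 h'))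
  | hlam Γ ρ σ M h ih => obtain ⟨τ', rfl, h₁⟩ := hasType_lam.1 h'; rw [ih h₁]
  | happ Γ ρ σ M N hM hN ihM ihN =>
    obtain ⟨ρ', hM', hN'⟩ := hasType_app.1 h'
    exact (Ty.imp.inj (ihM hM')).2
  | hbox Γ σs σ Ns M hM h₀ ihM hN => obtain ⟨τ', rfl, h', -⟩ := hasType_box.1 h'; rw [ihM h']

theorem HasType.rename_of_scoped {Γ Γ' : List (Ty P)} {M : Tm P K} {τ : Ty P}
    (h : HasType Γ M τ) {S : ℕ → Prop} (hS : Scoped S M) {f : ℕ → ℕ}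
    (hf : ∀ i σ, S i → Γ[i]? = some σ → Γ'[f i]? = some σ) : HasType Γ' (M.rename f) τ := by
  induction h using HasType.induct generalizing Γ' S f with
  | hcon Γ c σ => simpa using HasType.con _ _ _
  | hvar Γ i σ h => simpa [hasType_var] using hf i σ (scoped_var.1 hS) h
  | hlam Γ ρ σ M h ih =>
    rw [rename_lam]
    refine .lam _ _ _ _ (ih (scoped_lam.1 hS) fun i τ hi h => ?_)
    cases i with
    | zero => simpa using h
    | succ i => simpa using hf i τ (hi i rfl) (by simpa using h)
  | happ Γ ρ σ M N hM hN ihM ihN =>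
    rw [rename_app]
    have hS := scoped_app.1 hS
    exact .app _ _ _ _ _ (ihM hS.1 hf) (ihN hS.2 hf)
  | hbox Γ σs σ Ns M hM h₀ ihM hN =>
    rw [rename_box, hasType_box]
    refine ⟨σ, rfl, hM, ?_⟩
    rw [List.forall₂_map_left_iff]
    replace hS := scoped_box.1 hS
    clear ihM hM h₀
    induction hN with
    | nil => exact .nil
    | cons h _ ih =>
      exact .cons (h.snd (hS _ (by simp)) hf) (ih fun N hN => hS N (by simp [hN]))

theorem HasType.rename {Γ Γ' : List (Ty P)} {M : Tm P K} {τ : Ty P} (h : HasType Γ M τ)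
    {f : ℕ → ℕ} (hf : ∀ i σ, Γ[i]? = some σ → Γ'[f i]? = some σ) : HasType Γ' (M.rename f) τ :=
  h.rename_of_scoped (scoped_true M) fun i σ _ => hf i σ

theorem HasType.weaken {Γ : List (Ty P)} {M : Tm P K} {τ : Ty P} (h : HasType Γ M τ) (σ : Ty P) :
    HasType (σ :: Γ) M.weaken τ :=
  h.rename fun i τ hi => by simpa using hi

theorem HasType.unrename {Γ Γ' : List (Ty P)} {M : Tm P K} {τ : Ty P} {f : ℕ → ℕ}
    (h : HasType Γ' (M.rename f) τ) (hf : ∀ i, Γ'[f i]? = Γ[i]?) : HasType Γ M τ := by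
  induction M using Tm.ind generalizing Γ Γ' f τ with
  | hcon c σ => simpa [hasType_con] using h
  | hvar i => simpa [hasType_var, hf] using h
  | hlam σ M ih =>
    rw [rename_lam] at h
    obtain ⟨τ', rfl, h'⟩ := hasType_lam.1 h
    refine .lam _ _ _ _ (ih h' fun i => ?_)
    cases i <;> simp [hf]
  | happ M N ihM ihN =>
    rw [rename_app] at h
    obtain ⟨ρ, hM, hN⟩ := hasType_app.1 h
    exact .app _ _ _ _ _ (ihM hM hf) (ihN hN hf)
  | hbox σs Ns M ihN ihM =>
    rw [rename_box] at h
    obtain ⟨τ', rfl, hM, hN⟩ := hasType_box.1 h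
    refine hasType_box.2 ⟨τ', rfl, hM, ?_⟩
    rw [List.forall₂_map_left_iff] at hN
    clear hM ihM h
    induction hN with
    | nil => exact .nil
    | cons h _ ih =>
      exact .cons (ihN _ (by simp) h hf) (ih fun N hN => ihN N (by simp [hN]))

theorem HasType.of_weaken {Γ : List (Ty P)} {M : Tm P K} {σ τ : Ty P}
    (h : HasType (σ :: Γ) M.weaken τ) : HasType Γ M τ :=
  h.unrename fun i => by simp

theorem HasType.subst {Γ Δ : List (Ty P)} {M : Tm P K} {τ : Ty P} (h : HasType Γ M τ)
    {s : ℕ → Tm P K} (hs : ∀ i σ, Γ[i]? = some σ → HasType Δ (s i) σ) :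
    HasType Δ (M.subst s) τ := by
  induction h using HasType.induct generalizing Δ s with
  | hcon Γ c σ => simpa using HasType.con _ _ _
  | hvar Γ i σ h => simpa using hs i σ h
  | hlam Γ ρ σ M h ih =>
    rw [subst_lam]
    refine .lam _ _ _ _ (ih fun i τ h => ?_)
    cases i with
    | zero => simpa [hasType_var] using h
    | succ i => exact (hs i τ (by simpa using h)).weaken ρ
  | happ Γ ρ σ M N hM hN ihM ihN =>
    rw [subst_app]
    exact .app _ _ _ _ _ (ihM hs) (ihN hs)
  | hbox Γ σs σ Ns M hM h₀ ihM hN =>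
    rw [subst_box, hasType_box]
    refine ⟨σ, rfl, hM, ?_⟩
    rw [List.forall₂_map_left_iff]
    exact hN.imp fun N σ h => h.snd hs

theorem HasType.inst {Γ : List (Ty P)} {M N : Tm P K} {σ τ : Ty P} (h : HasType (σ :: Γ) M τ)
    (hN : HasType Γ N σ) : HasType Γ (M.inst N) τ := by
  rw [inst_eq]
  refine h.subst fun i ρ hi => ?_
  cases i with
  | zero => obtain rfl : σ = ρ := by simpa using hi
            exact hN
  | succ i => exact .var _ _ _ (by simpa using hi)

theorem HasType.scoped {Γ : List (Ty P)} {M : Tm P K} {τ : Ty P} (h : HasType Γ M τ) :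
    Scoped (fun i => i < Γ.length) M := by
  induction h using HasType.induct with
  | hcon Γ c σ => exact .con _ _ _
  | hvar Γ i σ h => exact .var _ _ (List.getElem?_eq_some_iff.1 h).1
  | hlam Γ ρ σ M h ih =>
    exact .lam _ _ _ (ih.mono fun i hi j hj => by simp at hi; omega)
  | happ Γ ρ σ M N hM hN ihM ihN => exact .app _ _ _ ihM ihN
  | hbox Γ σs σ Ns M hM h₀ ihM hN =>
    refine .box _ _ _ _ fun N hN' => ?_
    clear hM ihM h₀
    induction hN with
    | nil => simp at hN'
    | cons h _ ih =>
      rcases List.mem_cons.1 hN' with rfl | hN'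
      · exact h.snd
      · exact ih hN'

/-- The renaming is built in so that `f = id` gives replacement in the hole and `f = Nat.succ` gives
weakening of the context. -/
theorem Frame.hasType_fill {Γ : List (Ty P)} {C : Frame P K} {M : Tm P K} {τ : Ty P}
    (h : HasType Γ (C.fill M) τ) : ∃ σ, HasType Γ M σ ∧ ∀ (Γ' : List (Ty P)) (f : ℕ → ℕ)
      (N : Tm P K), (∀ i σ, Γ[i]? = some σ → Γ'[f i]? = some σ) → HasType Γ' N σ →
      HasType Γ' ((C.rename f).fill N) τ := by
  cases C with
  | appL L =>
    obtain ⟨ρ, hM, hL⟩ := hasType_app.1 h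
    exact ⟨_, hM, fun Γ' f N hf hN => .app _ _ _ _ _ hN (hL.rename hf)⟩
  | appR L =>
    obtain ⟨ρ, hL, hM⟩ := hasType_app.1 h
    exact ⟨_, hM, fun Γ' f N hf hN => .app _ _ _ _ _ (hL.rename hf) hN⟩
  | box σs Vs Ms L =>
    obtain ⟨ρ, rfl, hL, hM⟩ := hasType_box.1 h
    obtain ⟨s₁, s₂, rfl, h₁, h₂⟩ := forall₂_append_left.1 hM
    obtain ⟨σ, s₂, hM', h₃, rfl⟩ := List.forall₂_cons_left_iff.1 h₂
    refine ⟨_, hM', fun Γ' f N hf hN => hasType_box.2 ⟨ρ, rfl, hL, ?_⟩⟩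
    refine Forall₂.append ?_ (.cons hN ?_) <;> rw [List.forall₂_map_left_iff]
    · exact h₁.imp fun N σ h => h.rename hf
    · exact h₃.imp fun N σ h => h.rename hf

theorem ECtx.hasType_fill {Γ : List (Ty P)} {E : ECtx P K} {M : Tm P K} {τ : Ty P}
    (h : HasType Γ (E.fill M) τ) : ∃ σ, HasType Γ M σ ∧ ∀ (Γ' : List (Ty P)) (f : ℕ → ℕ)
      (N : Tm P K), (∀ i σ, Γ[i]? = some σ → Γ'[f i]? = some σ) → HasType Γ' N σ →
      HasType Γ' ((E.rename f).fill N) τ := by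
  induction E generalizing τ with
  | hole => exact ⟨τ, h, fun _ _ _ _ h => h⟩
  | comp C E ih =>
    obtain ⟨ρ, hρ, hC⟩ := C.hasType_fill h
    obtain ⟨σ, hσ, hE⟩ := ih hρ
    exact ⟨σ, hσ, fun Γ' f N hf hN => hC Γ' f _ hf (hE Γ' f N hf hN)⟩

/-- The converse direction, which strips the bound variable of `betaOmega` from a context in which
it does not occur. -/
theorem Frame.hasType_unrename {Γ Γ' : List (Ty P)} {C : Frame P K} {M : Tm P K} {τ : Ty P}
    {f : ℕ → ℕ} (h : HasType Γ' ((C.rename f).fill M) τ) (hf : ∀ i, Γ'[f i]? = Γ[i]?) :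
    ∃ σ, HasType Γ' M σ ∧ ∀ N, HasType Γ N σ → HasType Γ (C.fill N) τ := by
  cases C with
  | appL L =>
    obtain ⟨ρ, hM, hL⟩ := hasType_app.1 h
    exact ⟨_, hM, fun N hN => .app _ _ _ _ _ hN (hL.unrename hf)⟩
  | appR L =>
    obtain ⟨ρ, hL, hM⟩ := hasType_app.1 h
    exact ⟨_, hM, fun N hN => .app _ _ _ _ _ (hL.unrename hf) hN⟩
  | box σs Vs Ms L =>
    obtain ⟨ρ, rfl, hL, hM⟩ := hasType_box.1 h
    obtain ⟨s₁, s₂, rfl, h₁, h₂⟩ := forall₂_append_left.1 hM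
    obtain ⟨σ, s₂, hM', h₃, rfl⟩ := List.forall₂_cons_left_iff.1 h₂
    refine ⟨_, hM', fun N hN => hasType_box.2 ⟨ρ, rfl, hL, ?_⟩⟩
    rw [List.forall₂_map_left_iff] at h₁ h₃
    exact Forall₂.append (h₁.imp fun N σ h => h.unrename hf)
      (.cons hN (h₃.imp fun N σ h => h.unrename hf))

theorem ECtx.hasType_unrename {Γ Γ' : List (Ty P)} {E : ECtx P K} {M : Tm P K} {τ : Ty P}
    {f : ℕ → ℕ} (h : HasType Γ' ((E.rename f).fill M) τ) (hf : ∀ i, Γ'[f i]? = Γ[i]?) :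
    ∃ σ, HasType Γ' M σ ∧ ∀ N, HasType Γ N σ → HasType Γ (E.fill N) τ := by
  induction E generalizing τ with
  | hole => exact ⟨τ, h, fun _ h => h⟩
  | comp C E ih =>
    obtain ⟨ρ, hρ, hC⟩ := C.hasType_unrename h hf
    obtain ⟨σ, hσ, hE⟩ := ih hρ
    exact ⟨σ, hσ, fun N hN => hC _ (hE N hN)⟩

theorem HasType.fill_weaken {Γ : List (Ty P)} {C : Frame P K} {M : Tm P K} {τ : Ty P}
    (h : HasType Γ (C.fill M) τ) : ∃ σ, HasType Γ M σ ∧ (∀ N, HasType Γ N σ →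
      HasType Γ (C.fill N) τ) ∧ ∀ ρ N, HasType (ρ :: Γ) N σ →
      HasType (ρ :: Γ) (C.weaken.fill N) τ := by
  obtain ⟨σ, hM, hC⟩ := C.hasType_fill h
  refine ⟨σ, hM, fun N hN => ?_, fun ρ N hN => ?_⟩
  · simpa using hC Γ id N (fun _ _ h => h) hN
  · rw [C.weaken_eq]
    exact hC _ _ N (fun i τ h => by simpa using h) hN

theorem Rule.hasType {Γ : List (Ty P)} {M N : Tm P K} {τ : Ty P} (h : Rule Γ M N)
    (hM : HasType Γ M τ) : HasType Γ N τ := by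
  cases h with
  | idImp σ =>
    obtain ⟨σ', h, hN⟩ := hasType_app.1 hM
    obtain ⟨τ', he, h⟩ := hasType_lam.1 h
    obtain ⟨rfl, rfl⟩ := Ty.imp.inj he
    obtain rfl : σ' = τ := by simpa [hasType_var] using h
    exact hN
  | betaImp σ M V hV =>
    obtain ⟨σ', h, hN⟩ := hasType_app.1 hM
    obtain ⟨τ', he, h⟩ := hasType_lam.1 h
    obtain ⟨rfl, rfl⟩ := Ty.imp.inj he
    exact h.inst hN
  | etaImp σ V hV =>
    obtain ⟨τ', rfl, h⟩ := hasType_lam.1 hM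
    obtain ⟨σ', h, hx⟩ := hasType_app.1 h
    obtain rfl : σ = σ' := by simpa [hasType_var] using hx
    exact h.of_weaken
  | lift C σ M N hC =>
    obtain ⟨ρ, h, -, hC⟩ := hM.fill_weaken
    obtain ⟨σ', h, hN⟩ := hasType_app.1 h
    obtain ⟨τ', he, h⟩ := hasType_lam.1 h
    obtain ⟨rfl, rfl⟩ := Ty.imp.inj he
    exact .app _ _ _ _ _ (.lam _ _ _ _ (hC _ _ h)) hN
  | flat C σ y M hy hC hne hσ =>
    obtain ⟨ρ, h, -, hC⟩ := hM.fill_weaken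
    obtain rfl := h.unique hσ
    exact .app _ _ _ _ _ (.lam _ _ _ _ (hC _ _ (.var _ _ _ (by simp)))) hσ
  | betaOmega E σ y M hy hE =>
    obtain ⟨σ', h, hN⟩ := hasType_app.1 hM
    obtain ⟨τ', he, h⟩ := hasType_lam.1 h
    obtain ⟨rfl, rfl⟩ := Ty.imp.inj he
    rw [E.weaken_eq] at h
    obtain ⟨ρ, h, hE⟩ := ECtx.hasType_unrename (Γ := Γ) h fun i => by simp
    obtain ⟨σ, h, hx⟩ := hasType_app.1 h
    obtain rfl : σ' = σ := by simpa [hasType_var] using hx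
    exact hE _ (.app _ _ _ _ _ h.of_weaken hN)
  | idBox σ M =>
    obtain ⟨τ', rfl, h, hN⟩ := hasType_box.1 hM
    obtain rfl : σ = τ' := by simpa [hasType_var] using h
    simpa using hN
  | betaBox ws ys zs σ Ws Ns Ps V M hWs hV hlen =>
    obtain ⟨τ', rfl, h, hN⟩ := hasType_box.1 hM
    obtain ⟨h₁, h₂⟩ := forall₂_append_eq hN hlen
    obtain ⟨h₂, h₃⟩ := List.forall₂_cons.1 h₂
    obtain ⟨σ', he, hV, h₂⟩ := hasType_box.1 h₂
    obtain rfl := Ty.box.inj he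
    refine hasType_box.2 ⟨τ', rfl, ?_, Forall₂.append (Forall₂.append h₁ h₂) h₃⟩
    refine h.subst fun i ρ hi => ?_
    split_ifs with h₁ h₂
    · rw [List.getElem?_append_left h₁] at hi
      rw [hasType_var, List.append_assoc, List.getElem?_append_left h₁, hi]
    · subst h₂
      obtain rfl : σ = ρ := by simpa using hi
      refine hV.rename fun j ρ hj => ?_
      rw [List.append_assoc, List.getElem?_append_right (by omega), Nat.add_sub_cancel_left,
        List.getElem?_append_left (List.getElem?_eq_some_iff.1 hj).1, hj]
    · rw [List.getElem?_append_right (by omega)] at hi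
      obtain ⟨k, hk⟩ : ∃ k, i = ws.length + 1 + k := ⟨i - ws.length - 1, by omega⟩
      subst hk
      rw [hasType_var, List.getElem?_append_right (by simp)]
      rw [show ws.length + 1 + k - ws.length = k + 1 by omega] at hi
      rw [← hi, List.getElem?_cons_succ]
      congr 1
      simp
      omega

theorem Step.hasType {Γ : List (Ty P)} {M N : Tm P K} {τ : Ty P} (h : Step Γ M N)
    (hM : HasType Γ M τ) : HasType Γ N τ := by
  induction h generalizing τ with
  | rule Γ M N h => exact h.hasType hM
  | lam Γ σ M M' h ih =>
    obtain ⟨τ', rfl, hM'⟩ := hasType_lam.1 hM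
    exact .lam _ _ _ _ (ih hM')
  | appL Γ M M' N h ih =>
    obtain ⟨σ, hM, hN⟩ := hasType_app.1 hM
    exact .app _ _ _ _ _ (ih hM) hN
  | appR Γ M N N' h ih =>
    obtain ⟨σ, hM, hN⟩ := hasType_app.1 hM
    exact .app _ _ _ _ _ hM (ih hN)
  | boxArg Γ σs Ls Rs N N' M h ih =>
    obtain ⟨ρ, h, hC, -⟩ := HasType.fill_weaken (C := .box σs Ls Rs M) hM
    exact hC _ (ih h)
  | boxBody Γ σs Ns M M' h ih =>
    obtain ⟨τ', rfl, hM, hN⟩ := hasType_box.1 hM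
    exact hasType_box.2 ⟨τ', rfl, ih hM, hN⟩

theorem Steps.hasType {Γ : List (Ty P)} {M N : Tm P K} {τ : Ty P} (h : Steps Γ M N)
    (hM : HasType Γ M τ) : HasType Γ N τ := by
  induction h with
  | refl => exact hM
  | tail _ h ih => exact h.hasType ih

-- Values and call-by-value terms are closed under reduction

theorem isCbvTerm_lam {σ : Ty P} {M : Tm P K} : IsCbvTerm (.lam σ M) ↔ IsCbvTerm M :=
  ⟨fun h => by cases h; assumption, .lam _ _⟩

theorem isCbvTerm_app {M N : Tm P K} : IsCbvTerm (.app M N) ↔ IsCbvTerm M ∧ IsCbvTerm N :=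
  ⟨fun h => by cases h; constructor <;> assumption, fun h => .app _ _ h.1 h.2⟩

theorem isCbvTerm_box {σs : List (Ty P)} {Ns : List (Tm P K)} {M : Tm P K} :
    IsCbvTerm (.box σs Ns M) ↔ (∀ N ∈ Ns, IsCbvTerm N) ∧ IsCbvTerm M ∧ IsValue M :=
  ⟨fun h => by cases h; refine ⟨?_, ?_, ?_⟩ <;> assumption, fun h => .box _ _ _ h.1 h.2.1 h.2.2⟩

theorem isCbvTerm_rename {M : Tm P K} {f : ℕ → ℕ} : IsCbvTerm (M.rename f) ↔ IsCbvTerm M := by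
  induction M using Tm.ind generalizing f with
  | hcon c σ => simp
  | hvar i => simp [IsCbvTerm.var]
  | hlam σ M ih => simp [isCbvTerm_lam, ih]
  | happ M N ihM ihN => simp [isCbvTerm_app, ihM, ihN]
  | hbox σs Ns M ihN ihM =>
    simp only [rename_box, isCbvTerm_box, List.mem_map]
    refine and_congr_left fun _ => ⟨fun h N hN => (ihN N hN).1 (h _ ⟨N, hN, rfl⟩), ?_⟩
    rintro h _ ⟨N, hN, rfl⟩
    exact (ihN N hN).2 (h N hN)

theorem isCbvTerm_weaken {M : Tm P K} : IsCbvTerm M.weaken ↔ IsCbvTerm M := isCbvTerm_rename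

theorem IsCbvTerm.subst {M : Tm P K} (h : IsCbvTerm M) {s : ℕ → Tm P K}
    (hs : ∀ i, IsCbvTerm (s i)) : IsCbvTerm (M.subst s) := by
  induction h generalizing s with
  | con c σ => simpa using IsCbvTerm.con _ _
  | var i => simpa using hs i
  | lam σ M h ih =>
    rw [subst_lam]
    refine .lam _ _ (ih fun i => ?_)
    cases i with
    | zero => exact .var _
    | succ i => exact isCbvTerm_weaken.2 (hs i)
  | app M N hM hN ihM ihN => rw [subst_app]; exact .app _ _ (ihM hs) (ihN hs)
  | box σs Ns V hN hV hval ihN ihV =>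
    rw [subst_box]
    refine .box _ _ _ (fun N hN' => ?_) hV hval
    obtain ⟨N, hN, rfl⟩ := List.mem_map.1 hN'
    exact ihN N hN hs

theorem IsCbvTerm.inst {M N : Tm P K} (h : IsCbvTerm M) (hN : IsCbvTerm N) :
    IsCbvTerm (M.inst N) := by
  rw [inst_eq]
  refine h.subst fun i => ?_
  cases i
  · exact hN
  · exact .var _

/-- The renamings `f` and `g` are unrelated because a renaming does not affect whether a term
belongs to the fragment. -/
theorem Frame.isCbvTerm_fill {C : Frame P K} {M : Tm P K} (f : ℕ → ℕ)
    (h : IsCbvTerm ((C.rename f).fill M)) : IsCbvTerm M ∧ ∀ N g, IsCbvTerm N →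
      IsCbvTerm ((C.rename g).fill N) := by
  cases C with
  | appL L =>
    have h := isCbvTerm_app.1 h
    rw [isCbvTerm_rename] at h
    exact ⟨h.1, fun N g hN => .app _ _ hN (isCbvTerm_rename.2 h.2)⟩
  | appR L =>
    have h := isCbvTerm_app.1 h
    rw [isCbvTerm_rename] at h
    exact ⟨h.2, fun N g hN => .app _ _ (isCbvTerm_rename.2 h.1) hN⟩
  | box σs Vs Ms L =>
    obtain ⟨h, h'⟩ := isCbvTerm_box.1 h
    refine ⟨h _ (by simp), fun N g hN => isCbvTerm_box.2 ⟨fun Q hQ => ?_, h'⟩⟩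
    simp only [List.mem_append, List.mem_cons, List.mem_map] at hQ
    rcases hQ with ⟨Q, hQ, rfl⟩ | rfl | ⟨Q, hQ, rfl⟩
    · exact isCbvTerm_rename.2 (isCbvTerm_rename.1 (h (Q.rename f) (by simp only [List.mem_append, List.mem_cons]; simp only [List.mem_map]; grind)))
    · exact hN
    · exact isCbvTerm_rename.2 (isCbvTerm_rename.1 (h (Q.rename f) (by simp only [List.mem_append, List.mem_cons]; simp only [List.mem_map]; grind)))

theorem ECtx.isCbvTerm_fill {E : ECtx P K} {M : Tm P K} (f : ℕ → ℕ)
    (h : IsCbvTerm ((E.rename f).fill M)) : IsCbvTerm M ∧ ∀ N g, IsCbvTerm N →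
      IsCbvTerm ((E.rename g).fill N) := by
  induction E with
  | hole => exact ⟨h, fun _ _ h => h⟩
  | comp C E ih =>
    obtain ⟨h₁, h₂⟩ := C.isCbvTerm_fill f h
    obtain ⟨h₃, h₄⟩ := ih h₁
    exact ⟨h₃, fun N g hN => h₂ _ g (h₄ N g hN)⟩

@[simp] theorem ECtx.rename_id (E : ECtx P K) : E.rename id = E := by
  induction E with
  | hole => rfl
  | comp C E ih => simp [ECtx.rename, ih]

theorem isValue_instBox {a b : ℕ} {M V : Tm P K} (hM : IsValue M) (hV : IsValue V) :
    IsValue (M.instBox a b V) := by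
  refine hM.subst fun i => ?_
  split_ifs
  · exact .var _
  · exact hV.rename _
  · exact .var _

theorem isCbvTerm_instBox {a b : ℕ} {M V : Tm P K} (hM : IsCbvTerm M) (hV : IsCbvTerm V) :
    IsCbvTerm (M.instBox a b V) := by
  refine hM.subst fun i => ?_
  split_ifs
  · exact .var _
  · exact isCbvTerm_rename.2 hV
  · exact .var _

theorem Frame.not_isValue_fill {C : Frame P K} {M : Tm P K} (hM : ¬ IsValue M) :
    ¬ IsValue (C.fill M) := by
  cases C with
  | appL L => exact not_isValue_app
  | appR L => exact not_isValue_app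
  | box σs Vs Ms L => exact fun h => hM (isValue_box.1 h M (by simp))

theorem ECtx.not_isValue_fill {E : ECtx P K} {M : Tm P K} (hM : ¬ IsValue M) :
    ¬ IsValue (E.fill M) := by
  induction E with
  | hole => exact hM
  | comp C E ih => exact C.not_isValue_fill ih

theorem Rule.isValue {Γ : List (Ty P)} {M N : Tm P K} (h : Rule Γ M N) (hM : IsValue M) :
    IsValue N := by
  cases h with
  | idImp => exact absurd hM not_isValue_app
  | betaImp => exact absurd hM not_isValue_app
  | etaImp σ V hV => exact hV
  | lift C σ M N hC => exact absurd hM (C.not_isValue_fill not_isValue_app)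
  | flat C σ y M => exact absurd hM (C.not_isValue_fill not_isValue_app)
  | betaOmega => exact absurd hM not_isValue_app
  | idBox σ M => exact isValue_box.1 hM _ (by simp)
  | betaBox ws ys zs σ Ws Ns Ps V M hWs hV hlen =>
    have h := isValue_box.1 hM
    have h' := isValue_box.1 (h (.box ys Ns V) (by simp))
    refine isValue_box.2 fun N hN => ?_
    simp only [List.mem_append] at hN
    rcases hN with (hN | hN) | hN
    · exact hWs N hN
    · exact h' N hN
    · exact h N (by simp [hN])

theorem Step.isValue {Γ : List (Ty P)} {M N : Tm P K} (h : Step Γ M N) (hM : IsValue M) :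
    IsValue N := by
  induction h with
  | rule Γ M N h => exact h.isValue hM
  | lam => exact .lam _ _
  | appL => exact absurd hM not_isValue_app
  | appR => exact absurd hM not_isValue_app
  | boxArg Γ σs Ls Rs N N' M _ ih =>
    have h := isValue_box.1 hM
    refine isValue_box.2 fun Q hQ => ?_
    simp only [List.mem_append, List.mem_cons] at hQ
    rcases hQ with hQ | rfl | hQ
    · exact h Q (by simp [hQ])
    · exact ih (h N (by simp))
    · exact h Q (by simp [hQ])
  | boxBody => exact isValue_box.2 (isValue_box.1 hM)

theorem Rule.isCbvTerm {Γ : List (Ty P)} {M N : Tm P K} (h : Rule Γ M N) (hM : IsCbvTerm M) :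
    IsCbvTerm N := by
  cases h with
  | idImp => exact (isCbvTerm_app.1 hM).2
  | betaImp σ M V hV =>
    have h := isCbvTerm_app.1 hM
    exact (isCbvTerm_lam.1 h.1).inst h.2
  | etaImp σ V hV => exact isCbvTerm_weaken.1 (isCbvTerm_app.1 (isCbvTerm_lam.1 hM)).1
  | lift C σ M N hC =>
    rw [← C.rename_id] at hM
    obtain ⟨h, h'⟩ := C.isCbvTerm_fill id hM
    obtain ⟨hM, hN⟩ := isCbvTerm_app.1 h
    rw [C.weaken_eq]
    exact .app _ _ (.lam _ _ (h' _ _ (isCbvTerm_lam.1 hM))) hN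
  | flat C σ y M =>
    rw [← C.rename_id] at hM
    obtain ⟨h, h'⟩ := C.isCbvTerm_fill id hM
    rw [C.weaken_eq]
    exact .app _ _ (.lam _ _ (h' _ _ (.var _))) h
  | betaOmega E σ y M =>
    obtain ⟨h, hM⟩ := isCbvTerm_app.1 hM
    rw [E.weaken_eq] at h
    obtain ⟨h, h'⟩ := E.isCbvTerm_fill _ (isCbvTerm_lam.1 h)
    simpa using h' (.app y M) id (.app _ _ (isCbvTerm_weaken.1 (isCbvTerm_app.1 h).1) hM)
  | idBox σ M => exact (isCbvTerm_box.1 hM).1 _ (by simp)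
  | betaBox ws ys zs σ Ws Ns Ps V M hWs hV hlen =>
    obtain ⟨h, hM, hMv⟩ := isCbvTerm_box.1 hM
    obtain ⟨h', hV', -⟩ := isCbvTerm_box.1 (h (.box ys Ns V) (by simp))
    refine isCbvTerm_box.2 ⟨fun N hN => ?_, isCbvTerm_instBox hM hV', isValue_instBox hMv hV⟩
    simp only [List.mem_append] at hN
    rcases hN with (hN | hN) | hN
    · exact h N (by simp [hN])
    · exact h' N hN
    · exact h N (by simp [hN])

theorem Step.isCbvTerm {Γ : List (Ty P)} {M N : Tm P K} (h : Step Γ M N) (hM : IsCbvTerm M) :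
    IsCbvTerm N := by
  induction h with
  | rule Γ M N h => exact h.isCbvTerm hM
  | lam Γ σ M M' h ih => exact .lam _ _ (ih (isCbvTerm_lam.1 hM))
  | appL Γ M M' N h ih =>
    have hM := isCbvTerm_app.1 hM
    exact .app _ _ (ih hM.1) hM.2
  | appR Γ M N N' h ih =>
    have hM := isCbvTerm_app.1 hM
    exact .app _ _ hM.1 (ih hM.2)
  | boxArg Γ σs Ls Rs N N' M _ ih =>
    obtain ⟨h, h'⟩ := isCbvTerm_box.1 hM
    refine isCbvTerm_box.2 ⟨fun Q hQ => ?_, h'⟩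
    simp only [List.mem_append, List.mem_cons] at hQ
    rcases hQ with hQ | rfl | hQ
    · exact h Q (by simp [hQ])
    · exact ih (h N (by simp))
    · exact h Q (by simp [hQ])
  | boxBody Γ σs Ns M M' h ih =>
    obtain ⟨h₁, h₂, h₃⟩ := isCbvTerm_box.1 hM
    exact isCbvTerm_box.2 ⟨h₁, ih h₂, h.isValue h₃⟩

theorem Steps.isCbvTerm {Γ : List (Ty P)} {M N : Tm P K} (h : Steps Γ M N) (hM : IsCbvTerm M) :
    IsCbvTerm N := by
  induction h with
  | refl => exact hM
  | tail _ h ih => exact h.isCbvTerm ih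

-- Reduction under renaming and in contexts

theorem Scoped.weaken {S : ℕ → Prop} {M : Tm P K} (h : Scoped S M) :
    Scoped (fun i => ∀ j, i = j + 1 → S j) M.weaken :=
  scoped_rename.2 (h.mono (by simp))

theorem Scoped.inst {S : ℕ → Prop} {M N : Tm P K} (h : Scoped (fun i => ∀ j, i = j + 1 → S j) M)
    (hN : Scoped S N) : Scoped S (M.inst N) := by
  rw [inst_eq]
  refine h.subst fun i hi => ?_
  cases i with
  | zero => exact hN
  | succ i => exact .var _ _ (hi i rfl)

theorem Frame.scoped_fill_weaken {S : ℕ → Prop} {C : Frame P K} {M N : Tm P K}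
    (h : Scoped S (C.fill M)) (hN : Scoped (fun i => ∀ j, i = j + 1 → S j) N) :
    Scoped (fun i => ∀ j, i = j + 1 → S j) (C.weaken.fill N) := by
  have := h.weaken
  rw [Tm.weaken, C.rename_fill, ← C.weaken_eq] at this
  exact Frame.scoped_fill this hN

theorem Rule.scoped {Γ : List (Ty P)} {S : ℕ → Prop} {M N : Tm P K} (h : Rule Γ M N)
    (hM : Scoped S M) : Scoped S N := by
  cases h with
  | idImp => exact (scoped_app.1 hM).2
  | betaImp σ M V hV =>
    have h := scoped_app.1 hM
    exact (scoped_lam.1 h.1).inst h.2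
  | etaImp σ V hV =>
    have h := (scoped_app.1 (scoped_lam.1 hM)).1
    exact (scoped_rename.1 h).mono fun i hi => hi i rfl
  | lift C σ M N hC =>
    have h := scoped_app.1 (C.scoped_hole hM)
    exact .app _ _ _ (.lam _ _ _ (C.scoped_fill_weaken hM (scoped_lam.1 h.1))) h.2
  | flat C σ y M =>
    exact .app _ _ _ (.lam _ _ _ (C.scoped_fill_weaken hM (.var _ _ (by simp)))) (C.scoped_hole hM)
  | betaOmega E σ y M =>
    have h := scoped_app.1 hM
    have := (scoped_lam.1 h.1).inst h.2
    rw [E.weaken_fill_inst] at this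
    convert this using 2
    simp only [inst_eq, subst_app, subst_var, scons_zero]
    rw [← inst_eq, weaken_inst]
  | idBox σ M => exact scoped_box.1 hM _ (by simp)
  | betaBox ws ys zs σ Ws Ns Ps V M hWs hV hlen =>
    have h := scoped_box.1 hM
    have h' := scoped_box.1 (h (.box ys Ns V) (by simp))
    refine .box _ _ _ _ fun N hN => ?_
    simp only [List.mem_append] at hN
    rcases hN with (hN | hN) | hN
    · exact h N (by simp [hN])
    · exact h' N hN
    · exact h N (by simp [hN])

theorem Step.scoped {Γ : List (Ty P)} {S : ℕ → Prop} {M N : Tm P K} (h : Step Γ M N)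
    (hM : Scoped S M) : Scoped S N := by
  induction h generalizing S with
  | rule Γ M N h => exact h.scoped hM
  | lam Γ σ M M' h ih => exact .lam _ _ _ (ih (scoped_lam.1 hM))
  | appL Γ M M' N h ih =>
    have hM := scoped_app.1 hM
    exact .app _ _ _ (ih hM.1) hM.2
  | appR Γ M N N' h ih =>
    have hM := scoped_app.1 hM
    exact .app _ _ _ hM.1 (ih hM.2)
  | boxArg Γ σs Ls Rs N N' M _ ih =>
    exact Frame.scoped_fill (C := .box σs Ls Rs M) hM
      (ih (Frame.scoped_hole (C := .box σs Ls Rs M) hM))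
  | boxBody Γ σs Ns M M' h ih => exact .box _ _ _ _ (scoped_box.1 hM)

theorem Steps.scoped {Γ : List (Ty P)} {S : ℕ → Prop} {M N : Tm P K} (h : Steps Γ M N)
    (hM : Scoped S M) : Scoped S N := by
  induction h with
  | refl => exact hM
  | tail _ h ih => exact h.scoped ih

/-- Asking for `hf` only on the free variables admits `f = Nat.pred`, which undoes a weakening;
`Steps.slet_of_linear` needs this. -/
theorem Rule.rename_of_scoped {Γ Γ' : List (Ty P)} {M N : Tm P K} (h : Rule Γ M N)
    {S : ℕ → Prop} (hS : Scoped S M) {f : ℕ → ℕ}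
    (hf : ∀ i σ, S i → Γ[i]? = some σ → Γ'[f i]? = some σ) :
    Rule Γ' (M.rename f) (N.rename f) := by
  cases h with
  | idImp => simpa using Rule.idImp _ _
  | betaImp σ M V hV =>
    rw [inst_rename, rename_app, rename_lam]
    exact .betaImp _ _ _ (hV.rename f)
  | etaImp σ V hV =>
    rw [rename_lam, rename_app, weaken_rename, rename_var]
    exact .etaImp _ _ (hV.rename f)
  | lift C σ M N hC =>
    rw [C.rename_fill, rename_app, rename_app, rename_lam, rename_lam, Frame.rename_fill,
      C.weaken_rename]
    exact .lift _ _ _ _ (hC.rename f)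
  | flat C σ y M hy hC hne hσ =>
    rw [C.rename_fill, rename_app, rename_app, rename_lam, Frame.rename_fill, rename_app,
      C.weaken_rename, rename_var]
    refine .flat _ _ _ _ (hy.rename f) (hC.rename f) (fun V hV => ?_) ?_
    · cases C with
      | appR V => exact hne V rfl
      | appL => cases hV
      | box => cases hV
    · simpa using hσ.rename_of_scoped (C.scoped_hole hS) hf
  | betaOmega E σ y M hy hE =>
    rw [E.rename_fill, rename_app, rename_app, rename_lam, ECtx.rename_fill, rename_app,
      E.weaken_rename, rename_var, weaken_rename]
    exact .betaOmega _ _ _ _ (hy.rename f) (hE.rename f)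
  | idBox σ M => simpa using Rule.idBox _ _
  | betaBox ws ys zs σ Ws Ns Ps V M hWs hV hlen =>
    simp only [rename_box, List.map_append, List.map_cons]
    refine .betaBox _ _ _ _ _ _ _ _ _ (fun W hW => ?_) hV (by simpa using hlen)
    obtain ⟨W, hW', rfl⟩ := List.mem_map.1 hW
    exact (hWs W hW').rename f

theorem Step.rename_of_scoped {Γ Γ' : List (Ty P)} {M N : Tm P K} (h : Step Γ M N)
    {S : ℕ → Prop} (hS : Scoped S M) {f : ℕ → ℕ}
    (hf : ∀ i σ, S i → Γ[i]? = some σ → Γ'[f i]? = some σ) :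
    Step Γ' (M.rename f) (N.rename f) := by
  induction h generalizing Γ' S f with
  | rule Γ M N h => exact .rule _ _ _ (h.rename_of_scoped hS hf)
  | lam Γ σ M M' h ih =>
    rw [rename_lam, rename_lam]
    refine .lam _ _ _ _ (ih (scoped_lam.1 hS) fun i τ hi h => ?_)
    cases i with
    | zero => simpa using h
    | succ i => simpa using hf i τ (hi i rfl) (by simpa using h)
  | appL Γ M M' N h ih =>
    rw [rename_app, rename_app]
    exact .appL _ _ _ _ (ih (scoped_app.1 hS).1 hf)
  | appR Γ M N N' h ih =>
    rw [rename_app, rename_app]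
    exact .appR _ _ _ _ (ih (scoped_app.1 hS).2 hf)
  | boxArg Γ σs Ls Rs N N' M h ih =>
    simp only [rename_box, List.map_append, List.map_cons]
    exact .boxArg _ _ _ _ _ _ _ (ih (scoped_box.1 hS N (by simp)) hf)
  | boxBody Γ σs Ns M M' h ih =>
    simp only [rename_box]
    exact .boxBody _ _ _ _ _ h

theorem Steps.rename_of_scoped {Γ Γ' : List (Ty P)} {M N : Tm P K} (h : Steps Γ M N)
    {S : ℕ → Prop} (hS : Scoped S M) {f : ℕ → ℕ}
    (hf : ∀ i σ, S i → Γ[i]? = some σ → Γ'[f i]? = some σ) :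
    Steps Γ' (M.rename f) (N.rename f) := by
  induction h with
  | refl => exact .refl
  | tail h h' ih => exact ih.tail (h'.rename_of_scoped (Steps.scoped h hS) hf)

theorem Steps.rename {Γ Γ' : List (Ty P)} {M N : Tm P K} (h : Steps Γ M N) {f : ℕ → ℕ}
    (hf : ∀ i σ, Γ[i]? = some σ → Γ'[f i]? = some σ) : Steps Γ' (M.rename f) (N.rename f) :=
  h.rename_of_scoped (scoped_true M) fun i σ _ => hf i σ

theorem Rule.steps {Γ : List (Ty P)} {M N : Tm P K} (h : Rule Γ M N) : Steps Γ M N :=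
  .single (.rule _ _ _ h)

theorem Steps.map {Γ Γ' : List (Ty P)} {f : Tm P K → Tm P K}
    (hf : ∀ M N, Step Γ M N → Step Γ' (f M) (f N)) {M N : Tm P K} (h : Steps Γ M N) :
    Steps Γ' (f M) (f N) := by
  induction h with
  | refl => exact .refl
  | tail _ h ih => exact ih.tail (hf _ _ h)

theorem Steps.lam {Γ : List (Ty P)} {σ : Ty P} {M N : Tm P K} (h : Steps (σ :: Γ) M N) :
    Steps Γ (.lam σ M) (.lam σ N) :=
  h.map fun _ _ h => .lam _ _ _ _ h

theorem Step.fill {Γ : List (Ty P)} {C : Frame P K} {M N : Tm P K} (h : Step Γ M N) :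
    Step Γ (C.fill M) (C.fill N) := by
  cases C with
  | appL L => exact .appL _ _ _ _ h
  | appR L => exact .appR _ _ _ _ h
  | box σs Vs Ms L => exact .boxArg _ _ _ _ _ _ _ h

theorem Steps.fill {Γ : List (Ty P)} {M N : Tm P K} (h : Steps Γ M N) (C : Frame P K) :
    Steps Γ (C.fill M) (C.fill N) :=
  h.map fun _ _ h => h.fill

theorem Steps.appL {Γ : List (Ty P)} {M N : Tm P K} (h : Steps Γ M N) (L : Tm P K) :
    Steps Γ (.app M L) (.app N L) := h.fill (.appL L)

theorem Steps.appR {Γ : List (Ty P)} {M N : Tm P K} (h : Steps Γ M N) (L : Tm P K) :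
    Steps Γ (.app L M) (.app L N) := h.fill (.appR L)

theorem Steps.boxBody {Γ σs : List (Ty P)} {Ns : List (Tm P K)} {M N : Tm P K}
    (h : Steps σs M N) : Steps Γ (.box σs Ns M) (.box σs Ns N) :=
  h.map fun _ _ h => .boxBody _ _ _ _ _ h

-- Reductions of `E[y z]` for atoms `y` and `z`

/-- Composition of evaluation contexts. -/
def ECtx.append : ECtx P K → ECtx P K → ECtx P K
  | .hole, F => F
  | .comp C E, F => .comp C (E.append F)

theorem ECtx.append_fill (E F : ECtx P K) (M : Tm P K) :
    (E.append F).fill M = E.fill (F.fill M) := by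
  induction E with
  | hole => rfl
  | comp C E ih => simp [ECtx.append, ECtx.fill, ih]

theorem ECtx.IsEval.append {E F : ECtx P K} (hE : E.IsEval) (hF : F.IsEval) :
    (E.append F).IsEval := by
  induction E with
  | hole => exact hF
  | comp C E ih => exact ⟨hE.1, ih hE.2⟩

theorem append_cons_eq_append_cons {α : Type*} {l₁ r₁ l₂ r₂ : List α} {a b : α}
    (h : l₁ ++ a :: r₁ = l₂ ++ b :: r₂) :
    (l₁ = l₂ ∧ a = b ∧ r₁ = r₂) ∨ (∃ q, l₂ = l₁ ++ a :: q ∧ r₁ = q ++ b :: r₂) ∨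
      ∃ q, l₁ = l₂ ++ b :: q ∧ r₂ = q ++ a :: r₁ := by
  induction l₁ generalizing l₂ with
  | nil =>
    cases l₂ with
    | nil => simpa using h
    | cons c l₂ =>
      obtain ⟨rfl, rfl⟩ := List.cons.inj h
      exact .inr (.inl ⟨l₂, rfl, rfl⟩)
  | cons c l₁ ih =>
    cases l₂ with
    | nil =>
      obtain ⟨rfl, rfl⟩ := List.cons.inj h
      exact .inr (.inr ⟨l₁, rfl, rfl⟩)
    | cons d l₂ =>
      obtain ⟨rfl, h'⟩ := List.cons.inj h
      rcases ih h' with ⟨rfl, rfl, rfl⟩ | ⟨q, rfl, rfl⟩ | ⟨q, rfl, rfl⟩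
      · exact .inl ⟨rfl, rfl, rfl⟩
      · exact .inr (.inl ⟨q, rfl, rfl⟩)
      · exact .inr (.inr ⟨q, rfl, rfl⟩)

/-- Everything before the hole is a value, so the hole is at the first immediate subterm that is not
a value. -/
theorem Frame.fill_inj {C D : Frame P K} {M N : Tm P K} (hC : C.IsSimple) (hD : D.IsSimple)
    (hM : ¬ IsValue M) (hN : ¬ IsValue N) (h : C.fill M = D.fill N) : C = D ∧ M = N := by
  cases C with
  | appL L =>
    cases D with
    | appL L' => obtain ⟨rfl, rfl⟩ := Tm.app.inj h; exact ⟨rfl, rfl⟩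
    | appR L' => obtain ⟨rfl, rfl⟩ := Tm.app.inj h; exact absurd hD hM
    | box => cases h
  | appR L =>
    cases D with
    | appL L' => obtain ⟨rfl, rfl⟩ := Tm.app.inj h; exact absurd hC hN
    | appR L' => obtain ⟨rfl, rfl⟩ := Tm.app.inj h; exact ⟨rfl, rfl⟩
    | box => cases h
  | box σs Vs Ms L =>
    cases D with
    | appL L' => cases h
    | appR L' => cases h
    | box σs' Vs' Ms' L' =>
      obtain ⟨rfl, h', rfl⟩ := Tm.box.inj h
      rcases append_cons_eq_append_cons h' with ⟨rfl, rfl, rfl⟩ | ⟨q, rfl, rfl⟩ | ⟨q, rfl, rfl⟩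
      · exact ⟨rfl, rfl⟩
      · exact absurd (hD M (by simp)) hM
      · exact absurd (hC N (by simp)) hN

theorem not_rule_atom {Γ : List (Ty P)} {y R : Tm P K} (hy : IsAtom y) : ¬ Rule Γ y R := by
  intro h
  generalize hT : y = T at h
  cases h with
  | lift C => subst hT; cases C <;> cases hy
  | flat C => subst hT; cases C <;> cases hy
  | _ => subst hT; cases hy

theorem not_step_atom {Γ : List (Ty P)} {y R : Tm P K} (hy : IsAtom y) : ¬ Step Γ y R := by
  intro h
  cases h with
  | rule _ _ _ h => exact not_rule_atom hy h
  | _ => cases hy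

theorem Steps.atom_eq {Γ : List (Ty P)} {y R : Tm P K} (hy : IsAtom y) (h : Steps Γ y R) :
    R = y := by
  rcases Relation.ReflTransGen.cases_head h with h | ⟨_, h, -⟩
  · exact h.symm
  · exact absurd h (not_step_atom hy)

theorem not_step_app_atom {Γ : List (Ty P)} {y z R : Tm P K} (hy : IsAtom y) (hz : IsAtom z) :
    ¬ Step Γ (.app y z) R := by
  intro h
  generalize hT : Tm.app y z = T at h
  cases h with
  | rule _ _ _ h =>
    cases h with
    | lift C =>
      cases C with
      | appL => obtain ⟨rfl, rfl⟩ := Tm.app.inj hT; cases hy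
      | appR => obtain ⟨rfl, rfl⟩ := Tm.app.inj hT; cases hz
      | box => cases hT
    | flat C =>
      cases C with
      | appL => obtain ⟨rfl, rfl⟩ := Tm.app.inj hT; cases hy
      | appR => obtain ⟨rfl, rfl⟩ := Tm.app.inj hT; cases hz
      | box => cases hT
    | idImp => obtain ⟨rfl, rfl⟩ := Tm.app.inj hT; cases hy
    | betaImp => obtain ⟨rfl, rfl⟩ := Tm.app.inj hT; cases hy
    | betaOmega => obtain ⟨rfl, rfl⟩ := Tm.app.inj hT; cases hy
    | _ => cases hT
  | appL _ _ _ _ h => obtain ⟨rfl, rfl⟩ := Tm.app.inj hT; exact not_step_atom hy h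
  | appR _ _ _ _ h => obtain ⟨rfl, rfl⟩ := Tm.app.inj hT; exact not_step_atom hz h
  | _ => cases hT

theorem Steps.app_atom_eq {Γ : List (Ty P)} {y z R : Tm P K} (hy : IsAtom y) (hz : IsAtom z)
    (h : Steps Γ (.app y z) R) : R = .app y z := by
  rcases Relation.ReflTransGen.cases_head h with h | ⟨_, h, -⟩
  · exact h.symm
  · exact absurd h (not_step_app_atom hy hz)

theorem ECtx.fill_eq_app_lam {E : ECtx P K} {y z M N : Tm P K} {σ : Ty P} (hy : IsAtom y)
    (h : E.fill (.app y z) = .app (.lam σ M) N) :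
    ∃ F, E = .comp (.appR (.lam σ M)) F ∧ N = F.fill (.app y z) := by
  cases E with
  | hole => obtain ⟨rfl, rfl⟩ := Tm.app.inj h; cases hy
  | comp C F =>
    cases C with
    | appL L =>
      obtain ⟨h', rfl⟩ := Tm.app.inj h
      exact absurd (h' ▸ IsValue.lam σ M) (F.not_isValue_fill not_isValue_app)
    | appR L => obtain ⟨rfl, rfl⟩ := Tm.app.inj h; exact ⟨F, rfl, rfl⟩
    | box => cases h

/-- Lets a `flat` step on `E[y z]` be repeated on `E[y A]`: the application that it names is still
headed by the same atom. -/
theorem ECtx.fill_eq_app_atom {E : ECtx P K} {y z y' N : Tm P K} (hy' : IsAtom y')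
    (h : E.fill (.app y z) = .app y' N) (A : Tm P K) : ∃ N', E.fill (.app y A) = .app y' N' := by
  cases E with
  | hole => obtain ⟨rfl, rfl⟩ := Tm.app.inj h; exact ⟨A, rfl⟩
  | comp C F =>
    cases C with
    | appL L =>
      obtain ⟨h', rfl⟩ := Tm.app.inj h
      exact absurd (h' ▸ hy'.isValue) (F.not_isValue_fill not_isValue_app)
    | appR L => obtain ⟨rfl, rfl⟩ := Tm.app.inj h; exact ⟨_, rfl⟩
    | box => cases h

theorem ECtx.hasType_replace {Γ : List (Ty P)} {E : ECtx P K} {y z A : Tm P K} {τ ρ : Ty P}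
    (h : HasType Γ (E.fill (.app y z)) τ) (hz : HasType Γ z ρ) (hA : HasType Γ A ρ) :
    HasType Γ (E.fill (.app y A)) τ := by
  obtain ⟨σ, h, hE⟩ := E.hasType_fill h
  obtain ⟨ρ', hy, hz'⟩ := hasType_app.1 h
  obtain rfl := hz.unique hz'
  simpa using hE Γ id _ (fun _ _ h => h) (.app _ _ _ _ _ hy hA)

/-- The reducts of `E[y z]` have the same shape, and the reduction does not depend on the
atom `z`. -/
theorem Step.replace {Γ : List (Ty P)} {E : ECtx P K} {y z R : Tm P K} {ρ : Ty P}
    (hE : E.IsEval) (hy : IsAtom y) (hz : IsAtom z) (hzρ : HasType Γ z ρ)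
    (h : Step Γ (E.fill (.app y z)) R) : ∃ F : ECtx P K, F.IsEval ∧ R = F.fill (.app y z) ∧
      ∀ A, HasType Γ A ρ → Steps Γ (E.fill (.app y A)) (F.fill (.app y A)) := by
  induction E generalizing R with
  | hole => exact absurd h (not_step_app_atom hy hz)
  | comp C E ih =>
    obtain ⟨hC, hE⟩ := hE
    have nv (A : Tm P K) : ¬ IsValue (E.fill (.app y A)) := E.not_isValue_fill not_isValue_app
    generalize hT : (ECtx.comp C E).fill (.app y z) = T at h
    rw [ECtx.fill] at hT
    cases h with
    | rule _ _ _ h =>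
      cases h with
      | idImp σ M =>
        cases C with
        | appL L =>
          obtain ⟨h, rfl⟩ := Tm.app.inj hT
          exact absurd (h ▸ IsValue.lam _ _) (nv z)
        | appR V =>
          obtain ⟨rfl, rfl⟩ := Tm.app.inj hT
          exact ⟨E, hE, rfl, fun A _ => (Rule.idImp _ _).steps⟩
        | box => cases hT
      | betaImp σ M V hV =>
        cases C with
        | appL L =>
          obtain ⟨h, rfl⟩ := Tm.app.inj hT
          exact absurd (h ▸ IsValue.lam _ _) (nv z)
        | appR V =>
          obtain ⟨rfl, rfl⟩ := Tm.app.inj hT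
          exact absurd hV (nv z)
        | box => cases hT
      | etaImp => cases C <;> cases hT
      | lift D σ M N hD =>
        obtain ⟨rfl, h⟩ := Frame.fill_inj hC hD (nv z) not_isValue_app hT
        obtain ⟨F, rfl, rfl⟩ := ECtx.fill_eq_app_lam hy h
        exact ⟨.comp (.appR _) F, ⟨.lam _ _, hE.2⟩, rfl, fun A _ => (Rule.lift C _ _ _ hC).steps⟩
      | flat D σ y' M hy' hD hne hσ =>
        obtain ⟨rfl, h⟩ := Frame.fill_inj hC hD (nv z) not_isValue_app hT
        refine ⟨.comp (.appR _) E, ⟨.lam _ _, hE⟩, by rw [← h]; rfl, fun A hA => ?_⟩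
        obtain ⟨N', hN'⟩ := ECtx.fill_eq_app_atom hy' h A
        rw [← h] at hσ
        have hσ' := ECtx.hasType_replace hσ hzρ hA
        simp only [ECtx.fill, Frame.fill]
        rw [hN'] at hσ' ⊢
        exact (Rule.flat C _ _ _ hy' hC hne hσ').steps
      | betaOmega F σ y' M hy' hF =>
        cases C with
        | appL L =>
          obtain ⟨h, rfl⟩ := Tm.app.inj hT
          exact absurd (h ▸ IsValue.lam _ _) (nv z)
        | appR V =>
          obtain ⟨rfl, rfl⟩ := Tm.app.inj hT
          -- The contraction moves the argument, which contains the hole, into `F[y' -]`; this is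
          -- again an evaluation context.
          refine ⟨F.append (.comp (.appR y') E), hF.append ⟨hy'.isValue, hE⟩, ?_, fun A _ => ?_⟩
          · rw [ECtx.append_fill]; rfl
          · rw [ECtx.append_fill]
            exact (Rule.betaOmega F _ _ _ hy' hF).steps
        | box => cases hT
      | idBox σ M =>
        cases C with
        | appL => cases hT
        | appR => cases hT
        | box σs Vs Ms L =>
          obtain ⟨rfl, h, rfl⟩ := Tm.box.inj hT
          have hl := congrArg List.length h
          obtain ⟨rfl, rfl⟩ : Vs = [] ∧ Ms = [] := by
            constructor <;> (rw [← List.length_eq_zero_iff]; simp at hl; omega)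
          obtain rfl : _ = R := (List.cons.inj h).1
          exact ⟨E, hE, rfl, fun A _ => (Rule.idBox _ _).steps⟩
      | betaBox ws ys zs σ Ws Ns Ps V M hWs hV hlen =>
        cases C with
        | appL => cases hT
        | appR => cases hT
        | box σs Vs Ms L =>
          obtain ⟨rfl, h, rfl⟩ := Tm.box.inj hT
          -- The merged box contains the hole, lies to its right, or lies to its left. The second
          -- case is impossible, since all arguments before the merged box are values.
          rcases append_cons_eq_append_cons h with ⟨rfl, h', rfl⟩ | ⟨q, rfl, rfl⟩ | ⟨q, rfl, rfl⟩
          · cases E with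
            | hole => cases h'
            | comp C E =>
              cases C with
              | appL => cases h'
              | appR => cases h'
              | box σs' Vs' Ms' L' =>
                obtain ⟨rfl, rfl, rfl⟩ := Tm.box.inj h'
                refine ⟨.comp (.box (ws ++ σs' ++ zs) (Vs ++ Vs') (Ms' ++ Ms)
                  (L.instBox ws.length σs'.length L')) E,
                  ⟨fun V hV => ?_, hE.2⟩, ?_, fun A _ => ?_⟩
                · exact (List.mem_append.1 hV).elim (hC V) (hE.1 V)
                · simp [ECtx.fill, Frame.fill]
                · have := Rule.betaBox (Γ := Γ) ws σs' zs σ Vs (Vs' ++ E.fill (.app y A) :: Ms') Ms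
                    L' L hWs hV hlen
                  simpa [ECtx.fill, Frame.fill] using this.steps
          · exact absurd (hWs _ (by simp)) (nv z)
          · have hb : IsValue (.box ys Ns V) := hC _ (by simp)
            refine ⟨.comp (.box (ws ++ ys ++ zs) (Ws ++ Ns ++ q) Ms
              (L.instBox ws.length ys.length V)) E,
              ⟨fun V hV => ?_, hE⟩, ?_, fun A _ => ?_⟩
            · simp only [List.mem_append] at hV
              rcases hV with (hV | hV) | hV
              · exact hWs V hV
              · exact isValue_box.1 hb V hV
              · exact hC V (by simp [hV])
            · simp [ECtx.fill, Frame.fill]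
            · have := Rule.betaBox (Γ := Γ) ws ys zs σ Ws Ns (q ++ E.fill (.app y A) :: Ms) V L
                hWs hV hlen
              simpa [ECtx.fill, Frame.fill] using this.steps
    | lam => cases C <;> cases hT
    | appL _ M M' N h =>
      cases C with
      | appL L =>
        obtain ⟨rfl, rfl⟩ := Tm.app.inj hT
        obtain ⟨F, hF, rfl, hA⟩ := ih hE h
        exact ⟨.comp (.appL L) F, ⟨trivial, hF⟩, rfl, fun A h => (hA A h).fill (.appL L)⟩
      | appR V =>
        obtain ⟨rfl, rfl⟩ := Tm.app.inj hT
        exact ⟨.comp (.appR M') E, ⟨h.isValue hC, hE⟩, rfl, fun A _ => .single (.appL _ _ _ _ h)⟩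
      | box => cases hT
    | appR _ M N N' h =>
      cases C with
      | appL L =>
        obtain ⟨rfl, rfl⟩ := Tm.app.inj hT
        exact ⟨.comp (.appL N') E, ⟨trivial, hE⟩, rfl, fun A _ => .single (.appR _ _ _ _ h)⟩
      | appR V =>
        obtain ⟨rfl, rfl⟩ := Tm.app.inj hT
        obtain ⟨F, hF, rfl, hA⟩ := ih hE h
        exact ⟨.comp (.appR V) F, ⟨hC, hF⟩, rfl, fun A h => (hA A h).fill (.appR V)⟩
      | box => cases hT
    | boxArg _ σs Ls Rs N N' M h =>
      cases C with
      | appL => cases hT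
      | appR => cases hT
      | box σs Vs Ms L =>
        obtain ⟨rfl, hl, rfl⟩ := Tm.box.inj hT
        rcases append_cons_eq_append_cons hl with ⟨rfl, rfl, rfl⟩ | ⟨q, rfl, rfl⟩ | ⟨q, rfl, rfl⟩
        · obtain ⟨F, hF, rfl, hA⟩ := ih hE h
          exact ⟨.comp (.box σs Vs Ms L) F, ⟨hC, hF⟩, rfl, fun A h => (hA A h).fill _⟩
        · refine ⟨.comp (.box σs Vs (q ++ N' :: Rs) L) E, ⟨hC, hE⟩, ?_, fun A _ => ?_⟩
          · simp [ECtx.fill, Frame.fill]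
          · have := Step.boxArg Γ σs (Vs ++ E.fill (.app y A) :: q) Rs N N' L h
            exact .single (by simpa [ECtx.fill, Frame.fill] using this)
        · refine ⟨.comp (.box σs (Ls ++ N' :: q) Ms L) E, ⟨fun V hV => ?_, hE⟩, ?_, fun A _ => ?_⟩
          · simp only [List.mem_append, List.mem_cons] at hV
            rcases hV with hV | rfl | hV
            · exact hC V (by simp [hV])
            · exact h.isValue (hC N (by simp))
            · exact hC V (by simp [hV])
          · simp [ECtx.fill, Frame.fill]
          · have := Step.boxArg Γ σs Ls (q ++ E.fill (.app y A) :: Ms) N N' L h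
            exact .single (by simpa [ECtx.fill, Frame.fill] using this)
    | boxBody _ σs Ns M M' h =>
      cases C with
      | appL => cases hT
      | appR => cases hT
      | box σs Vs Ms L =>
        obtain ⟨rfl, rfl, rfl⟩ := Tm.box.inj hT
        exact ⟨.comp (.box σs Vs Ms M') E, ⟨hC, hE⟩, rfl,
          fun A _ => .single (.boxBody _ _ _ _ _ h)⟩

theorem Steps.replace {Γ : List (Ty P)} {E : ECtx P K} {y z R : Tm P K} {ρ : Ty P}
    (hE : E.IsEval) (hy : IsAtom y) (hz : IsAtom z) (hzρ : HasType Γ z ρ)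
    (h : Steps Γ (E.fill (.app y z)) R) : ∃ F : ECtx P K, F.IsEval ∧ R = F.fill (.app y z) ∧
      ∀ A, HasType Γ A ρ → Steps Γ (E.fill (.app y A)) (F.fill (.app y A)) := by
  induction h with
  | refl => exact ⟨E, hE, rfl, fun A _ => .refl⟩
  | tail _ h ih =>
    obtain ⟨F, hF, rfl, hA⟩ := ih
    obtain ⟨G, hG, rfl, hA'⟩ := h.replace hF hy hz hzρ
    exact ⟨G, hG, rfl, fun A h => (hA A h).trans (hA' A h)⟩

-- Contraction of bound calls

/-- `L = E[y x]` for the most recently bound variable `x`, not free in `E[y]`. -/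
def IsLinear (L : Tm P K) : Prop :=
  ∃ (E : ECtx P K) (y : Tm P K), E.IsEval ∧ IsAtom y ∧ L = E.weaken.fill (.app y.weaken (.var 0))

open Classical in
/-- The contraction of `(λx. L) A` by the rules that do not depend on `A`. -/
noncomputable def slet (τ : Ty P) (L A : Tm P K) : Tm P K :=
  if L = .var 0 ∨ IsLinear L then L.inst A else .app (.lam τ L) A

theorem slet_var (τ : Ty P) (A : Tm P K) : slet τ (.var 0) A = A := by
  simp [slet, inst_eq]

theorem slet_linear {E : ECtx P K} {y : Tm P K} (hE : E.IsEval) (hy : IsAtom y) (τ : Ty P)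
    (A : Tm P K) : slet τ (E.weaken.fill (.app y.weaken (.var 0))) A = E.fill (.app y A) := by
  have : IsLinear (E.weaken.fill (.app y.weaken (.var 0))) := ⟨E, y, hE, hy, rfl⟩
  simp only [slet, this, or_true, if_true, E.weaken_fill_inst]
  simp only [inst_eq, subst_app, subst_var, scons_zero]
  rw [← inst_eq, weaken_inst]

theorem steps_slet (Γ : List (Ty P)) (τ : Ty P) (L A : Tm P K) :
    Steps Γ (.app (.lam τ L) A) (slet τ L A) := by
  by_cases h : L = .var 0 ∨ IsLinear L
  · rcases h with rfl | ⟨E, y, hE, hy, rfl⟩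
    · rw [slet_var]; exact (Rule.idImp _ _).steps
    · rw [slet_linear hE hy]; exact (Rule.betaOmega _ _ _ _ hy hE).steps
  · simp only [slet, h, if_false]; exact .refl

/-- The term `E[y A]` has lost the binder, so reductions of the body `E[y x]` cannot be carried out
under it. `Steps.replace` repeats them with `A` for `x`, and the reduct of the body is again linear,
so `slet` contracts it to the term thus reached. -/
theorem Steps.slet_of_linear {Γ : List (Ty P)} {E : ECtx P K} {y A R : Tm P K} {τ : Ty P}
    (hE : E.IsEval) (hy : IsAtom y) (hA : HasType Γ A τ)
    (h : Steps (τ :: Γ) (E.weaken.fill (.app y.weaken (.var 0))) R) :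
    Steps Γ (E.fill (.app y A)) (slet τ R A) := by
  obtain ⟨F, hF, rfl, h'⟩ := h.replace hE.weaken (hy.rename _) (.var 0)
    (.var _ _ τ (by simp))
  replace h := h' A.weaken (hA.weaken τ)
  change Steps _ (E.weaken.fill (.app y.weaken A.weaken)) (F.fill (.app y.weaken A.weaken)) at h
  change Steps _ _ (slet τ (F.fill (.app y.weaken (.var 0))) A)
  have eq : E.weaken.fill (.app y.weaken A.weaken) = (E.fill (.app y A)).weaken := by
    simp [Tm.weaken, E.rename_fill, E.weaken_eq]
  rw [eq] at h
  -- A weakened term does not contain variable `0`, and reduction creates no free variables. Hence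
  -- `F` is a weakening, and `Nat.pred` brings the reduction back to `Γ`.
  have hS := scoped_weaken (E.fill (.app y A))
  have h' := Steps.rename_of_scoped (Γ' := Γ) (f := Nat.pred) h hS (by
    intro i σ hi h
    obtain ⟨i, rfl⟩ := Nat.exists_eq_succ_of_ne_zero hi
    simpa using h)
  have hF' := ECtx.weaken_rename_pred (h.scoped hS)
  rw [rename_pred_weaken, F.rename_fill, rename_app, rename_pred_weaken, rename_pred_weaken] at h'
  rw [← hF', slet_linear (hF.rename _) hy]
  exact h'

-- The model: computations and denotations

/-- Atoms, with variables named by de Bruijn levels. -/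
inductive At (P : Type u) (K : Type v) : Type (max u v)
  | con (c : K) (σ : Ty P) : At P K
  | lvl (l : ℕ) : At P K

/-- The term that an atom denotes in a context of length `n`. -/
def At.toTm (n : ℕ) : At P K → Tm P K
  | .con c σ => .con c σ
  | .lvl l => .var (n - 1 - l)

/-- Computations: a sequence of calls of atoms, each of which binds its result, that ends with a
result in `X`. -/
inductive Tree (P : Type u) (K : Type v) (X : Type (max u v)) : Type (max u v)
  | ret (x : X) : Tree P K X
  | call (a : At P K) (W : Tm P K) (τ : Ty P) (t : Tree P K X) : Tree P K X

/-- Sequencing of a computation in a context of length `n`. -/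
def Tree.bind {X Y : Type (max u v)} : Tree P K X → ℕ → (X → ℕ → Tree P K Y) → Tree P K Y
  | .ret x, n, f => f x n
  | .call a W τ t, n, f => .call a W τ (t.bind (n + 1) f)

/-- The result of a computation without calls. -/
def Tree.result {X : Type (max u v)} [Inhabited X] : Tree P K X → X
  | .ret x => x
  | .call _ _ _ _ => default

/-- Computations that depend on the length of the context. -/
def Comp (P : Type u) (K : Type v) (X : Type (max u v)) : Type (max u v) := ℕ → Tree P K X

/-- The computation that returns `x`. -/
def Comp.ret {X : Type (max u v)} (x : X) : Comp P K X := fun _ => .ret x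

/-- Sequencing of computations. -/
def Comp.bind {X Y : Type (max u v)} (m : Comp P K X) (f : X → Comp P K Y) : Comp P K Y :=
  fun n => (m n).bind n f

@[simp] theorem Comp.ret_bind {X Y : Type (max u v)} (x : X) (f : X → Comp P K Y) :
    (Comp.ret x).bind f = f x := rfl

theorem Tree.bind_ret {X : Type (max u v)} (t : Tree P K X) (n : ℕ) :
    t.bind n Comp.ret = t := by
  induction t generalizing n with
  | ret => rfl
  | call a W τ t ih => simp [Tree.bind, ih]

@[simp] theorem Comp.bind_ret {X : Type (max u v)} (m : Comp P K X) : m.bind Comp.ret = m :=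
  funext fun n => (m n).bind_ret n

theorem Tree.bind_assoc {X Y Z : Type (max u v)} (t : Tree P K X) (n : ℕ) (f : X → Comp P K Y)
    (g : Y → Comp P K Z) : (t.bind n f).bind n g = t.bind n fun x => (f x).bind g := by
  induction t generalizing n with
  | ret => rfl
  | call a W τ t ih => simp [Tree.bind, ih]

@[simp] theorem Comp.bind_assoc {X Y Z : Type (max u v)} (m : Comp P K X) (f : X → Comp P K Y)
    (g : Y → Comp P K Z) : (m.bind f).bind g = m.bind fun x => (f x).bind g :=
  funext fun n => (m n).bind_assoc n f g

/-- The denotations of the values of a type.  A value of type `□σ` is a list of typed atoms that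
are bound to the variables of a body; the body depends on the number of variables that are bound
after them. -/
def D (P : Type u) (K : Type v) : Ty P → Type (max u v)
  | .base _ => At P K
  | .imp σ τ => D P K σ → Comp P K (D P K τ)
  | .box σ => List (At P K × Ty P) × (ℕ → D P K σ)

/-- The function that is denoted by a value of type `σ ⊃ τ`. -/
def D.app {σ τ : Ty P} (f : D P K (.imp σ τ)) : D P K σ → Comp P K (D P K τ) := f

/-- The atoms of a value of type `□σ`. -/
def D.atoms {σ : Ty P} (d : D P K (.box σ)) : List (At P K × Ty P) := Prod.fst d

/-- The body of a value of type `□σ`. -/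
def D.body {σ : Ty P} (d : D P K (.box σ)) : ℕ → D P K σ := Prod.snd d

/-- The value of type `□σ` with given atoms and body. -/
def D.box {σ : Ty P} (as : List (At P K × Ty P)) (b : ℕ → D P K σ) : D P K (.box σ) := (as, b)

@[simp] theorem D.atoms_box {σ : Ty P} (as : List (At P K × Ty P)) (b : ℕ → D P K σ) :
    (D.box as b).atoms = as := rfl

theorem D.box_eta {σ : Ty P} (d : D P K (.box σ)) : D.box d.atoms d.body = d := rfl

/-- Some element of `D σ`. -/
def D.some : (σ : Ty P) → D P K σ
  | .base _ => At.lvl 0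
  | .imp _ τ => fun _ => Comp.ret (D.some τ)
  | .box σ => ([], fun _ => D.some σ)

instance (σ : Ty P) : Inhabited (D P K σ) := ⟨D.some σ⟩

-- Reflection and reification

open Classical in
/-- `λx. M`, up to an `η`-step. -/
noncomputable def etaLam (σ : Ty P) (M : Tm P K) : Tm P K :=
  if h : ∃ V : Tm P K, IsValue V ∧ M = .app V.weaken (.var 0) then h.choose else .lam σ M

/-- The chosen value is unique because weakening is injective. -/
theorem etaLam_app {σ : Ty P} {V : Tm P K} (hV : IsValue V) :
    etaLam σ (.app V.weaken (.var 0)) = V := by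
  have h : ∃ W : Tm P K, IsValue W ∧ Tm.app V.weaken (.var 0) = .app W.weaken (.var 0) :=
    ⟨V, hV, rfl⟩
  rw [etaLam, dif_pos h]
  exact weaken_injective (Tm.app.inj h.choose_spec.2).1.symm

theorem steps_etaLam (Γ : List (Ty P)) (σ : Ty P) (M : Tm P K) :
    Steps Γ (.lam σ M) (etaLam σ M) := by
  by_cases h : ∃ V : Tm P K, IsValue V ∧ M = .app V.weaken (.var 0)
  · obtain ⟨V, hV, rfl⟩ := h
    rw [etaLam_app hV]
    exact (Rule.etaImp _ _ hV).steps
  · rw [etaLam, dif_neg h]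
    exact .refl

open Classical in
/-- A box, up to the identity rule. -/
noncomputable def idBox (σs : List (Ty P)) (As : List (Tm P K)) (M : Tm P K) : Tm P K :=
  if h : ∃ A : Tm P K, (∃ σ, σs = [σ]) ∧ As = [A] ∧ M = .var 0 then h.choose else .box σs As M

theorem idBox_var (σ : Ty P) (A : Tm P K) : idBox [σ] [A] (.var 0) = A := by
  have h : ∃ B : Tm P K, (∃ τ, [σ] = [τ]) ∧ [A] = [B] ∧ (.var 0 : Tm P K) = .var 0 :=
    ⟨A, ⟨σ, rfl⟩, rfl, rfl⟩
  rw [idBox, dif_pos h]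
  exact (List.cons.inj h.choose_spec.2.1).1.symm

theorem steps_idBox (Γ σs : List (Ty P)) (As : List (Tm P K)) (M : Tm P K) :
    Steps Γ (.box σs As M) (idBox σs As M) := by
  by_cases h : ∃ A : Tm P K, (∃ σ, σs = [σ]) ∧ As = [A] ∧ M = .var 0
  · obtain ⟨A, ⟨σ, rfl⟩, rfl, rfl⟩ := h
    rw [idBox_var]
    exact (Rule.idBox _ _).steps
  · rw [idBox, dif_neg h]
    exact .refl

/-- The term that a computation denotes in a context of length `n`. -/
noncomputable def Tree.toTm {X : Type (max u v)} (r : X → ℕ → Tm P K) : Tree P K X → ℕ → Tm P K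
  | .ret x, n => r x n
  | .call a W τ t, n => slet τ (t.toTm r (n + 1)) (.app (a.toTm n) W)

/-- Reflection of atoms into denotations, and reification of denotations as normal forms. -/
noncomputable def nbe : (σ : Ty P) → (At P K → D P K σ) × (D P K σ → ℕ → Tm P K)
  | .base _ => (id, fun a n => At.toTm n a)
  | .imp σ τ =>
    -- In a context of length `n`, the result of the call is bound to the fresh level `n`.
    (fun a d n => .call a ((nbe σ).2 d n) τ (.ret ((nbe τ).1 (.lvl n))),
      fun d n => etaLam σ (Tree.toTm (nbe τ).2 (d ((nbe σ).1 (.lvl n)) (n + 1)) (n + 1)))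
  | .box σ =>
    -- An atom is identified with the box of its own variable, as the identity rule demands. With
    -- `o` variables bound after it, that variable has level `o`.
    (fun a => ([(a, σ)], fun o => (nbe σ).1 (.lvl o)),
      fun d n => idBox (d.1.map Prod.snd) (d.1.map fun p => p.1.toTm n)
        ((nbe σ).2 (d.2 0) d.1.length))

/-- The denotation of an atom. -/
noncomputable def reflect (σ : Ty P) : At P K → D P K σ := (nbe σ).1

/-- The normal form of a denotation. -/
noncomputable def reify (σ : Ty P) : D P K σ → ℕ → Tm P K := (nbe σ).2

theorem reflect_imp (σ τ : Ty P) (a : At P K) (d : D P K σ) (n : ℕ) :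
    (reflect (.imp σ τ) a).app d n = .call a (reify σ d n) τ (.ret (reflect τ (.lvl n))) := rfl

theorem reflect_box (σ : Ty P) (a : At P K) :
    reflect (.box σ) a = D.box [(a, σ)] fun o => reflect σ (.lvl o) := rfl

theorem reify_imp (σ τ : Ty P) (d : D P K (.imp σ τ)) (n : ℕ) :
    reify (.imp σ τ) d n =
      etaLam σ ((d.app (reflect σ (.lvl n)) (n + 1)).toTm (reify τ) (n + 1)) := rfl

theorem reify_box (σ : Ty P) (d : D P K (.box σ)) (n : ℕ) :
    reify (.box σ) d n = idBox (d.atoms.map Prod.snd) (d.atoms.map fun p => p.1.toTm n)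
      (reify σ (d.body 0) d.atoms.length) := rfl

-- Environments and arguments of boxes

/-- Environments. -/
abbrev Env (P : Type u) (K : Type v) : Type (max u v) := ℕ → Σ σ, D P K σ

/-- Extension of an environment, or of any other sequence. -/
def ncons {X : Type*} (x : X) (s : ℕ → X) : ℕ → X
  | 0 => x
  | i + 1 => s i

@[simp] theorem ncons_zero {X : Type*} (x : X) (s : ℕ → X) : ncons x s 0 = x := rfl
@[simp] theorem ncons_succ {X : Type*} (x : X) (s : ℕ → X) (i : ℕ) : ncons x s (i + 1) = s i := rfl

theorem ncons_comp_upRen {X : Type*} (x : X) (s : ℕ → X) (f : ℕ → ℕ) :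
    ncons x s ∘ upRen f = ncons x (s ∘ f) := by
  funext i; cases i <;> rfl

open Classical in
/-- A denotation as a denotation of type `τ`. -/
noncomputable def coeD (x : Σ σ, D P K σ) (τ : Ty P) : D P K τ :=
  if h : x.1 = τ then h ▸ x.2 else default

@[simp] theorem coeD_mk (σ : Ty P) (d : D P K σ) : coeD ⟨σ, d⟩ σ = d := by
  simp [coeD]

/-- Denotations of the arguments of a box. -/
def Args (P : Type u) (K : Type v) : List (Ty P) → Type (max u v)
  | [] => PUnit
  | σ :: σs => D P K (.box σ) × Args P K σs

/-- The empty list of arguments. -/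
def Args.nil : Args P K [] := PUnit.unit

/-- A nonempty list of arguments. -/
def Args.cons {σ : Ty P} {σs : List (Ty P)} (d : D P K (.box σ)) (ds : Args P K σs) :
    Args P K (σ :: σs) := (d, ds)

/-- Some list of arguments. -/
def Args.some : (σs : List (Ty P)) → Args P K σs
  | [] => .nil
  | _ :: σs => .cons default (Args.some σs)

instance (σs : List (Ty P)) : Inhabited (Args P K σs) := ⟨Args.some σs⟩

/-- The atoms of a list of arguments. -/
def Args.atoms : {σs : List (Ty P)} → Args P K σs → List (At P K × Ty P)
  | [], _ => []
  | _ :: _, ds => D.atoms (Prod.fst ds) ++ Args.atoms (Prod.snd ds)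

/-- Concatenation of lists of arguments. -/
def Args.append : {σs τs : List (Ty P)} → Args P K σs → Args P K τs → Args P K (σs ++ τs)
  | [], _, _, es => es
  | _ :: _, _, ds, es => .cons (Prod.fst ds) (Args.append (Prod.snd ds) es)

@[simp] theorem Args.atoms_nil (ds : Args P K []) : ds.atoms = [] := rfl

@[simp] theorem Args.atoms_cons {σ : Ty P} {σs : List (Ty P)} (d : D P K (.box σ))
    (ds : Args P K σs) : (Args.cons d ds).atoms = d.atoms ++ ds.atoms := rfl

@[simp] theorem Args.nil_append {τs : List (Ty P)} (ds : Args P K []) (es : Args P K τs) :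
    ds.append es = es := rfl

@[simp] theorem Args.cons_append {σ : Ty P} {σs τs : List (Ty P)} (d : D P K (.box σ))
    (ds : Args P K σs) (es : Args P K τs) : (Args.cons d ds).append es = .cons d (ds.append es) :=
  rfl

theorem Args.exists_cons {σ : Ty P} {σs : List (Ty P)} (ds : Args P K (σ :: σs)) :
    ∃ d es, ds = Args.cons d es := ⟨Prod.fst ds, Prod.snd ds, rfl⟩

@[simp] theorem Args.atoms_append {σs τs : List (Ty P)} (ds : Args P K σs) (es : Args P K τs) :
    (ds.append es).atoms = ds.atoms ++ es.atoms := by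
  induction σs with
  | nil => rfl
  | cons σ σs ih =>
    obtain ⟨d, ds, rfl⟩ := ds.exists_cons
    simp only [List.cons_append, cons_append, atoms_cons, ih, List.append_assoc]

/-- The environment `env` has the types that `Γ` prescribes. -/
def EnvOK (Γ : List (Ty P)) (env : Env P K) : Prop :=
  ∀ i σ, Γ[i]? = some σ → (env i).1 = σ

theorem EnvOK.cons {Γ : List (Ty P)} {env : Env P K} (h : EnvOK Γ env) (σ : Ty P) (d : D P K σ) :
    EnvOK (σ :: Γ) (ncons ⟨σ, d⟩ env) := by
  intro i τ hi
  cases i with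
  | zero => simpa using hi
  | succ i => exact h i τ (by simpa using hi)

section eval

variable [Inhabited (Ty P)]

/-- The environment for the body of a box, in which `o` further variables are bound after those
of the arguments. -/
def Args.env : {σs : List (Ty P)} → Args P K σs → ℕ → Env P K
  | [], _, _ => fun _ => default
  | σ :: _, ds, o =>
    ncons ⟨σ, D.body (Prod.fst ds) (o + (Args.atoms (Prod.snd ds)).length)⟩
      (Args.env (Prod.snd ds) o)

@[simp] theorem Args.env_cons {σ : Ty P} {σs : List (Ty P)} (d : D P K (.box σ))
    (ds : Args P K σs) (o : ℕ) :
    (Args.cons d ds).env o = ncons ⟨σ, d.body (o + ds.atoms.length)⟩ (ds.env o) := rfl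

theorem Args.env_fst {σs : List (Ty P)} (ds : Args P K σs) (o : ℕ) {i : ℕ} {σ : Ty P}
    (h : σs[i]? = Option.some σ) : (ds.env o i).1 = σ := by
  induction σs generalizing i with
  | nil => simp at h
  | cons τ σs ih =>
    obtain ⟨d, ds, rfl⟩ := ds.exists_cons
    cases i with
    | zero => simpa using h
    | succ i => exact ih ds (by simpa using h)

/-- The variables for the atoms of `es` are bound after those of `ds`, which raises the offset of
`ds`. -/
theorem Args.env_append_left {σs τs : List (Ty P)} (ds : Args P K σs) (es : Args P K τs)
    (o : ℕ) {i : ℕ} (hi : i < σs.length) :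
    (ds.append es).env o i = ds.env (o + es.atoms.length) i := by
  induction σs generalizing i with
  | nil => simp at hi
  | cons τ σs ih =>
    obtain ⟨d, ds, rfl⟩ := ds.exists_cons
    simp only [List.cons_append, cons_append, env_cons, atoms_append]
    cases i with
    | zero =>
      simp only [ncons_zero, List.length_append]
      rw [Nat.add_assoc, Nat.add_comm es.atoms.length]
    | succ i => exact ih ds (by simpa using hi)

theorem Args.env_append_right {σs τs : List (Ty P)} (ds : Args P K σs) (es : Args P K τs)
    (o i : ℕ) : (ds.append es).env o (σs.length + i) = es.env o i := by
  induction σs with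
  | nil => simp
  | cons τ σs ih =>
    obtain ⟨d, ds, rfl⟩ := ds.exists_cons
    simp only [List.cons_append, cons_append, env_cons, List.length_cons]
    rw [Nat.add_right_comm]
    exact ih ds

-- Evaluation of terms

/-- The result type of a function type. -/
def Ty.cod : Ty P → Ty P
  | .imp _ τ => τ
  | τ => τ

/-- The type of a typable term. -/
noncomputable def ity : (ℕ → Ty P) → Tm P K → Ty P
  | _, .con _ σ => σ
  | g, .var i => g i
  | g, .lam σ M => .imp σ (ity (ncons σ g) M)
  | g, .app M _ => (ity g M).cod
  | _, .box σs _ M => .box (ity (fun i => σs[i]?.getD default) M)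

/-- The value of type `τ` that is denoted by an abstraction. -/
def lamD (F : ∀ σ τ : Ty P, D P K σ → Comp P K (D P K τ)) : (τ : Ty P) → D P K τ
  | .base _ => default
  | .imp σ τ => F σ τ
  | .box _ => default

/-- The value of type `τ` that is denoted by a box. -/
def boxD (F : ∀ τ : Ty P, D P K (.box τ)) : (τ : Ty P) → D P K τ
  | .base _ => default
  | .imp _ _ => default
  | .box τ => F τ

mutual
  /-- The denotation of a term of type `τ`. -/
  noncomputable def eval : Tm P K → Env P K → (τ : Ty P) → Comp P K (D P K τ)
    | .con c σ, _, τ => .ret (coeD ⟨σ, reflect σ (.con c σ)⟩ τ)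
    | .var i, env, τ => .ret (coeD (env i) τ)
    | .lam _ M, env, τ => .ret (lamD (fun σ' τ' d => eval M (ncons ⟨σ', d⟩ env) τ') τ)
    | .app M N, env, τ =>
      (eval M env (.imp (ity (fun i => (env i).1) N) τ)).bind fun f =>
        (eval N env (ity (fun i => (env i).1) N)).bind f.app
    | .box σs Ns M, env, τ =>
      (evalList Ns env σs).bind fun ds =>
        -- In a call-by-value term the body is a value, so its evaluation makes no calls and the
        -- context length `0` plays no role.
        .ret (boxD (fun τ' => .box ds.atoms fun o => (eval M (ds.env o) τ' 0).result) τ)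
  /-- The denotations of the arguments of a box. -/
  noncomputable def evalList : List (Tm P K) → Env P K → (σs : List (Ty P)) →
      Comp P K (Args P K σs)
    | [], _, _ => .ret default
    | _ :: _, _, [] => .ret default
    | N :: Ns, env, σ :: σs =>
      (eval N env (.box σ)).bind fun d => (evalList Ns env σs).bind fun ds => .ret (.cons d ds)
end

/-- The denotation of a value of type `τ`. -/
noncomputable def evalV (V : Tm P K) (env : Env P K) (τ : Ty P) : D P K τ := (eval V env τ 0).result

theorem eval_con (c : K) (σ : Ty P) (env : Env P K) :
    eval (.con c σ) env σ = .ret (reflect σ (.con c σ)) := by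
  rw [eval, coeD_mk]

theorem eval_var {i : ℕ} {env : Env P K} {σ : Ty P} {d : D P K σ} (h : env i = ⟨σ, d⟩) :
    eval (.var i) env σ = .ret d := by
  rw [eval, h, coeD_mk]

theorem eval_lam (ρ : Ty P) (M : Tm P K) (env : Env P K) (σ τ : Ty P) :
    eval (.lam ρ M) env (.imp σ τ) =
      .ret (show D P K (.imp σ τ) from fun d => eval M (ncons ⟨σ, d⟩ env) τ) := by
  rw [eval]; rfl

theorem eval_box (σs : List (Ty P)) (Ns : List (Tm P K)) (M : Tm P K) (env : Env P K) (τ : Ty P) :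
    eval (.box σs Ns M) env (.box τ) = (evalList Ns env σs).bind fun ds =>
      .ret (.box ds.atoms fun o => evalV M (ds.env o) τ) := by
  rw [eval]; rfl

theorem evalList_nil (env : Env P K) : evalList [] env [] = .ret (Args.nil : Args P K []) := by
  rw [evalList]; rfl

theorem evalList_cons (N : Tm P K) (Ns : List (Tm P K)) (env : Env P K) (σ : Ty P)
    (σs : List (Ty P)) : evalList (N :: Ns) env (σ :: σs) = (eval N env (.box σ)).bind fun d =>
      (evalList Ns env σs).bind fun ds => .ret (.cons d ds) := by
  rw [evalList]

theorem Args.envOK {σs : List (Ty P)} (ds : Args P K σs) (o : ℕ) : EnvOK σs (ds.env o) :=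
  fun _ _ h => ds.env_fst o h

/-- An application does not record the type of its argument. This recovers it, so that `eval` can be
defined on raw terms. -/
theorem HasType.ity_eq {Γ : List (Ty P)} {M : Tm P K} {τ : Ty P} (h : HasType Γ M τ)
    {g : ℕ → Ty P} (hg : ∀ i σ, Γ[i]? = some σ → g i = σ) : ity g M = τ := by
  induction h using HasType.induct generalizing g with
  | hcon => rw [ity]
  | hvar Γ i τ h => rw [ity, hg i τ h]
  | hlam Γ σ τ M h ih =>
    rw [ity, ih]
    intro i τ hi
    cases i with
    | zero => simpa using hi
    | succ i => exact hg i τ (by simpa using hi)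
  | happ Γ σ τ M N hM hN ihM ihN => rw [ity, ihM hg]; rfl
  | hbox Γ σs τ Ns M hM _ ihM hN =>
    rw [ity, ihM]
    intro i σ hi
    simp [hi]

theorem HasType.eval_app {Γ : List (Ty P)} {M N : Tm P K} {σ τ : Ty P} (h : HasType Γ N σ)
    {env : Env P K} (henv : EnvOK Γ env) : eval (.app M N) env τ =
      (eval M env (.imp σ τ)).bind fun f => (eval N env σ).bind f.app := by
  rw [eval, h.ity_eq henv]

theorem ity_rename (g : ℕ → Ty P) (f : ℕ → ℕ) (M : Tm P K) :
    ity g (M.rename f) = ity (g ∘ f) M := by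
  induction M using Tm.ind generalizing g f with
  | hcon => simp [ity]
  | hvar => simp [ity]
  | hlam σ M ih => simp [ity, ih, ncons_comp_upRen]
  | happ M N ihM ihN => simp [ity, ihM]
  | hbox σs Ns M ihN ihM => simp [ity]

theorem eval_rename (M : Tm P K) (f : ℕ → ℕ) (env : Env P K) (τ : Ty P) :
    eval (M.rename f) env τ = eval M (env ∘ f) τ := by
  induction M using Tm.ind generalizing env f τ with
  | hcon => simp [eval]
  | hvar => simp [eval]
  | hlam σ M ih => simp [eval, ih, ncons_comp_upRen]
  | happ M N ihM ihN =>
    have h : ity (fun i => (env i).1) (N.rename f) = ity (fun i => ((env ∘ f) i).1) N :=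
      ity_rename _ _ N
    rw [rename_app, eval, eval, h, ihM, ihN]
  | hbox σs Ns M ihN ihM =>
    have h : evalList (Ns.map (Tm.rename f)) env σs = evalList Ns (env ∘ f) σs := by
      clear ihM
      induction Ns generalizing σs with
      | nil => simp [evalList]
      | cons N Ns ih =>
        cases σs with
        | nil => simp [evalList]
        | cons σ σs =>
          simp only [List.map_cons, evalList_cons]
          rw [ihN N (by simp), ih σs fun N hN => ihN N (by simp [hN])]
    simp only [rename_box, eval, h]

theorem eval_weaken (M : Tm P K) (x : Σ σ, D P K σ) (env : Env P K) (τ : Ty P) :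
    eval M.weaken (ncons x env) τ = eval M env τ :=
  eval_rename M _ _ τ

theorem evalList_map_weaken (Ns : List (Tm P K)) (x : Σ σ, D P K σ) (env : Env P K)
    (σs : List (Ty P)) :
    evalList (Ns.map (Tm.rename Nat.succ)) (ncons x env) σs = evalList Ns env σs := by
  induction Ns generalizing σs with
  | nil => simp [evalList]
  | cons N Ns ih =>
    cases σs with
    | nil => simp [evalList]
    | cons σ σs =>
      simp only [List.map_cons, evalList_cons, ih]
      rw [← eval_weaken N x]; rfl

/-- Calls arise only from applications, and in a value these occur only under an abstraction or in
the body of a box, where evaluation is suspended or kept as part of the denotation. -/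
theorem IsValue.exists_eval {V : Tm P K} (h : IsValue V) (env : Env P K) (τ : Ty P) :
    ∃ d, eval V env τ = .ret d := by
  induction h generalizing τ with
  | con => exact ⟨_, by rw [eval]⟩
  | var => exact ⟨_, by rw [eval]⟩
  | lam => exact ⟨_, by rw [eval]⟩
  | box σs Vs M h ih =>
    have : ∃ ds, evalList Vs env σs = .ret ds := by
      clear h
      induction Vs generalizing σs with
      | nil => exact ⟨_, by rw [evalList]⟩
      | cons V Vs ih' =>
        cases σs with
        | nil => exact ⟨_, by rw [evalList]⟩
        | cons σ σs =>
          obtain ⟨d, hd⟩ := ih V (by simp) (.box σ)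
          obtain ⟨ds, hds⟩ := ih' σs fun V hV => ih V (by simp [hV])
          exact ⟨_, by rw [evalList_cons, hd, Comp.ret_bind, hds, Comp.ret_bind]⟩
    obtain ⟨ds, hds⟩ := this
    exact ⟨_, by rw [eval, hds, Comp.ret_bind]⟩

theorem exists_evalList {Vs : List (Tm P K)} (h : ∀ V ∈ Vs, IsValue V) (env : Env P K)
    (σs : List (Ty P)) : ∃ ds, evalList Vs env σs = .ret ds := by
  induction Vs generalizing σs with
  | nil => exact ⟨_, by rw [evalList]⟩
  | cons V Vs ih =>
    cases σs with
    | nil => exact ⟨_, by rw [evalList]⟩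
    | cons σ σs =>
      obtain ⟨d, hd⟩ := (h V (by simp)).exists_eval env (.box σ)
      obtain ⟨ds, hds⟩ := ih (fun V hV => h V (by simp [hV])) σs
      exact ⟨_, by rw [evalList_cons, hd, Comp.ret_bind, hds, Comp.ret_bind]⟩

theorem evalV_eq {V : Tm P K} {env : Env P K} {τ : Ty P} {d : D P K τ}
    (h : eval V env τ = .ret d) : evalV V env τ = d := by
  rw [evalV, h]; rfl

theorem IsValue.eval_eq {V : Tm P K} (h : IsValue V) (env : Env P K) (τ : Ty P) :
    eval V env τ = .ret (evalV V env τ) := by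
  obtain ⟨d, hd⟩ := h.exists_eval env τ
  rw [evalV_eq hd, hd]

-- Evaluation is invariant under reduction

theorem evalList_append {Ns Ns' : List (Tm P K)} {σs σs' : List (Ty P)} {env : Env P K}
    (h : σs.length = Ns.length) : evalList (Ns ++ Ns') env (σs ++ σs') =
      (evalList Ns env σs).bind fun ds => (evalList Ns' env σs').bind fun es =>
        .ret (ds.append es) := by
  induction Ns generalizing σs with
  | nil =>
    obtain rfl : σs = [] := by simpa using h
    simp only [evalList_nil, List.nil_append, Comp.ret_bind, Args.nil_append, Comp.bind_ret]
  | cons N Ns ih =>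
    cases σs with
    | nil => simp at h
    | cons σ σs =>
      simp only [List.cons_append, evalList_cons, Comp.bind_assoc, Comp.ret_bind]
      rw [ih (by simpa using h)]
      simp only [Comp.bind_assoc, Comp.ret_bind, Args.cons_append]

/-- The substituted terms must evaluate without calls, since substitution may duplicate, drop or
delay them. Typing keeps the argument types computed by `ity` in agreement on both sides. -/
theorem HasType.eval_subst {Γ Δ : List (Ty P)} {M : Tm P K} {τ : Ty P} (h : HasType Γ M τ)
    {s : ℕ → Tm P K} {env env' : Env P K} (henv : EnvOK Δ env)
    (hs : ∀ i σ, Γ[i]? = some σ → HasType Δ (s i) σ ∧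
      ∃ d, env' i = ⟨σ, d⟩ ∧ eval (s i) env σ = .ret d) :
    eval (M.subst s) env τ = eval M env' τ := by
  induction h using HasType.induct generalizing Δ s env env' with
  | hcon => simp [eval]
  | hvar Γ i τ h =>
    obtain ⟨-, d, hd, he⟩ := hs i τ h
    rw [subst_var, he, eval_var hd]
  | hlam Γ σ τ M h ih =>
    rw [subst_lam, eval_lam, eval_lam]
    congr 1
    funext d
    refine ih (henv.cons σ d) fun i ρ hi => ?_
    cases i with
    | zero =>
      obtain rfl : σ = ρ := by simpa using hi
      exact ⟨.var _ _ _ (by simp), d, rfl, eval_var rfl⟩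
    | succ i =>
      obtain ⟨h, e, he, he'⟩ := hs i ρ (by simpa using hi)
      exact ⟨h.weaken σ, e, he, (eval_weaken _ _ _ _).trans he'⟩
  | happ Γ σ τ M N hM hN ihM ihN =>
    have henv' : EnvOK Γ env' := fun i σ hi => by
      obtain ⟨-, d, hd, -⟩ := hs i σ hi
      rw [hd]
    rw [subst_app, hN.eval_app henv', (hN.subst fun i σ hi => (hs i σ hi).1).eval_app henv,
      ihM henv hs, ihN henv hs]
  | hbox Γ σs τ Ns M hM h₀ ihM hN =>
    rw [subst_box, eval_box, eval_box]
    congr 1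
    clear ihM hM h₀
    induction hN with
    | nil => simp [evalList_nil]
    | cons h _ ih =>
      rw [List.map_cons, evalList_cons, evalList_cons, h.snd henv hs, ih]

theorem HasType.eval_congr {Γ : List (Ty P)} {M : Tm P K} {τ : Ty P} (h : HasType Γ M τ)
    {env env' : Env P K} (henv : EnvOK Γ env) (hs : ∀ i, i < Γ.length → env i = env' i) :
    eval M env τ = eval M env' τ := by
  have := h.eval_subst (s := Tm.var) (env' := env') henv fun i σ hi => by
    have hi' := (List.getElem?_eq_some_iff.1 hi).1
    obtain rfl := henv i σ hi
    exact ⟨.var _ _ _ hi, (env i).2, (hs i hi').symm, eval_var rfl⟩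
  rwa [subst_var_eq] at this

theorem HasType.eval_inst {Γ : List (Ty P)} {M V : Tm P K} {σ τ : Ty P}
    (h : HasType (σ :: Γ) M τ) (hV : HasType Γ V σ) (hval : IsValue V) {env : Env P K}
    (henv : EnvOK Γ env) :
    eval (M.inst V) env τ = eval M (ncons ⟨σ, evalV V env σ⟩ env) τ := by
  rw [inst_eq]
  refine h.eval_subst henv fun i ρ hi => ?_
  cases i with
  | zero =>
    obtain rfl : σ = ρ := by simpa using hi
    exact ⟨hV, _, rfl, hval.eval_eq _ _⟩
  | succ i =>
    have hi : Γ[i]? = some ρ := by simpa using hi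
    obtain rfl := henv i ρ hi
    exact ⟨.var _ _ _ hi, (env i).2, rfl, eval_var rfl⟩

/-- What stands before the hole is a value and makes no calls, so the calls of `M` come first. The
rules that move or name the term in a hole are sound for this reason. -/
theorem Frame.eval_fill {Γ : List (Ty P)} {C : Frame P K} {M : Tm P K} {σ τ : Ty P}
    (hC : C.IsSimple) (h : HasType Γ (C.fill M) τ) (hM : HasType Γ M σ) {env : Env P K}
    (henv : EnvOK Γ env) : eval (C.fill M) env τ =
      (eval M env σ).bind fun d => eval (C.weaken.fill (.var 0)) (ncons ⟨σ, d⟩ env) τ := by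
  cases C with
  | appL L =>
    obtain ⟨ρ, hM', hL⟩ := hasType_app.1 h
    obtain rfl := hM.unique hM'
    simp only [Frame.fill, Frame.weaken]
    rw [hL.eval_app henv]
    congr 1
    funext d
    rw [(hL.weaken _).eval_app (henv.cons _ d), eval_var rfl, eval_weaken, Comp.ret_bind]
  | appR V =>
    obtain ⟨ρ, hV, hM'⟩ := hasType_app.1 h
    obtain rfl := hM.unique hM'
    simp only [Frame.fill, Frame.weaken]
    rw [hM.eval_app henv, IsValue.eval_eq hC, Comp.ret_bind]
    congr 1
    funext d
    have hx : HasType (σ :: Γ) (.var 0 : Tm P K) σ := .var _ _ _ (by simp)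
    rw [hx.eval_app (henv.cons _ d), eval_var rfl, eval_weaken,
      IsValue.eval_eq hC, Comp.ret_bind, Comp.ret_bind]
  | box σs Vs Ms L =>
    obtain ⟨τ', rfl, -, hN⟩ := hasType_box.1 h
    obtain ⟨s₁, s₂, rfl, h₁, h₂⟩ := forall₂_append_left.1 hN
    obtain ⟨ρ, s₂, hM', h₂, rfl⟩ := List.forall₂_cons_left_iff.1 h₂
    obtain rfl := hM.unique hM'
    simp only [Frame.fill, Frame.weaken, renameList_eq_map, eval_box]
    obtain ⟨ds, hds⟩ := exists_evalList hC env s₁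
    rw [evalList_append h₁.length_eq.symm, evalList_cons, hds]
    simp only [Comp.ret_bind, Comp.bind_assoc]
    congr 1
    funext d
    rw [evalList_append (by simpa using h₁.length_eq.symm), evalList_cons, evalList_map_weaken,
      evalList_map_weaken, eval_var rfl, hds]
    simp only [Comp.ret_bind, Comp.bind_assoc]

theorem Frame.eval_weaken_fill (C : Frame P K) (x y : Σ σ, D P K σ) (env : Env P K) (τ : Ty P) :
    eval (C.weaken.weaken.fill (.var 0)) (ncons x (ncons y env)) τ =
      eval (C.weaken.fill (.var 0)) (ncons x env) τ := by
  have : C.weaken.weaken.fill (.var 0) = (C.weaken.fill (.var 0)).rename (upRen Nat.succ) := by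
    rw [Frame.rename_fill, Frame.weaken_rename, ← C.weaken_eq]; rfl
  rw [this, eval_rename, ncons_comp_upRen]
  rfl

theorem ECtx.eval_fill {Γ : List (Ty P)} {E : ECtx P K} {M : Tm P K} {σ τ : Ty P}
    (hE : E.IsEval) (h : HasType Γ (E.fill M) τ) (hM : HasType Γ M σ) {env : Env P K}
    (henv : EnvOK Γ env) : eval (E.fill M) env τ =
      (eval M env σ).bind fun d => eval (E.weaken.fill (.var 0)) (ncons ⟨σ, d⟩ env) τ := by
  induction E generalizing τ with
  | hole =>
    obtain rfl := h.unique hM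
    simp only [ECtx.fill, ECtx.weaken]
    conv_lhs => rw [← Comp.bind_ret (eval M env τ)]
    congr 1
    funext d
    rw [eval_var rfl]
  | comp C E ih =>
    obtain ⟨ρ, h', -⟩ := HasType.fill_weaken h
    obtain ⟨ρ', h₁, h₂⟩ := E.hasType_fill h'
    obtain rfl := hM.unique h₁
    simp only [ECtx.fill, ECtx.weaken]
    rw [C.eval_fill hE.1 h h' henv, ih hE.2 h', Comp.bind_assoc]
    congr 1
    funext d
    obtain ⟨ρ', h₃, -, h₄⟩ := HasType.fill_weaken h
    obtain rfl := h'.unique h₃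
    have h₅ := h₂ (σ :: Γ) Nat.succ (.var 0) (fun i τ h => by simpa using h)
      (.var _ _ _ (by simp))
    rw [← E.weaken_eq] at h₅
    rw [C.weaken.eval_fill hE.1.weaken (h₄ σ _ h₅) h₅ (henv.cons σ d)]
    congr 1
    funext e
    rw [C.eval_weaken_fill]

theorem ECtx.eval_weaken_fill (E : ECtx P K) (x y : Σ σ, D P K σ) (env : Env P K) (τ : Ty P) :
    eval (E.weaken.weaken.fill (.var 0)) (ncons x (ncons y env)) τ =
      eval (E.weaken.fill (.var 0)) (ncons x env) τ := by
  have : E.weaken.weaken.fill (.var 0) = (E.weaken.fill (.var 0)).rename (upRen Nat.succ) := by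
    rw [ECtx.rename_fill, ECtx.weaken_rename, ← E.weaken_eq]; rfl
  rw [this, eval_rename, ncons_comp_upRen]
  rfl

/-- The offsets agree: the variables of `w` are followed by those of `e` and `p` on both sides,
those of `e` by those of `p`. -/
theorem HasType.eval_instBox {ws ys zs : List (Ty P)} {σ τ : Ty P} {M V : Tm P K}
    (hM : HasType (ws ++ σ :: zs) M τ) (hV : HasType ys V σ) (hval : IsValue V)
    (w : Args P K ws) (e : Args P K ys) (p : Args P K zs) (o : ℕ) :
    eval (M.instBox ws.length ys.length V) (((w.append e).append p).env o) τ =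
      eval M ((w.append (.cons (.box e.atoms fun o => evalV V (e.env o) σ) p)).env o) τ := by
  refine hM.eval_subst (Args.envOK _ o) fun i ρ hi => ?_
  split_ifs with h₁ h₂
  · rw [List.getElem?_append_left h₁] at hi
    have hi' : (ws ++ ys ++ zs)[i]? = some ρ := by
      rw [List.append_assoc, List.getElem?_append_left h₁, hi]
    have h := Args.env_fst ((w.append e).append p) o hi'
    subst h
    refine ⟨.var _ _ _ hi', (((w.append e).append p).env o i).2, ?_, eval_var rfl⟩
    rw [Args.env_append_left _ _ _ h₁, Args.env_append_left _ _ _ (by simp; omega),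
      Args.env_append_left _ _ _ h₁]
    simp [Nat.add_comm, Nat.add_left_comm]
  · subst h₂
    obtain rfl : σ = ρ := by simpa using hi
    refine ⟨hV.rename fun j ρ hj => ?_, ?_⟩
    · rw [List.append_assoc, List.getElem?_append_right (by omega), Nat.add_sub_cancel_left,
        List.getElem?_append_left (List.getElem?_eq_some_iff.1 hj).1, hj]
    · have := Args.env_append_right w (.cons (.box e.atoms fun o => evalV V (e.env o) σ) p) o 0
      rw [Nat.add_zero] at this
      refine ⟨evalV V (e.env (o + p.atoms.length)) σ, this, ?_⟩
      rw [eval_rename, ← hval.eval_eq]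
      symm
      refine hV.eval_congr (Args.envOK _ _) fun j hj => ?_
      rw [Function.comp, Args.env_append_left _ _ _ (by simp; omega), Args.env_append_right]
  · rw [List.getElem?_append_right (by omega)] at hi
    obtain ⟨k, rfl⟩ : ∃ k, i = ws.length + (k + 1) := ⟨i - ws.length - 1, by omega⟩
    rw [Nat.add_sub_cancel_left, List.getElem?_cons_succ] at hi
    have e₁ : ws.length + (k + 1) - 1 + ys.length = (ws ++ ys).length + k := by simp; omega
    have hi' : (ws ++ ys ++ zs)[ws.length + (k + 1) - 1 + ys.length]? = some ρ := by
      rw [e₁, List.getElem?_append_right (by omega), Nat.add_sub_cancel_left, hi]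
    have h := Args.env_fst p o hi
    subst h
    refine ⟨.var _ _ _ hi', (p.env o k).2, ?_, eval_var ?_⟩
    · rw [Args.env_append_right, Args.env_cons, ncons_succ]
    · rw [e₁, Args.env_append_right]

/-- `idImp` is the right unit law of `Comp`; `lift`, `flat` and `betaOmega` combine `eval_fill` with
associativity or the evaluation of an abstraction; `etaImp` is extensionality; `idBox` holds since a
box denotation is determined by its atoms and body; `betaImp` and `betaBox` are substitution lemmas.
-/
theorem Rule.eval_eq {Γ : List (Ty P)} {M N : Tm P K} {τ : Ty P} (h : Rule Γ M N)
    (hM : HasType Γ M τ) (hcbv : IsCbvTerm M) {env : Env P K} (henv : EnvOK Γ env) :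
    eval M env τ = eval N env τ := by
  cases h with
  | idImp σ =>
    obtain ⟨σ', h, hN⟩ := hasType_app.1 hM
    obtain ⟨τ', he, h⟩ := hasType_lam.1 h
    obtain ⟨rfl, rfl⟩ := Ty.imp.inj he
    obtain rfl : σ' = τ := by simpa [hasType_var] using h
    rw [hN.eval_app henv, eval_lam, Comp.ret_bind]
    conv_rhs => rw [← Comp.bind_ret (eval N env σ')]
    congr 1
    funext d
    exact eval_var rfl
  | betaImp σ M V hV =>
    obtain ⟨σ', h, hN⟩ := hasType_app.1 hM
    obtain ⟨τ', he, h⟩ := hasType_lam.1 h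
    obtain ⟨rfl, rfl⟩ := Ty.imp.inj he
    rw [hN.eval_app henv, eval_lam, Comp.ret_bind, h.eval_inst hN hV henv, hV.eval_eq,
      Comp.ret_bind]
    rfl
  | etaImp σ V hV =>
    obtain ⟨τ', rfl, h⟩ := hasType_lam.1 hM
    obtain ⟨σ', h, hx⟩ := hasType_app.1 h
    obtain rfl : σ = σ' := by simpa [hasType_var] using hx
    rw [eval_lam, hV.eval_eq]
    congr 1
    funext d
    rw [hx.eval_app (henv.cons σ d), eval_weaken, hV.eval_eq, Comp.ret_bind, eval_var rfl,
      Comp.ret_bind]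
    rfl
  | lift C σ M N hC =>
    obtain ⟨ρ, h, -, hC'⟩ := hM.fill_weaken
    obtain ⟨σ', h', hN⟩ := hasType_app.1 h
    obtain ⟨τ', he, h'⟩ := hasType_lam.1 h'
    obtain ⟨rfl, rfl⟩ := Ty.imp.inj he
    rw [C.eval_fill hC hM h henv, hN.eval_app henv, hN.eval_app henv, eval_lam, eval_lam,
      Comp.ret_bind, Comp.ret_bind, Comp.bind_assoc]
    congr 1
    funext d
    refine Eq.trans ?_ (C.weaken.eval_fill hC.weaken (hC' _ _ h') h' (henv.cons _ d)).symm
    simp only [C.eval_weaken_fill]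
    rfl
  | flat C σ y M hy hC hne hσ =>
    rw [C.eval_fill hC hM hσ henv, hσ.eval_app henv, eval_lam, Comp.ret_bind]
    rfl
  | betaOmega E σ y M hy hE =>
    have hN := (Rule.betaOmega (Γ := Γ) E σ y M hy hE).hasType hM
    obtain ⟨σ', h, hM'⟩ := hasType_app.1 hM
    obtain ⟨τ', he, h⟩ := hasType_lam.1 h
    obtain ⟨rfl, rfl⟩ := Ty.imp.inj he
    obtain ⟨ρ, h', -⟩ := E.hasType_fill hN
    obtain ⟨σ₂, hy', h''⟩ := hasType_app.1 h'
    obtain rfl := hM'.unique h''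
    have hx : HasType (σ' :: Γ) (.var 0 : Tm P K) σ' := .var _ _ _ (by simp)
    rw [hM'.eval_app henv, eval_lam, Comp.ret_bind, E.eval_fill hE hN h' henv,
      hM'.eval_app henv, hy.isValue.eval_eq, Comp.ret_bind, Comp.bind_assoc]
    congr 1
    funext d
    refine (E.weaken.eval_fill hE.weaken h (.app _ _ _ _ _ (hy'.weaken σ') hx)
      (henv.cons _ d)).trans ?_
    rw [hx.eval_app (henv.cons _ d), eval_weaken, hy.isValue.eval_eq, Comp.ret_bind,
      eval_var rfl, Comp.ret_bind]
    simp only [E.eval_weaken_fill]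
  | idBox σ M =>
    obtain ⟨τ', rfl, h, hN⟩ := hasType_box.1 hM
    obtain rfl : τ' = σ := by simpa [hasType_var, eq_comm] using h
    rw [eval_box, evalList_cons, evalList_nil]
    simp only [Comp.ret_bind, Comp.bind_assoc]
    conv_rhs => rw [← Comp.bind_ret (eval N env (.box τ'))]
    congr 1
    funext d
    rw [Args.atoms_cons, Args.atoms_nil, List.append_nil]
    congr 1
    conv_rhs => rw [← D.box_eta d]
    congr 1
    funext o
    exact evalV_eq (eval_var rfl)
  | betaBox ws ys zs σ Ws Ns Ps V M hWs hV hlen =>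
    obtain ⟨τ', rfl, h, hN⟩ := hasType_box.1 hM
    obtain ⟨h₁, h₂⟩ := forall₂_append_eq hN hlen
    obtain ⟨h₂, h₃⟩ := List.forall₂_cons.1 h₂
    obtain ⟨σ', he, hV', h₂⟩ := hasType_box.1 h₂
    obtain rfl := Ty.box.inj he
    rw [eval_box, eval_box, evalList_append hlen, evalList_cons, eval_box,
      evalList_append (by simp [hlen, h₂.length_eq]), evalList_append hlen]
    simp only [Comp.ret_bind, Comp.bind_assoc]
    congr 1
    funext w
    congr 1
    funext e
    congr 1
    funext p
    congr 1
    simp only [Args.atoms_append, Args.atoms_cons, D.atoms_box, List.append_assoc]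
    congr 1
    funext o
    rw [evalV, evalV, h.eval_instBox hV' hV]

theorem Step.eval_eq {Γ : List (Ty P)} {M N : Tm P K} {τ : Ty P} (h : Step Γ M N)
    (hM : HasType Γ M τ) (hcbv : IsCbvTerm M) {env : Env P K} (henv : EnvOK Γ env) :
    eval M env τ = eval N env τ := by
  induction h generalizing τ env with
  | rule Γ M N h => exact h.eval_eq hM hcbv henv
  | lam Γ σ M M' h ih =>
    obtain ⟨τ', rfl, hM'⟩ := hasType_lam.1 hM
    rw [eval_lam, eval_lam]
    congr 1
    funext d
    exact ih hM' (isCbvTerm_lam.1 hcbv) (henv.cons σ d)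
  | appL Γ M M' N h ih =>
    obtain ⟨σ, hM', hN⟩ := hasType_app.1 hM
    rw [hN.eval_app henv, hN.eval_app henv, ih hM' (isCbvTerm_app.1 hcbv).1 henv]
  | appR Γ M N N' h ih =>
    obtain ⟨σ, hM', hN⟩ := hasType_app.1 hM
    rw [hN.eval_app henv, (h.hasType hN).eval_app henv, ih hN (isCbvTerm_app.1 hcbv).2 henv]
  | boxArg Γ σs Ls Rs N N' M h ih =>
    obtain ⟨τ', rfl, -, hN⟩ := hasType_box.1 hM
    obtain ⟨s₁, s₂, rfl, h₁, h₂⟩ := forall₂_append_left.1 hN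
    obtain ⟨ρ, s₂, hM', h₂, rfl⟩ := List.forall₂_cons_left_iff.1 h₂
    rw [eval_box, eval_box, evalList_append h₁.length_eq.symm, evalList_append h₁.length_eq.symm,
      evalList_cons, evalList_cons, ih hM' ((isCbvTerm_box.1 hcbv).1 N (by simp)) henv]
  | boxBody Γ σs Ns M M' h ih =>
    obtain ⟨τ', rfl, hM', -⟩ := hasType_box.1 hM
    rw [eval_box, eval_box]
    congr 1
    funext ds
    congr 2
    funext o
    rw [evalV, evalV, ih hM' (isCbvTerm_box.1 hcbv).2.1 (ds.envOK o)]

theorem Steps.eval_eq {Γ : List (Ty P)} {M N : Tm P K} {τ : Ty P} (h : Steps Γ M N)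
    (hM : HasType Γ M τ) (hcbv : IsCbvTerm M) {env : Env P K} (henv : EnvOK Γ env) :
    eval M env τ = eval N env τ := by
  induction h with
  | refl => rfl
  | tail h h' ih =>
    exact ih.trans (h'.eval_eq (Steps.hasType h hM) (Steps.isCbvTerm h hcbv) henv)

end eval

-- The logical relation

/-- The atom `a` has type `σ` in the context `Γ`. -/
def At.OK (Γ : List (Ty P)) (σ : Ty P) : At P K → Prop
  | .con _ τ => τ = σ
  | .lvl l => l < Γ.length ∧ Γ[Γ.length - 1 - l]? = some σ

theorem At.isAtom_toTm (a : At P K) (n : ℕ) : IsAtom (a.toTm n) := by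
  cases a
  · exact .con _ _
  · exact .var _

theorem At.OK.hasType {Γ : List (Ty P)} {σ : Ty P} {a : At P K} (h : a.OK Γ σ) :
    HasType Γ (a.toTm Γ.length) σ := by
  cases a with
  | con c τ => obtain rfl : τ = σ := h; exact .con _ _ _
  | lvl l => exact .var _ _ _ h.2

theorem At.OK.toTm_append {Γ : List (Ty P)} {σ : Ty P} {a : At P K} (h : a.OK Γ σ)
    (Δ : List (Ty P)) :
    a.toTm (Δ ++ Γ).length = (a.toTm Γ.length).rename (· + Δ.length) := by
  cases a with
  | con c τ => simp [At.toTm]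
  | lvl l =>
    have := h.1
    simp only [At.toTm, rename_var, List.length_append]
    congr 1
    omega

theorem getElem?_append_add {α : Type*} (Δ Γ : List α) (i : ℕ) :
    (Δ ++ Γ)[i + Δ.length]? = Γ[i]? := by
  rw [List.getElem?_append_right (by omega), Nat.add_sub_cancel]

theorem At.OK.append {Γ : List (Ty P)} {σ : Ty P} {a : At P K} (h : a.OK Γ σ)
    (Δ : List (Ty P)) : a.OK (Δ ++ Γ) σ := by
  cases a with
  | con c τ => exact h
  | lvl l =>
    obtain ⟨h₁, h₂⟩ := h
    refine ⟨by simp; omega, ?_⟩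
    have : (Δ ++ Γ).length - 1 - l = Γ.length - 1 - l + Δ.length := by
      rw [List.length_append]
      omega
    rw [this, getElem?_append_add, h₂]

theorem HasType.append {Γ : List (Ty P)} {M : Tm P K} {τ : Ty P} (h : HasType Γ M τ)
    (Δ : List (Ty P)) : HasType (Δ ++ Γ) (M.rename (· + Δ.length)) τ :=
  h.rename fun i σ hi => by rw [getElem?_append_add, hi]

theorem Steps.append {Γ : List (Ty P)} {M N : Tm P K} (h : Steps Γ M N) (Δ : List (Ty P)) :
    Steps (Δ ++ Γ) (M.rename (· + Δ.length)) (N.rename (· + Δ.length)) :=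
  h.rename fun i σ hi => by rw [getElem?_append_add, hi]

/-- Evaluation of terms to computations, relative to an evaluation `R` to results. -/
def RC {X : Type (max u v)} (R : List (Ty P) → Tm P K → X → Prop) :
    Tree P K X → List (Ty P) → Tm P K → Prop
  | .ret d, Γ, M => ∃ V, Steps Γ M V ∧ R Γ V d
  | .call a W τ t, Γ, M => HasType Γ (.app (a.toTm Γ.length) W) τ ∧
      -- The call is bound by an abstraction, is the argument of an atom `y`, or is the whole term.
      -- In the second case `flat` does not name the call, so the rest of the computation is
      -- attached to `E[y x]`.
      ((∃ L, Steps Γ M (.app (.lam τ L) (.app (a.toTm Γ.length) W)) ∧ RC R t (τ :: Γ) L) ∨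
        (∃ E y, ECtx.IsEval E ∧ IsAtom y ∧
          Steps Γ M (E.fill (.app y (.app (a.toTm Γ.length) W))) ∧
          RC R t (τ :: Γ) (E.weaken.fill (.app y.weaken (.var 0)))) ∨
        (Steps Γ M (.app (a.toTm Γ.length) W) ∧ ∃ d, t = .ret d ∧ R (τ :: Γ) (.var 0) d))

/-- Every clause only asks what the term reduces to. Closure under reduction would require
confluence, so all constructions below are arranged to need expansion only. -/
theorem RC.expand {X : Type (max u v)} {R : List (Ty P) → Tm P K → X → Prop} {t : Tree P K X}
    {Γ : List (Ty P)} {M N : Tm P K} (h : Steps Γ M N) (hN : RC R t Γ N) : RC R t Γ M := by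
  cases t with
  | ret d =>
    obtain ⟨V, hV, hR⟩ := hN
    exact ⟨V, h.trans hV, hR⟩
  | call a W τ t =>
    refine ⟨hN.1, ?_⟩
    rcases hN.2 with ⟨L, hL, hR⟩ | ⟨E, y, hE, hy, hL, hR⟩ | ⟨hL, hR⟩
    · exact .inl ⟨L, h.trans hL, hR⟩
    · exact .inr (.inl ⟨E, y, hE, hy, h.trans hL, hR⟩)
    · exact .inr (.inr ⟨h.trans hL, hR⟩)

/-- Each of the three shapes of a call reduces to the same `slet`: by reducing under the binder, by
`Steps.slet_of_linear`, or because the body is the variable itself. -/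
theorem RC.steps {X : Type (max u v)} {R : List (Ty P) → Tm P K → X → Prop}
    {r : X → ℕ → Tm P K} (hr : ∀ Γ V d, R Γ V d → Steps Γ V (r d Γ.length)) {t : Tree P K X}
    {Γ : List (Ty P)} {M : Tm P K} (h : RC R t Γ M) : Steps Γ M (t.toTm r Γ.length) := by
  induction t generalizing Γ M with
  | ret d =>
    obtain ⟨V, hV, hR⟩ := h
    exact hV.trans (hr _ _ _ hR)
  | call a W τ t ih =>
    obtain ⟨hA, h⟩ := h
    rcases h with ⟨L, hL, hR⟩ | ⟨E, y, hE, hy, hL, hR⟩ | ⟨hL, d, rfl, hR⟩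
    · exact hL.trans (((ih hR).lam.appL _).trans (steps_slet _ _ _ _))
    · exact hL.trans ((ih hR).slet_of_linear hE hy hA)
    · have := (hr _ _ _ hR).atom_eq (.var 0)
      refine hL.trans ?_
      simp only [Tree.toTm]
      rw [List.length_cons] at this
      rw [this, slet_var]

/-- `V` reduces to a box with types `σs`, arguments `As` and body `B`, up to the identity rule. -/
def BoxRed (Γ : List (Ty P)) (V : Tm P K) (σs : List (Ty P)) (As : List (Tm P K)) (B : Tm P K) :
    Prop :=
  Steps Γ V (.box σs As B) ∨ ∃ σ A, σs = [σ] ∧ As = [A] ∧ B = .var 0 ∧ Steps Γ V A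

/-- Evaluation of values to denotations. -/
def RV : (σ : Ty P) → List (Ty P) → Tm P K → D P K σ → Prop
  | .base p, Γ, V, a => IsValue V ∧ HasType Γ V (.base p) ∧ At.OK Γ (.base p) a ∧
      Steps Γ V (At.toTm Γ.length a)
  | .imp σ τ, Γ, V, f => IsValue V ∧ HasType Γ V (.imp σ τ) ∧
      ((∃ y, IsAtom y ∧ Steps Γ V y ∧ ∀ Δ W d, RV σ (Δ ++ Γ) W d →
          RC (RV τ) (D.app f d (Δ ++ Γ).length) (Δ ++ Γ) (.app (y.rename (· + Δ.length)) W)) ∨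
        ∃ L, Steps Γ V (.lam σ L) ∧ ∀ Δ W d, RV σ (Δ ++ Γ) W d →
          RC (RV τ) (D.app f d (Δ ++ Γ).length) (Δ ++ Γ)
            ((L.rename (upRen (· + Δ.length))).inst W))
  | .box σ, Γ, V, d => IsValue V ∧ HasType Γ V (.box σ) ∧
      (∀ p ∈ D.atoms d, At.OK Γ (.box p.2) p.1) ∧
      ∃ B, IsValue B ∧ HasType ((D.atoms d).map Prod.snd) B σ ∧
        BoxRed Γ V ((D.atoms d).map Prod.snd) ((D.atoms d).map fun p => p.1.toTm Γ.length) B ∧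
        -- When this box is merged into a larger one, `zs` types the variables that are bound after
        -- its own.
        ∀ zs, RV σ ((D.atoms d).map Prod.snd ++ zs) B (D.body d zs.length)

theorem RV.isValue {σ : Ty P} {Γ : List (Ty P)} {V : Tm P K} {d : D P K σ} (h : RV σ Γ V d) :
    IsValue V := by
  cases σ <;> exact h.1

theorem RV.hasType {σ : Ty P} {Γ : List (Ty P)} {V : Tm P K} {d : D P K σ} (h : RV σ Γ V d) :
    HasType Γ V σ := by
  cases σ <;> exact h.2.1

theorem RV.expand {σ : Ty P} {Γ : List (Ty P)} {V W : Tm P K} {d : D P K σ} (hV : IsValue V)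
    (hVσ : HasType Γ V σ) (h : Steps Γ V W) (hW : RV σ Γ W d) : RV σ Γ V d := by
  cases σ with
  | base p => exact ⟨hV, hVσ, hW.2.2.1, h.trans hW.2.2.2⟩
  | imp σ τ =>
    refine ⟨hV, hVσ, ?_⟩
    rcases hW.2.2 with ⟨y, hy, hWy, hR⟩ | ⟨L, hL, hR⟩
    · exact .inl ⟨y, hy, h.trans hWy, hR⟩
    · exact .inr ⟨L, h.trans hL, hR⟩
  | box σ =>
    obtain ⟨-, -, hOK, B, hB, hBσ, hred, hR⟩ := hW
    refine ⟨hV, hVσ, hOK, B, hB, hBσ, ?_, hR⟩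
    rcases hred with hred | ⟨τ, A, h₁, h₂, h₃, hred⟩
    · exact .inl (h.trans hred)
    · exact .inr ⟨τ, A, h₁, h₂, h₃, h.trans hred⟩

theorem comp_add (m n : ℕ) : ((· + m) ∘ (· + n) : ℕ → ℕ) = (· + (m + n)) := by
  funext i
  simp only [Function.comp]
  omega

/-- Levels are stable under extension of the context, so only the term is renamed and `d` stays the
same. -/
theorem RV.append {σ : Ty P} {Γ : List (Ty P)} {V : Tm P K} {d : D P K σ} (h : RV σ Γ V d)
    (Δ : List (Ty P)) : RV σ (Δ ++ Γ) (V.rename (· + Δ.length)) d := by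
  cases σ with
  | base p =>
    obtain ⟨hV, hVσ, hOK, hs⟩ := h
    refine ⟨hV.rename _, hVσ.append Δ, hOK.append Δ, ?_⟩
    rw [hOK.toTm_append]
    exact hs.append Δ
  | imp σ τ =>
    obtain ⟨hV, hVσ, h⟩ := h
    refine ⟨hV.rename _, hVσ.append Δ, ?_⟩
    rcases h with ⟨y, hy, hVy, hR⟩ | ⟨L, hL, hR⟩
    · refine .inl ⟨_, hy.rename _, hVy.append Δ, fun Δ' W d hW => ?_⟩
      rw [← List.append_assoc] at hW ⊢
      have := hR (Δ' ++ Δ) W d hW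
      rwa [rename_rename, comp_add, ← List.length_append]
    · refine .inr ⟨L.rename (upRen (· + Δ.length)), ?_, fun Δ' W d hW => ?_⟩
      · have := hL.append Δ
        rwa [rename_lam] at this
      · rw [← List.append_assoc] at hW ⊢
        have := hR (Δ' ++ Δ) W d hW
        rwa [rename_rename, ← upRen_comp, comp_add, ← List.length_append]
  | box σ =>
    obtain ⟨hV, hVσ, hOK, B, hB, hBσ, hred, hR⟩ := h
    refine ⟨hV.rename _, hVσ.append Δ, fun p hp => (hOK p hp).append Δ, B, hB, hBσ, ?_, hR⟩
    have e : (d.atoms.map fun p => p.1.toTm (Δ ++ Γ).length) =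
        (d.atoms.map fun p => p.1.toTm Γ.length).map (Tm.rename (· + Δ.length)) := by
      rw [List.map_map]
      exact List.map_congr_left fun p hp => (hOK p hp).toTm_append Δ
    rw [e]
    rcases hred with hred | ⟨τ, A, h₁, h₂, h₃, hred⟩
    · have := hred.append Δ
      rw [rename_box] at this
      exact .inl this
    · exact .inr ⟨τ, _, h₁, by rw [h₂]; rfl, h₃, hred.append Δ⟩

theorem rename_add_zero (M : Tm P K) : M.rename (· + 0) = M := rename_id M

theorem Frame.rename_add_zero (C : Frame P K) : C.rename (· + 0) = C := C.rename_id

/-- Both halves are proved together by induction on the type: reflection at `σ ⊃ τ` reads back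
arguments of type `σ`, and reification applies the function to a reflected variable. -/
theorem RV.reflect_reify (σ : Ty P) :
    (∀ (Γ : List (Ty P)) (a : At P K), a.OK Γ σ → RV σ Γ (a.toTm Γ.length) (reflect σ a)) ∧
      ∀ (Γ : List (Ty P)) (V : Tm P K) (d : D P K σ), RV σ Γ V d →
        Steps Γ V (reify σ d Γ.length) := by
  induction σ with
  | base p =>
    exact ⟨fun Γ a h => ⟨(a.isAtom_toTm _).isValue, h.hasType, h, .refl⟩, fun Γ V d h => h.2.2.2⟩
  | imp σ τ ihσ ihτ =>
    have last (Γ : List (Ty P)) (σ : Ty P) : (At.lvl Γ.length : At P K).OK (σ :: Γ) σ :=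
      ⟨by simp, by simp⟩
    have last_toTm (Γ : List (Ty P)) (σ : Ty P) :
        (At.lvl Γ.length : At P K).toTm (σ :: Γ).length = .var 0 := by simp [At.toTm]
    constructor
    · intro Γ a h
      refine ⟨(a.isAtom_toTm _).isValue, h.hasType,
        .inl ⟨_, a.isAtom_toTm _, .refl, fun Δ W d hW => ?_⟩⟩
      rw [reflect_imp, ← h.toTm_append]
      have hs := ihσ.2 _ _ _ hW
      refine ⟨.app _ _ _ _ _ (h.append Δ).hasType (hs.hasType hW.hasType), .inr (.inr ⟨hs.appR _,
        _, rfl, ?_⟩)⟩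
      have := ihτ.1 _ _ (last (Δ ++ Γ) τ)
      rwa [last_toTm] at this
    · intro Γ V f h
      rw [reify_imp]
      have hx := ihσ.1 _ _ (last Γ σ)
      rw [last_toTm] at hx
      rcases h.2.2 with ⟨y, hy, hVy, hR⟩ | ⟨L, hL, hR⟩
      · have := RC.steps (r := reify τ) ihτ.2 (hR [σ] _ _ hx)
        -- `y x` has no reducts, so the read-back body is `y x` itself, and `etaLam` returns `y`.
        have := this.app_atom_eq (hy.rename _) (.var 0)
        refine hVy.trans ?_
        simp only [List.length_append, List.length_singleton, Nat.add_comm 1] at this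
        rw [this]
        have := etaLam_app (σ := σ) hy.isValue
        rw [Tm.weaken] at this
        rw [this]
      · have := RC.steps (r := reify τ) ihτ.2 (hR [σ] _ _ hx)
        refine hL.trans (Relation.ReflTransGen.trans ?_ (steps_etaLam _ _ _))
        refine Steps.lam ?_
        simp only [List.length_append, List.length_singleton, Nat.add_comm 1] at this
        have e := rename_upRen_succ_inst L
        rwa [show L.rename (upRen (· + 1)) = L.rename (upRen Nat.succ) from rfl, e] at this
  | box σ ih =>
    constructor
    · intro Γ a h
      refine ⟨(a.isAtom_toTm _).isValue, h.hasType, ?_, .var 0, .var 0, ?_, ?_, fun zs => ?_⟩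
      · simpa [reflect_box] using h
      · exact .var _ _ _ (by simp [reflect_box])
      · exact .inr ⟨σ, _, rfl, rfl, rfl, .refl⟩
      · have : RV σ (σ :: zs) (.var 0 : Tm P K) (LambdaBox.reflect σ (.lvl zs.length)) := by
          simpa [At.toTm] using ih.1 (σ :: zs) (.lvl zs.length) ⟨by simp, by simp⟩
        exact this
    · intro Γ V d h
      obtain ⟨-, -, hOK, B, hB, hBσ, hred, hR⟩ := h
      rw [reify_box]
      have hs := ih.2 _ _ _ (hR [])
      simp only [List.append_nil, List.length_map, List.length_nil] at hs
      rcases hred with hred | ⟨τ, A, h₁, h₂, rfl, hred⟩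
      · exact hred.trans (hs.boxBody.trans (steps_idBox _ _ _ _))
      -- The body is a variable, hence its own read-back, and `idBox` returns `A`.
      · rw [hs.atom_eq (.var 0), h₁, h₂, idBox_var]
        exact hred

theorem RV.reflect {σ : Ty P} {Γ : List (Ty P)} {a : At P K} (h : a.OK Γ σ) :
    RV σ Γ (a.toTm Γ.length) (reflect σ a) := (RV.reflect_reify σ).1 Γ a h

theorem RV.steps_reify {σ : Ty P} {Γ : List (Ty P)} {V : Tm P K} {d : D P K σ}
    (h : RV σ Γ V d) : Steps Γ V (reify σ d Γ.length) := (RV.reflect_reify σ).2 Γ V d h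

-- Sequencing in the logical relation

/-- The term that `C[V]` becomes when an abstraction in `C` is applied to `V`. -/
def Frame.contract : Frame P K → Tm P K → Tm P K
  | .appR (.lam _ L), V => L.inst V
  | C, V => C.fill V

/-- `C` is a simple evaluation context in which a function is an atom or an abstraction. -/
def Frame.Ready : Frame P K → Prop
  | .appR V => IsAtom V ∨ ∃ σ L, V = .lam σ L
  | C => C.IsSimple

theorem Frame.Ready.isSimple {C : Frame P K} (h : C.Ready) : C.IsSimple := by
  cases C with
  | appR V =>
    rcases h with h | ⟨σ, L, rfl⟩
    · exact h.isValue
    · exact .lam _ _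
  | _ => exact h

theorem Frame.Ready.rename {C : Frame P K} (h : C.Ready) (f : ℕ → ℕ) : (C.rename f).Ready := by
  cases C with
  | appR V =>
    rcases h with h | ⟨σ, L, rfl⟩
    · exact .inl (h.rename f)
    · exact .inr ⟨_, _, rename_lam f σ L⟩
  | appL => trivial
  | box σs Vs Ms L => exact Frame.IsSimple.rename (C := .box σs Vs Ms L) h f

theorem Frame.steps_contract (Γ : List (Ty P)) (C : Frame P K) {V : Tm P K} (hV : IsValue V) :
    Steps Γ (C.fill V) (C.contract V) := by
  cases C with
  | appR W =>
    cases W with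
    | lam σ L => exact (Rule.betaImp _ _ _ hV).steps
    | _ => exact .refl
  | _ => exact .refl

theorem Frame.contract_atom {y V : Tm P K} (hy : IsAtom y) :
    (Frame.appR y).contract V = .app y V := by
  cases hy <;> rfl

/-- The continuation `κ` describes the evaluation of `C`. -/
def RK (σ τ : Ty P) (κ : D P K σ → Comp P K (D P K τ)) (Γ : List (Ty P)) (C : Frame P K) : Prop :=
  ∀ Δ V d, RV σ (Δ ++ Γ) V d →
    RC (RV τ) (κ d (Δ ++ Γ).length) (Δ ++ Γ) ((C.rename (· + Δ.length)).contract V)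

theorem RK.append {σ τ : Ty P} {κ : D P K σ → Comp P K (D P K τ)} {Γ : List (Ty P)}
    {C : Frame P K} (h : RK σ τ κ Γ C) (Δ : List (Ty P)) :
    RK σ τ κ (Δ ++ Γ) (C.rename (· + Δ.length)) := by
  intro Δ' V d hV
  rw [← List.append_assoc] at hV ⊢
  have := h (Δ' ++ Δ) V d hV
  rwa [Frame.rename_rename, comp_add, ← List.length_append]

theorem RK.weaken {σ τ : Ty P} {κ : D P K σ → Comp P K (D P K τ)} {Γ : List (Ty P)}
    {C : Frame P K} (h : RK σ τ κ Γ C) (ρ : Ty P) : RK σ τ κ (ρ :: Γ) C.weaken := by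
  rw [C.weaken_eq]
  exact h.append [ρ]

/-- Induction on the calls of `t`. A bound call leaves `C` by `lift`. A call that is the argument of
an atom keeps this shape, with `C` added to its context. A bare call is named by `flat`, unless `C`
is `V -`; then `V` is an atom, giving the second shape, or an abstraction, giving the first. -/
theorem RC.bind {σ τ : Ty P} {κ : D P K σ → Comp P K (D P K τ)} {t : Tree P K (D P K σ)}
    {Γ : List (Ty P)} {C : Frame P K} {M : Tm P K} (hC : C.Ready) (hMσ : HasType Γ M σ)
    (hMτ : HasType Γ (C.fill M) τ) (hκ : RK σ τ κ Γ C) (h : RC (RV σ) t Γ M) :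
    RC (RV τ) (t.bind Γ.length κ) Γ (C.fill M) := by
  induction t generalizing Γ C M with
  | ret d =>
    obtain ⟨V, hV, hR⟩ := h
    refine RC.expand ((hV.fill C).trans (C.steps_contract Γ hR.isValue)) ?_
    have := hκ [] V d hR
    simp only [List.length_nil, C.rename_add_zero, List.nil_append] at this
    exact this
  | call a W ρ t ih =>
    obtain ⟨hA, h⟩ := h
    obtain ⟨σ', h₁, hfill, hfillw⟩ := hMτ.fill_weaken
    obtain rfl := hMσ.unique h₁
    have hCw : C.weaken.Ready := C.weaken_eq ▸ hC.rename _
    have hs := hC.isSimple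
    rcases h with ⟨L, hL, hR⟩ | ⟨E, y, hE, hy, hL, hR⟩ | ⟨hL, d, rfl, hR⟩
    · refine ⟨hA, .inl ⟨C.weaken.fill L, (hL.fill C).trans (Rule.lift C _ _ _ hs).steps, ?_⟩⟩
      obtain ⟨ρ', h₂, -⟩ := hasType_app.1 (hL.hasType hMσ)
      obtain ⟨σ', he, h₂⟩ := hasType_lam.1 h₂
      obtain ⟨rfl, rfl⟩ := Ty.imp.inj he
      exact ih hCw h₂ (hfillw _ _ h₂) (hκ.weaken _) hR
    · refine ⟨hA, .inr (.inl ⟨.comp C E, y, ⟨hs, hE⟩, hy, hL.fill C, ?_⟩)⟩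
      obtain ⟨ρ', h₂, h₃⟩ := E.hasType_fill (hL.hasType hMσ)
      obtain ⟨ρ'', hyt, hA'⟩ := hasType_app.1 h₂
      obtain rfl := hA.unique hA'
      have h₄ := h₃ (ρ :: Γ) Nat.succ (.app y.weaken (.var 0)) (fun i τ h => by simpa using h)
        (.app _ _ _ _ _ (hyt.weaken ρ) (.var _ _ _ (by simp)))
      rw [← E.weaken_eq] at h₄
      exact ih hCw h₄ (hfillw _ _ h₄) (hκ.weaken _) hR
    · obtain rfl := hA.unique (hL.hasType hMσ)
      have hR' := hκ.weaken ρ [] _ d hR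
      simp only [List.length_nil, Frame.rename_add_zero, List.nil_append] at hR'
      refine ⟨hA, ?_⟩
      have hflat (hne : ∀ V : Tm P K, C ≠ .appR V)
          (hR' : RC (RV τ) (κ d (ρ :: Γ).length) (ρ :: Γ) (C.weaken.fill (.var 0))) :=
        (⟨_, (hL.fill C).trans (Rule.flat C _ _ _ (a.isAtom_toTm _) hs hne hA).steps, hR'⟩ :
          ∃ L, Steps Γ (C.fill M) (.app (.lam ρ L) (.app (a.toTm Γ.length) W)) ∧
            RC (RV τ) (κ d (ρ :: Γ).length) (ρ :: Γ) L)
      cases C with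
      | appL L => exact .inl (hflat nofun hR')
      | box σs Vs Ms L => exact .inl (hflat nofun hR')
      | appR V =>
        rcases hC with hV | ⟨ρ', L, rfl⟩
        · refine .inr (.inl ⟨.hole, V, trivial, hV, hL.fill (.appR V), ?_⟩)
          rwa [Frame.weaken, Frame.contract_atom (y := V.weaken) (hV.rename _)] at hR'
        · obtain ⟨ρ'', h₂, h₃⟩ := hasType_app.1 hMτ
          obtain ⟨σ', he, h₂⟩ := hasType_lam.1 h₂
          obtain ⟨rfl, rfl⟩ := Ty.imp.inj he
          obtain rfl := hMσ.unique h₃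
          -- `(λx. L) (a W)` already has the first shape, so `L` itself must be related. This is why
          -- `RK` uses `Frame.contract`: `(λx. L) x` would only be known to reduce to `L`.
          refine .inl ⟨L, hL.fill _, ?_⟩
          simp only [Frame.weaken, Tm.weaken, rename_lam, Frame.contract,
            rename_upRen_succ_inst] at hR'
          exact hR'

-- Boxes in the logical relation

/-- Evaluation of the arguments of a box to denotations. -/
inductive RArgs (Γ : List (Ty P)) : {σs : List (Ty P)} → List (Tm P K) → Args P K σs → Prop
  | nil : RArgs Γ [] Args.nil
  | cons {σ : Ty P} {σs : List (Ty P)} {V : Tm P K} {Vs : List (Tm P K)} {d : D P K (.box σ)}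
      {ds : Args P K σs} (h : RV (.box σ) Γ V d) (hs : RArgs Γ Vs ds) :
      RArgs Γ (V :: Vs) (Args.cons d ds)

theorem RArgs.isValue {Γ σs : List (Ty P)} {Vs : List (Tm P K)} {ds : Args P K σs}
    (h : RArgs Γ Vs ds) : ∀ V ∈ Vs, IsValue V := by
  induction h with
  | nil => simp
  | cons h _ ih => simpa using ⟨h.isValue, ih⟩

theorem RArgs.hasType {Γ σs : List (Ty P)} {Vs : List (Tm P K)} {ds : Args P K σs}
    (h : RArgs Γ Vs ds) : List.Forall₂ (fun V σ => HasType Γ V (.box σ)) Vs σs := by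
  induction h with
  | nil => exact .nil
  | cons h _ ih => exact .cons h.hasType ih

theorem RArgs.ok {Γ σs : List (Ty P)} {Vs : List (Tm P K)} {ds : Args P K σs}
    (h : RArgs Γ Vs ds) : ∀ p ∈ ds.atoms, At.OK Γ (.box p.2) p.1 := by
  induction h with
  | nil => simp
  | cons h _ ih =>
    intro p hp
    rw [Args.atoms_cons, List.mem_append] at hp
    exact hp.elim (h.2.2.1 p) (ih p)

/-- The terms of the substitution `s` evaluate to the denotations in `env`. -/
def REnv (Γ Δ : List (Ty P)) (s : ℕ → Tm P K) (env : Env P K) : Prop :=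
  ∀ i σ, Γ[i]? = some σ → ∃ d, env i = ⟨σ, d⟩ ∧ RV σ Δ (s i) d

theorem REnv.envOK {Γ Δ : List (Ty P)} {s : ℕ → Tm P K} {env : Env P K} (h : REnv Γ Δ s env) :
    EnvOK Γ env := fun i σ hi => by
  obtain ⟨d, hd, -⟩ := h i σ hi
  rw [hd]

theorem REnv.hasType {Γ Δ : List (Ty P)} {s : ℕ → Tm P K} {env : Env P K} (h : REnv Γ Δ s env)
    (i : ℕ) (σ : Ty P) (hi : Γ[i]? = some σ) : HasType Δ (s i) σ := by
  obtain ⟨d, -, hd⟩ := h i σ hi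
  exact hd.hasType

theorem REnv.append {Γ Δ : List (Ty P)} {s : ℕ → Tm P K} {env : Env P K} (h : REnv Γ Δ s env)
    (Δ' : List (Ty P)) : REnv Γ (Δ' ++ Δ) (fun i => (s i).rename (· + Δ'.length)) env :=
  fun i σ hi => by
    obtain ⟨d, hd, hR⟩ := h i σ hi
    exact ⟨d, hd, hR.append Δ'⟩

theorem REnv.cons {Γ Δ : List (Ty P)} {s : ℕ → Tm P K} {env : Env P K} (h : REnv Γ Δ s env)
    {σ : Ty P} {V : Tm P K} {d : D P K σ} (hV : RV σ Δ V d) :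
    REnv (σ :: Γ) Δ (scons V s) (ncons ⟨σ, d⟩ env) := by
  intro i τ hi
  cases i with
  | zero =>
    obtain rfl : σ = τ := by simpa using hi
    exact ⟨d, rfl, hV⟩
  | succ i => exact h i τ (by simpa using hi)

/-- The substitution `t` for the variables from `a` on, whose terms live below `a` variables. -/
def substFrom (a : ℕ) (t : ℕ → Tm P K) (i : ℕ) : Tm P K :=
  if i < a then .var i else (t (i - a)).rename (· + a)

theorem substFrom_zero (t : ℕ → Tm P K) : substFrom 0 t = t := by
  funext i
  simp only [substFrom, Nat.not_lt_zero, if_false, Nat.sub_zero]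
  exact rename_add_zero _

theorem instBox_subst_substFrom {a b : ℕ} {M B : Tm P K} (hB : Scoped (fun i => i < b) B)
    (t : ℕ → Tm P K) : (M.instBox a b B).subst (substFrom (a + b) t) =
      M.subst (substFrom a (ncons B fun i => (t i).rename (· + b))) := by
  rw [Tm.instBox, subst_subst]
  congr 1
  funext i
  split_ifs with h₁ h₂
  · simp only [subst_var, substFrom, h₁, if_true]
    rw [if_pos (by omega)]
  · subst h₂
    rw [subst_rename]
    simp only [substFrom, lt_irrefl, if_false, Nat.sub_self, ncons_zero]
    rw [rename_eq_subst]
    refine hB.subst_congr fun j hj => ?_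
    rw [Function.comp, substFrom, if_pos (by omega), Nat.add_comm]
  · obtain ⟨k, rfl⟩ : ∃ k, i = a + (k + 1) := ⟨i - a - 1, by omega⟩
    simp only [subst_var, substFrom, h₁, if_false]
    rw [if_neg (by omega), show a + (k + 1) - 1 + b - (a + b) = k by omega, Nat.add_sub_cancel_left,
      ncons_succ, rename_rename, comp_add]

theorem instBox_var (a : ℕ) (M : Tm P K) : M.instBox a 1 (.var 0) = M := by
  conv_rhs => rw [← subst_var_eq M]
  rw [Tm.instBox]
  congr 1
  funext i
  split_ifs with h₁ h₂
  · rfl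
  · simp [h₂]
  · congr 1
    omega

section

variable [Inhabited (Ty P)]

/-- The arguments are flattened from left to right: each reduces to a box over atoms, which
`betaBox` merges because the prefix `As` consists of values. The substitution `t` collects the
bodies. -/
theorem RArgs.exists_subst {Γ σs : List (Ty P)} {Vs : List (Tm P K)} {ds : Args P K σs}
    (h : RArgs Γ Vs ds) : ∃ t : ℕ → Tm P K, (∀ i, IsValue (t i)) ∧
      (∀ zs, REnv σs (ds.atoms.map Prod.snd ++ zs) t (ds.env zs.length)) ∧
      ∀ (ws : List (Ty P)) (As : List (Tm P K)) (M : Tm P K), (∀ A ∈ As, IsValue A) →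
        ws.length = As.length → Steps Γ (.box (ws ++ σs) (As ++ Vs) M)
          (.box (ws ++ ds.atoms.map Prod.snd) (As ++ ds.atoms.map fun p => p.1.toTm Γ.length)
            (M.subst (substFrom ws.length t))) := by
  induction h with
  | nil =>
    refine ⟨.var, .var, fun zs i σ hi => by simp at hi, fun ws As M hAs hl => ?_⟩
    have : substFrom ws.length Tm.var = (Tm.var : ℕ → Tm P K) := by
      funext i
      rw [substFrom, rename_var]
      split_ifs with h
      · rfl
      · rw [Nat.sub_add_cancel (by omega)]
    rw [this, subst_var_eq]
    exact .refl
  | @cons σ σs V Vs d ds hV hVs ih =>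
    obtain ⟨t, htv, htR, htS⟩ := ih
    obtain ⟨hVv, hVt, hOK, B, hB, hBσ, hred, hR⟩ := hV
    refine ⟨ncons B fun i => (t i).rename (· + d.atoms.length), fun i => ?_,
      fun zs i ρ hi => ?_, fun ws As M hAs hl => ?_⟩
    · cases i with
      | zero => exact hB
      | succ i => exact (htv i).rename _
    · rw [Args.atoms_cons, List.map_append, List.append_assoc, Args.env_cons]
      cases i with
      | zero =>
        obtain rfl : σ = ρ := by simpa using hi
        have := hR (ds.atoms.map Prod.snd ++ zs)
        rw [List.length_append, List.length_map, Nat.add_comm] at this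
        exact ⟨_, rfl, this⟩
      | succ i =>
        have := (htR zs).append (d.atoms.map Prod.snd) i ρ (by simpa using hi)
        simpa using this
    · rw [Args.atoms_cons, List.map_append, List.map_append]
      have hscope := hBσ.scoped
      rw [List.length_map] at hscope
      have key := htS (ws ++ d.atoms.map Prod.snd)
        (As ++ d.atoms.map fun p => p.1.toTm Γ.length) (M.instBox ws.length d.atoms.length B)
        (fun A hA => by
          rcases List.mem_append.1 hA with hA | hA
          · exact hAs A hA
          · obtain ⟨p, -, rfl⟩ := List.mem_map.1 hA
            exact (p.1.isAtom_toTm _).isValue) (by simp [hl])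
      rw [List.length_append, List.length_map, instBox_subst_substFrom hscope] at key
      simp only [List.append_assoc] at key
      refine Relation.ReflTransGen.trans ?_ key
      rcases hred with hred | ⟨ρ, A, h₁, h₂, rfl, hred⟩
      · have := hred.fill (.box (ws ++ σ :: σs) As Vs M)
        refine this.trans ?_
        have := Rule.betaBox (Γ := Γ) ws (d.atoms.map Prod.snd) σs σ As
          (d.atoms.map fun p => p.1.toTm Γ.length) Vs B M hAs hB hl
        rw [List.length_map, List.append_assoc, List.append_assoc] at this
        exact this.steps
      -- The argument reduces to an atom without passing through a box. It stays in place, and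
      -- substituting its variable for itself changes nothing.
      · have hl' : d.atoms.length = 1 := by simpa using congrArg List.length h₁
        obtain rfl : σ = ρ := by
          rw [h₁] at hBσ
          simpa [hasType_var, eq_comm] using hBσ
        rw [hl', instBox_var, h₁, h₂]
        exact hred.fill (.box (ws ++ σ :: σs) As Vs M)

theorem RArgs.box {Γ σs : List (Ty P)} {Vs : List (Tm P K)} {ds : Args P K σs}
    (h : RArgs Γ Vs ds) {M : Tm P K} {τ : Ty P} (hM : HasType σs M τ) (hval : IsValue M)
    (hR : ∀ (Δ : List (Ty P)) (s : ℕ → Tm P K) (env : Env P K), REnv σs Δ s env →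
      RC (RV τ) (eval M env τ Δ.length) Δ (M.subst s)) :
    RV (.box τ) Γ (.box σs Vs M) (.box ds.atoms fun o => evalV M (ds.env o) τ) := by
  obtain ⟨t, htv, htR, htS⟩ := h.exists_subst
  refine ⟨.box _ _ _ h.isValue, hasType_box.2 ⟨τ, rfl, hM, h.hasType⟩, h.ok, M.subst t,
    hval.subst htv, ?_, .inl ?_, fun zs => ?_⟩
  · refine hM.subst fun i σ hi => ?_
    have := (htR []).hasType i σ hi
    simpa using this
  · have := htS [] [] M (by simp) rfl
    simpa [substFrom_zero] using this
  · have := hR _ _ _ (htR zs)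
    -- The body is a value, so the relation is at a returned denotation and yields a related reduct,
    -- from which `RV.expand` goes back.
    rw [hval.eval_eq] at this
    obtain ⟨V, hV, hR⟩ := this
    exact hR.expand (hval.subst htv) (hM.subst (htR zs).hasType) hV

/-- `RC.bind` is applied to the arguments in turn. The continuation `κ` is related in all
extensions, since each call made by an argument extends the context and renames the values `Vs`
already found. -/
theorem RC.evalList {ρs σs : List (Ty P)} {τ : Ty P} {M : Tm P K} {env : Env P K}
    {Γ : List (Ty P)} {Ns : List (Tm P K)}
    (hNs : List.Forall₂ (fun N σ => HasType Γ N (.box σ) ∧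
      ∀ (Δ : List (Ty P)) (s : ℕ → Tm P K), REnv Γ Δ s env →
        RC (RV (.box σ)) (eval N env (.box σ) Δ.length) Δ (N.subst s)) Ns σs)
    {κ : Args P K σs → Comp P K (D P K τ)} {Δ : List (Ty P)} {s : ℕ → Tm P K}
    (hs : REnv Γ Δ s env) {Vs : List (Tm P K)} (hVs : ∀ V ∈ Vs, IsValue V)
    (hτ : HasType Δ (.box ρs (Vs ++ Ns.map (Tm.subst s)) M) τ)
    (hκ : ∀ Δ' Ws ds, RArgs (Δ' ++ Δ) Ws ds → RC (RV τ) (κ ds (Δ' ++ Δ).length) (Δ' ++ Δ)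
      (.box ρs (Vs.map (Tm.rename (· + Δ'.length)) ++ Ws) M)) :
    RC (RV τ) (((LambdaBox.evalList Ns env σs).bind κ) Δ.length) Δ
      (.box ρs (Vs ++ Ns.map (Tm.subst s)) M) := by
  induction hNs generalizing Δ s Vs with
  | nil =>
    rw [evalList_nil, Comp.ret_bind]
    have := hκ [] [] .nil .nil
    have e : Vs.map (Tm.rename (· + 0)) = Vs := map_eq_self fun V _ => rename_add_zero V
    simp only [List.length_nil, List.nil_append, List.append_nil, e] at this
    simpa using this
  | @cons N σ Ns σs hN _ ih =>
    rw [evalList_cons, Comp.bind_assoc]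
    refine RC.bind (C := .box ρs Vs (Ns.map (Tm.subst s)) M) hVs (hN.1.subst hs.hasType) hτ ?_
      (hN.2 Δ s hs)
    intro Δ' V d hV
    change RC (RV τ) ((((LambdaBox.evalList Ns env σs).bind fun ds => .ret (.cons d ds)).bind κ)
      (Δ' ++ Δ).length) _ _
    rw [Comp.bind_assoc]
    simp only [Comp.ret_bind]
    have hτ' : HasType (Δ' ++ Δ) (.box ρs (Vs.map (Tm.rename (· + Δ'.length)) ++
        V :: (Ns.map (Tm.subst s)).map (Tm.rename (· + Δ'.length))) M) τ := by
      obtain ⟨σ', h₁, h₂⟩ := Frame.hasType_fill (C := .box ρs Vs (Ns.map (Tm.subst s)) M) hτ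
      obtain rfl := (hN.1.subst hs.hasType).unique h₁
      exact h₂ (Δ' ++ Δ) _ V (fun i σ hi => by rw [getElem?_append_add, hi]) hV.hasType
    have e : (Ns.map (Tm.subst s)).map (Tm.rename (· + Δ'.length)) =
        Ns.map (Tm.subst fun i => (s i).rename (· + Δ'.length)) := by
      rw [List.map_map]
      exact List.map_congr_left fun N _ => rename_subst _ _ N
    have e' : (Frame.box ρs Vs (Ns.map (Tm.subst s)) M |>.rename (· + Δ'.length)).contract V =
        .box ρs ((Vs.map (Tm.rename (· + Δ'.length)) ++ [V]) ++
          Ns.map (Tm.subst fun i => (s i).rename (· + Δ'.length))) M := by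
      simp [Frame.rename, Frame.contract, Frame.fill, ← e]
    rw [e] at hτ'
    rw [e']
    refine ih (κ := fun ds => κ (.cons d ds)) (hs.append Δ') (fun W hW => ?_) (by simpa using hτ')
      fun Δ'' Ws ds hds => ?_
    · rcases List.mem_append.1 hW with hW | hW
      · obtain ⟨W, hW', rfl⟩ := List.mem_map.1 hW
        exact (hVs W hW').rename _
      · rw [List.mem_singleton.1 hW]
        exact hV.isValue
    · have := hV.append Δ''
      rw [← List.append_assoc] at this hds ⊢
      have := hκ (Δ'' ++ Δ') _ _ (.cons this hds)
      have e₃ : Vs.map (Tm.rename (· + Δ'.length) · |>.rename (· + Δ''.length)) =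
          Vs.map (Tm.rename (· + (Δ'' ++ Δ').length)) := by
        refine List.map_congr_left fun V _ => ?_
        rw [rename_rename, comp_add, List.length_append]
      rw [← e₃] at this
      simpa [Function.comp_def] using this

-- The fundamental theorem and normal forms

theorem HasType.rc_eval {Γ : List (Ty P)} {M : Tm P K} {τ : Ty P} (h : HasType Γ M τ)
    (hcbv : IsCbvTerm M) {Δ : List (Ty P)} {s : ℕ → Tm P K} {env : Env P K}
    (hs : REnv Γ Δ s env) : RC (RV τ) (eval M env τ Δ.length) Δ (M.subst s) := by
  induction h using HasType.induct generalizing Δ s env with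
  | hcon Γ c τ =>
    rw [eval_con, subst_con]
    exact ⟨_, .refl, RV.reflect (a := .con c τ) rfl⟩
  | hvar Γ i τ h =>
    obtain ⟨d, hd, hR⟩ := hs i τ h
    rw [eval_var hd, subst_var]
    exact ⟨_, .refl, hR⟩
  | hlam Γ σ τ M h ih =>
    rw [eval_lam]
    have ht := (HasType.lam _ _ _ _ h).subst hs.hasType
    rw [subst_lam] at ht ⊢
    refine ⟨_, .refl, .lam _ _, ht, .inr ⟨_, .refl, fun Δ' W d hW => ?_⟩⟩
    have := ih (isCbvTerm_lam.1 hcbv) ((hs.append Δ').cons hW)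
    have e : ((M.subst (upSubst s)).rename (upRen (· + Δ'.length))).inst W =
        M.subst (scons W fun i => (s i).rename (· + Δ'.length)) := by
      rw [← inst_subst, rename_subst]
      congr 2
      funext i
      cases i with
      | zero => simp
      | succ i => simp [weaken_rename]
    rw [e]
    exact this
  | happ Γ σ τ M N hM hN ihM ihN =>
    have hcbv := isCbvTerm_app.1 hcbv
    have hMs := hM.subst hs.hasType
    have hNs := hN.subst hs.hasType
    rw [hN.eval_app hs.envOK, subst_app]
    refine RC.bind (C := .appL (N.subst s)) trivial hMs (.app _ _ _ _ _ hMs hNs) ?_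
      (ihM hcbv.1 hs)
    intro Δ' V f hV
    have hs' := hs.append Δ'
    have hNs' := hN.subst hs'.hasType
    have hR := ihN hcbv.2 hs'
    have e : (Frame.appL (N.subst s) |>.rename (· + Δ'.length)).contract V =
        .app V (N.subst fun i => (s i).rename (· + Δ'.length)) := by
      simp [Frame.rename, Frame.contract, Frame.fill, rename_subst]
    rw [e]
    -- The function is reduced to an atom or an abstraction before its argument is evaluated, so
    -- that the second context is `Ready`.
    rcases hV.2.2 with ⟨y, hy, hVy, hRy⟩ | ⟨L, hVL, hRL⟩
    · refine RC.expand (hVy.appL _) (RC.bind (C := .appR y) (.inl hy) hNs'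
        (.app _ _ _ _ _ (hVy.hasType hV.hasType) hNs') (fun Δ'' W d hW => ?_) hR)
      rw [Frame.rename, Frame.contract_atom (hy.rename _)]
      exact hRy Δ'' W d hW
    · refine RC.expand (hVL.appL _) (RC.bind (C := .appR (.lam σ L)) (.inr ⟨_, _, rfl⟩) hNs'
        (.app _ _ _ _ _ (hVL.hasType hV.hasType) hNs') (fun Δ'' W d hW => ?_) hR)
      rw [Frame.rename, rename_lam]
      exact hRL Δ'' W d hW
  | hbox Γ σs τ Ns M hM h₀ ihM hN =>
    obtain ⟨hcbvN, hcbvM, hval⟩ := isCbvTerm_box.1 hcbv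
    have ht := h₀.subst hs.hasType
    rw [eval_box]
    rw [subst_box] at ht ⊢
    refine RC.evalList (Γ := Γ) (Vs := []) ?_ hs (by simp) ht fun Δ' Ws ds hds => ?_
    · clear ht h₀ hcbv hM ihM
      induction hN with
      | nil => exact .nil
      | cons h _ ih =>
        exact .cons ⟨h.fst, fun Δ s hs => h.snd (hcbvN _ (by simp)) hs⟩
          (ih fun N hN => hcbvN N (by simp [hN]))
    · exact ⟨_, .refl, hds.box hM hval fun Δ s env h => ihM hcbvM h⟩

/-- The denotations of the variables in a context. -/
noncomputable def idEnv (Γ : List (Ty P)) (i : ℕ) : Σ σ, D P K σ :=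
  match Γ[i]? with
  | some σ => ⟨σ, reflect σ (.lvl (Γ.length - 1 - i))⟩
  | none => default

theorem rEnv_idEnv (Γ : List (Ty P)) : REnv Γ Γ Tm.var (idEnv Γ : Env P K) := by
  intro i σ hi
  refine ⟨reflect σ (.lvl (Γ.length - 1 - i)), by rw [idEnv, hi], ?_⟩
  have hl := (List.getElem?_eq_some_iff.1 hi).1
  have e : Γ.length - 1 - (Γ.length - 1 - i) = i := by omega
  have := RV.reflect (K := K) (Γ := Γ) (σ := σ) (a := .lvl (Γ.length - 1 - i))
    ⟨by omega, by rw [e, hi]⟩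
  rwa [At.toTm, e] at this

/-- The normal form of a term of type `τ`. -/
noncomputable def nf (Γ : List (Ty P)) (τ : Ty P) (M : Tm P K) : Tm P K :=
  (eval M (idEnv Γ) τ Γ.length).toTm (reify τ) Γ.length

theorem HasType.steps_nf {Γ : List (Ty P)} {M : Tm P K} {τ : Ty P} (h : HasType Γ M τ)
    (hcbv : IsCbvTerm M) : Steps Γ M (nf Γ τ M) := by
  have := h.rc_eval hcbv (rEnv_idEnv Γ)
  rw [subst_var_eq] at this
  exact this.steps fun Γ V d hV => hV.steps_reify

theorem Steps.nf_eq {Γ : List (Ty P)} {M N : Tm P K} {τ : Ty P} (h : Steps Γ M N)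
    (hM : HasType Γ M τ) (hcbv : IsCbvTerm M) : nf Γ τ M = nf Γ τ N := by
  rw [nf, nf, h.eval_eq hM hcbv (rEnv_idEnv Γ).envOK]

end

end LambdaBox

theorem proposition8 {P : Type*} {K : Type*} (Γ : List (LambdaBox.Ty P)) (τ : LambdaBox.Ty P)
    (M N₁ N₂ : LambdaBox.Tm P K) (hτ : LambdaBox.HasType Γ M τ) (hM : LambdaBox.IsCbvTerm M)
    (h₁ : LambdaBox.Steps Γ M N₁) (h₂ : LambdaBox.Steps Γ M N₂) :
    ∃ L : LambdaBox.Tm P K, LambdaBox.Steps Γ N₁ L ∧ LambdaBox.Steps Γ N₂ L := by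
  -- The model needs some type for variables outside the context; any type will do.
  have : Inhabited (LambdaBox.Ty P) := ⟨τ⟩
  refine ⟨LambdaBox.nf Γ τ M, ?_, ?_⟩
  · rw [h₁.nf_eq hτ hM]
    exact (h₁.hasType hτ).steps_nf (h₁.isCbvTerm hM)
  · rw [h₂.nf_eq hτ hM]
    exact (h₂.hasType hτ).steps_nf (h₂.isCbvTerm hM)
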